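/- For integers $a,b,c$ let $P_{a,b,c}(n)$ be the number of primes $p<n$ of the form $p=ax^2+bx+c$ with $x\in\mathbb Z_{\ge 0}$. The Hardy--Littlewood Conjecture says: if $a>0$, $\gcd(a,b,c)=1$, $a+b$ and $c$ are not both even, and $\Delta=b^2-4ac$ is not a square, then $$P_{a,b,c}(n)\sim \delta(a,b,c)\frac{\sqrt n}{\log n}\quad(n\to\infty),\qquad \delta(a,b,c)=\frac{\gcd(2,a+b)}{\sqrt a}\prod_{\substack{p\mid a,\,p\mid b\\ p>2}}\frac{p}{p-1}\prod_{\substack{p\nmid a\\ p>2}}\left(1-\frac{\left(\frac{\Delta}{p}\right)}{p-1}\right)$$ (the last product being the limit of its partial products over the primes in increasing order); in particular there are infinitely many primes of this form. **Assume this conjecture.** For a nonzero integer $D$ let $E_D: y^2=x^3+Dx$, and for a prime $p$ of good reduction let $a_p(E_D)=1+p-\#\tilde E_D(\mathbb F_p)$. For a nonzero integer $r$ let $Q(r,N)$ be the set of primes $p\le N$ of the form $p=r^2+x^2$, $x\in\mathbb Z$, and let $$a_p(2r)=a_p(E_D,2r)=\lim_{N\to\infty}\frac{\#\{p\in Q(r,N):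 a_p(E_D)=2r\}}{\#Q(r,N)}.$$ Let $D=\varepsilon\,2^{\sigma}\,PQ^2L^3$ with $\varepsilon=\pm1$, $\sigma\in\{1,3\}$, $P=p_1\cdots p_r$, $Q=q_1\cdots q_s$, $L=l_1\cdots l_t$, where the $p_i,q_i,l_i$ are pairwise distinct odd primes (possibly none). Let $r_i$, $t_i$ be the numbers of prime factors $\equiv i\pmod 8$ of $P$, $L$ respectively. Let $\beta\neq0$ be an even integer. Put $D=d\bar d$, where $d>0$ is the product of the $l^{v_l(D)}$ over the odd primes $l\mid D$ with $l\mid\beta$. Let $\bar d_p,\bar d_q,\bar d_l$ be the products of the prime factors not dividing $\beta$ of $P,Q,L$ respectively; let $r'',s'',t''$ be their numbers of prime factors, and $r_i'',t_i''$ the numbers of prime factors $\equiv i\pmod 8$ of $\bar d_p,\bar d_l$. Let $\mathrm{Rad}(D)$ be the product of the odd primes dividing $D$. Let $\tau$ be the multiplicative function on the odd positive integers with $\tau(l^k)=l^{k}$ for primes $l\equiv3\pmod4$ and $\tau(l^k)=l^{k-1}(l-2)$ for primes $l\equiv1\pmod 4$. **Theorem.** All the densities below exist and have the stated values. Let $\eta=\varepsilon$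 if $\sigma=1$ (that is, $2\| D$) and $\eta=-\varepsilon$ if $\sigma=3$ (that is, $8\| D$). (1) Suppose $2\|\beta$, with the sign of $\beta$ normalised so that $\beta\equiv2\pmod 8$. (1a) If $d=1$, then $$a_p(\pm2\beta)=\frac14\left(1+\frac{(-1)^{r+t}}{\tau(PL)}\pm\eta\,\frac{2(-1)^{r_1+r_5+t_1+t_5+s}}{\tau(PQL)}\right).$$ (1b) One has $\bar d=\pm2^\sigma$ if and only if $\mathrm{Rad}(D)\mid\beta$. In this case $$a_p(\pm2\beta)=\frac12\left(1\pm(-1)^{\frac12\left(\frac D2-1\right)}\right)\ \text{ if } 2\|D,\qquad a_p(\pm2\beta)=\frac12\left(1\mp(-1)^{\frac12\left(\frac D8-1\right)}\right)\ \text{ if } 8\|D.$$ (1c) If $\bar d$ has an odd prime factor, then $$a_p(\pm2\beta)=\frac14\left(1+\frac{(-1)^{r''+t''}}{\tau(\bar d_p\bar d_l)}\pm\eta\,\frac{2(-1)^{r_1''+r_5''+t_1''+t_5''+s''+\frac{d-1}2}}{\tau(\bar d_p\bar d_q\bar d_l)}\right).$$ (2) Suppose $4\mid\beta$. If $d=1$,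 then $$a_p(2\beta)=a_p(-2\beta)=\frac14\left(1-\frac{(-1)^{r+t}}{\tau(PL)}\right);$$ and for every $d$, $$a_p(2\beta)=a_p(-2\beta)=\frac14\left(1-\frac{(-1)^{r''+t''}}{\tau(\bar d_p\bar d_l)}\right).$$ -/

import Mathlib

open Filter Topology Asymptotics

noncomputable section

/-! ### The Hardy-Littlewood conjecture for quadratic polynomials -/

/-- The number of primes less than `n` of the form `a x² + b x + c` with `x` a natural number. -/
def quadPrimeCount (a b c : ℤ) (n : ℕ) : ℕ :=
  Set.ncard {p : ℕ | p.Prime ∧ p < n ∧ ∃ x : ℕ, (p : ℤ) = a * x ^ 2 + b * x + c}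

/-- The partial product, over the odd primes `p < n` with `p ∤ a`, of
`1 - (Δ / p) / (p - 1)`, where `Δ = b² - 4ac` and `(Δ / p)` is the Legendre symbol
(the Jacobi symbol at a prime). -/
def hlPartialProduct (a b c : ℤ) (n : ℕ) : ℝ :=
  ∏ p ∈ (Finset.range n).filter (fun p : ℕ => p.Prime ∧ 2 < p ∧ ¬ (p : ℤ) ∣ a),
    (1 - (jacobiSym (b ^ 2 - 4 * a * c) p : ℝ) / ((p : ℝ) - 1))

/-- The finite factor of the Hardy-Littlewood constant:
`gcd(2, a + b) / √a * ∏_{p > 2, p ∣ a, p ∣ b} p / (p - 1)`. -/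
def hlFiniteFactor (a b : ℤ) : ℝ :=
  (Int.gcd 2 (a + b) : ℝ) / Real.sqrt (a : ℝ) *
    ∏ p ∈ a.natAbs.primeFactors.filter (fun p : ℕ => 2 < p ∧ (p : ℤ) ∣ b),
      ((p : ℝ) / ((p : ℝ) - 1))

/-- `δ` is the Hardy-Littlewood constant of `a x² + b x + c`. The infinite product converges only
conditionally, so it is the limit of its partial products over the primes in increasing order. -/
def IsHLConstant (a b c : ℤ) (δ : ℝ) : Prop :=
  Tendsto (fun n : ℕ => hlFiniteFactor a b * hlPartialProduct a b c n) atTop (𝓝 δ)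

/-- The Hardy-Littlewood conjecture on primes represented by quadratic polynomials. -/
def HardyLittlewoodConjecture : Prop :=
  ∀ a b c : ℤ, 0 < a → Int.gcd a (Int.gcd b c : ℤ) = 1 → ¬ (Even (a + b) ∧ Even c) →
    ¬ IsSquare (b ^ 2 - 4 * a * c) →
      (∃ δ : ℝ, IsHLConstant a b c δ ∧
        (fun n : ℕ => (quadPrimeCount a b c n : ℝ)) ~[atTop]
          (fun n : ℕ => δ * (Real.sqrt n / Real.log n))) ∧
      {p : ℕ | p.Prime ∧ ∃ x : ℕ, (p : ℤ) = a * x ^ 2 + b * x + c}.Infinite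

/-! ### The curve `y² = x³ + D x`, its Frobenius traces and the densities -/

/-- The curve `E_D : y² = x³ + D x`. -/
def curveE (D : ℤ) : WeierstrassCurve ℤ where
  a₁ := 0
  a₂ := 0
  a₃ := 0
  a₄ := D
  a₆ := 0

/-- `a_p(E_D) = 1 + p - #E_D(𝔽_p)` (used at primes `p` not dividing the discriminant). -/
def traceFrob (D : ℤ) (p : ℕ) : ℤ :=
  1 + (p : ℤ) -
    (Nat.card ((curveE D).map (Int.castRingHom (ZMod p))).toAffine.Point : ℤ)

/-- `Q(r, N)`: the primes `p = r² + x² ≤ N`. -/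
def quadPrimes (r : ℤ) (N : ℕ) : Set ℕ :=
  {p : ℕ | p.Prime ∧ p ≤ N ∧ ∃ x : ℤ, (p : ℤ) = r ^ 2 + x ^ 2}

/-- The density `a_p(E_D, 2r)` exists and equals `v`: among the primes `p = r² + x² ≤ N`, the
proportion of those (of good reduction) with `a_p(E_D) = 2r` tends to `v`. -/
def HasTraceDensity (D r : ℤ) (v : ℝ) : Prop :=
  Tendsto (fun N : ℕ =>
      (Set.ncard {p ∈ quadPrimes r N | ¬ (p : ℤ) ∣ (curveE D).Δ ∧ traceFrob D p = 2 * r} : ℝ) /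
        (Set.ncard (quadPrimes r N) : ℝ))
    atTop (𝓝 v)

/-! ### Arithmetic quantities in the formulas -/

/-- The multiplicative function `τ` with `τ(l^k) = l^(k-1) (l - 2)` for a prime `l ≡ 1 (mod 4)`, and
`τ(l^k) = l^k` for the other primes `l`. -/
def tauFun (n : ℕ) : ℕ :=
  ∏ l ∈ n.primeFactors, l ^ (n.factorization l - 1) * (if l % 4 = 1 then l - 2 else l)

/-- The number of prime factors of `n`. -/
def numPrimes (n : ℕ) : ℕ := n.primeFactors.card

/-- The number of prime factors `l ≡ i (mod 8)` of `n`. -/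
def numPrimesMod (n i : ℕ) : ℕ := (n.primeFactors.filter (fun l => l % 8 = i)).card

/-- The product of the prime factors of `n` that divide `β`. -/
def partDividing (β : ℤ) (n : ℕ) : ℕ :=
  ∏ l ∈ n.primeFactors.filter (fun l : ℕ => (l : ℤ) ∣ β), l

/-- The product of the prime factors of `n` that do not divide `β`. -/
def partCoprime (β : ℤ) (n : ℕ) : ℕ :=
  ∏ l ∈ n.primeFactors.filter (fun l : ℕ => ¬ (l : ℤ) ∣ β), l

/-- The factor `d` of `D = ± 2^σ P Q² L³` collecting the odd primes that divide `β`. -/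
def dPart (β : ℤ) (P Q L : ℕ) : ℕ :=
  partDividing β P * partDividing β Q ^ 2 * partDividing β L ^ 3

/-- `Rad(D)`, the product of the odd prime factors of `D`. -/
def oddRad (D : ℤ) : ℕ := ∏ l ∈ D.natAbs.primeFactors.filter (fun l => l ≠ 2), l

/-- `(-1)^(r+t) / τ(P L)`, where `r`, `t` count the prime factors of `P`, `L`. -/
def quadTerm (P L : ℕ) : ℝ :=
  (-1 : ℝ) ^ (numPrimes P + numPrimes L) / (tauFun (P * L) : ℝ)

/-- `2 (-1)^(r₁ + r₅ + t₁ + t₅ + s + m) / τ(P Q L)`, where `s` counts the prime factors of `Q`, and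
`rᵢ`, `tᵢ` those of `P`, `L` that are `≡ i (mod 8)`. -/
def quarticTerm (P Q L m : ℕ) : ℝ :=
  2 * (-1 : ℝ) ^ (numPrimesMod P 1 + numPrimesMod P 5 + numPrimesMod L 1 + numPrimesMod L 5 +
    numPrimes Q + m) / (tauFun (P * Q * L) : ℝ)

end

/-!
Let `p = X² + β²` be a prime with `β` even and `X ≡ 1 (mod 4)`, let `j = β / X` in `𝔽_p`, a square
root of `-1`, and let `χ` be the quartic residue character of `𝔽_p` with values in `ℤ[i]` for which
`χ(u) ↦ u^((p-1)/4)` under `i ↦ j`. The number of points of `y² = x³ + D x` over `𝔽_p` is given by a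
Jacobsthal sum, hence by the Jacobi sum `χ(-1) J(χ, χ²)`, whose value is `-(X + β i)`
(`IsQuarticChar.jacobiSum_eq`). It follows that `a_p(E_D) = ± 2 β` exactly when `χ(D) = ± i`
(`IsQuarticChar.traceFrob_eq_iff`). Everything thus reduces to the distribution of `χ(D)`.

The character `χ` is multiplicative, so the prime factors of `D` can be treated separately. The
values `χ(-1)` and `χ(2)` depend only on `β` (`IsQuarticChar.apply_neg_one_eq`,
`IsQuarticChar.apply_two`, after Gauss). For an odd prime `l`, Frobenius applied to the quartic Gauss
sum in characteristic `l` expresses `χ(l*)`, where `l* = ± l ≡ 1 (mod 4)`, by `X + β i` modulo `l`: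
it is a function `φ_l` of the class of `X` modulo `l` (`exists_isLocalSymbol`). If `l ∣ β` then `φ_l`
is `1`; otherwise `φ_l` is a quartic character of `(X + β i) / (X - β i)`, or of `X + β i` in the
field with `l²` elements, and its powers of exponent not divisible by `4` have sum `-1` over the
classes of `X`. As `τ(l)` is the number of classes with `l ∤ X² + β²`, the mean of such
a power is `-1 / τ(l)`.

The Hardy-Littlewood conjecture is applied to the polynomials `(m x + k)² + β²` with
`m = 4 ∏ l`. Their discriminants do not depend on `k`, nor do the constants; so the primes
`x² + β²` are equally distributed among the classes of `x` modulo `m` for which `x² + β²` is prime to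
`m`, and the density of a condition on `x` modulo `m` is the proportion of these classes that satisfy
it (`HardyLittlewoodConjecture.tendsto_ratio`).

It remains to count the classes with `χ(D) = ± i`. The indicator function of `i` among the fourth
roots of unity is a combination of the powers `w, w², w³` and `1`, and the Chinese remainder theorem
turns the mean of each power of `∏ φ_l^(v_l(D))` into a product of local means
(`card_filter_residueSymbol`). The second power involves the primes of `P` and `L` only, since
the symbols at the primes of `Q` occur with exponent `2` in `χ(D)`; the odd powers involve all the
primes. For `4 ∣ β` the symbol
of `± 2^σ` is `± 1` and the contributions of the two odd powers cancel; for `β ≡ 2 (mod 8)` it is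
`± i` and they add up.
-/

/-! ### The quartic residue character of a finite field -/

/-- The imaginary unit of the Gaussian integers. -/
def gaussI : GaussianInt := ⟨0, 1⟩

lemma gaussI_sq : gaussI ^ 2 = -1 := by decide

lemma gaussI_pow_four : gaussI ^ 4 = 1 := by decide

lemma gaussI_pow_mod (n : ℕ) : gaussI ^ n = gaussI ^ (n % 4) :=
  pow_eq_pow_mod n gaussI_pow_four

lemma pow_mod_four_of_sq_eq_neg_one {R : Type*} [CommRing R] {j : R} (hj : j ^ 2 = -1) (n : ℕ) :
    j ^ n = j ^ (n % 4) :=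
  pow_eq_pow_mod n (by rw [show (4 : ℕ) = 2 * 2 from rfl, pow_mul, hj]; norm_num)

/-- The ring homomorphism from the Gaussian integers sending the imaginary unit to `j`. -/
def gaussLift {R : Type*} [CommRing R] (j : R) (hj : j ^ 2 = -1) : GaussianInt →+* R :=
  Zsqrtd.lift ⟨j, by rw [← sq, hj]; simp⟩

lemma gaussLift_apply {R : Type*} [CommRing R] (j : R) (hj : j ^ 2 = -1) (z : GaussianInt) :
    gaussLift j hj z = z.re + z.im * j := by
  simp [gaussLift, Zsqrtd.lift]

lemma gaussLift_gaussI {R : Type*} [CommRing R] (j : R) (hj : j ^ 2 = -1) :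
    gaussLift j hj gaussI = j := by
  simp [gaussLift_apply, gaussI]

/-- Powers of a square root of `-1` are distinguished by exponents modulo `4`. -/
lemma pow_eq_pow_iff_of_sq_eq_neg_one {K : Type*} [Field K] (h2 : (2 : K) ≠ 0) {j : K}
    (hj : j ^ 2 = -1) {m n : ℕ} (h : j ^ m = j ^ n) : gaussI ^ m = gaussI ^ n := by
  have hord : orderOf j = 2 ^ 2 := by
    refine orderOf_eq_prime_pow (fun h => h2 ?_) ?_
    · rw [pow_one, hj] at h; linear_combination -h
    · rw [show (2 : ℕ) ^ (1 + 1) = 2 * 2 from rfl, pow_mul, hj]; norm_num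
  have hfin : IsOfFinOrder j := orderOf_pos_iff.1 (by rw [hord]; norm_num)
  have hmod := (hfin.pow_eq_pow_iff_modEq).1 h
  rw [hord] at hmod
  rw [gaussI_pow_mod m, gaussI_pow_mod n]
  exact congrArg _ hmod

/-- `χ` is the quartic residue character of the finite field `K` (of order `q ≡ 1 (mod 4)`), with
values in the Gaussian integers, for the choice `j ∈ K` of a square root of `-1`:
`χ(u) = iⁿ` when `u^((q-1)/4) = jⁿ`. -/
def IsQuarticChar {K : Type*} [Field K] [Fintype K] (j : K) (χ : MulChar K GaussianInt) : Prop :=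
  ∀ u : K, u ≠ 0 → ∃ n : ℕ, χ u = gaussI ^ n ∧ u ^ ((Fintype.card K - 1) / 4) = j ^ n

lemma exists_isQuarticChar {K : Type*} [Field K] [Fintype K]
    (hq : 4 ∣ Fintype.card K - 1) {j : K} (hj : j ^ 2 = -1) :
    ∃ χ : MulChar K GaussianInt, IsQuarticChar j χ ∧ ∃ g : K, χ g = gaussI := by
  classical
  obtain ⟨g, hg⟩ := IsCyclic.exists_generator (α := Kˣ)
  have hcard : Fintype.card Kˣ = Fintype.card K - 1 := Fintype.card_units K
  set m := (Fintype.card K - 1) / 4 with hm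
  have hm4 : m * 4 = Fintype.card K - 1 := Nat.div_mul_cancel hq
  have hord : orderOf g = m * 4 := by
    rw [orderOf_eq_card_of_forall_mem_zpowers hg, Nat.card_eq_fintype_card, hcard, hm4]
  have hmpos : 0 < m := by
    have := Fintype.one_lt_card (α := K)
    omega
  -- replacing `g` by its inverse, its power of exponent `m` is `j` and not `-j`
  have key : ∃ g : Kˣ, (∀ x, x ∈ Subgroup.zpowers g) ∧ (g : K) ^ m = j := by
    have h4 : ((g : K) ^ m) ^ 4 = 1 := by
      have : g ^ (m * 4) = 1 := hord ▸ pow_orderOf_eq_one g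
      rw [← pow_mul, ← Units.val_pow_eq_pow_val, this, Units.val_one]
    have hne : ((g : K) ^ m) ^ 2 ≠ 1 := by
      intro h
      have : g ^ (m * 2) = 1 := by
        apply Units.ext; push_cast; rw [pow_mul]; exact h
      have := orderOf_dvd_of_pow_eq_one this
      rw [hord] at this
      have := Nat.le_of_dvd (by omega) this
      omega
    have hsq : ((g : K) ^ m) ^ 2 = -1 := by
      have : (((g : K) ^ m) ^ 2 - 1) * (((g : K) ^ m) ^ 2 + 1) = 0 := by linear_combination h4
      rcases mul_eq_zero.1 this with h | h
      · exact absurd (by linear_combination h) hne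
      · linear_combination h
    have : ((g : K) ^ m - j) * ((g : K) ^ m + j) = 0 := by linear_combination hsq - hj
    rcases mul_eq_zero.1 this with h | h
    · exact ⟨g, hg, by linear_combination h⟩
    · refine ⟨g⁻¹, fun x => by simpa using hg x, ?_⟩
      have hg0 : (g : K) ^ m = -j := by linear_combination h
      have hj0 : j ≠ 0 := by rintro rfl; norm_num at hj
      rw [Units.val_inv_eq_inv_val, inv_pow, hg0]
      rw [inv_eq_iff_eq_inv]
      exact eq_inv_of_mul_eq_one_left (by linear_combination -hj)
  obtain ⟨g, hg, hgj⟩ := key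
  let ζ : GaussianIntˣ := ⟨gaussI, -gaussI, by decide, by decide⟩
  have hζ : ζ ∈ rootsOfUnity (Fintype.card Kˣ) GaussianInt := by
    rw [mem_rootsOfUnity, hcard, ← hm4, mul_comm, pow_mul]
    have : ζ ^ 4 = 1 := Units.ext (by push_cast; exact gaussI_pow_four)
    rw [this, one_pow]
  refine ⟨MulChar.ofRootOfUnity hζ hg, ?_, g, MulChar.ofRootOfUnity_spec hζ hg⟩
  intro u hu
  obtain ⟨n, hn⟩ := (mem_powers_iff_mem_zpowers (x := g)).2 (hg (Units.mk0 u hu))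
  have hun : u = (g : K) ^ n := by
    have := congrArg Units.val hn
    simpa using this.symm
  refine ⟨n, ?_, ?_⟩
  · rw [hun, map_pow, MulChar.ofRootOfUnity_spec hζ hg]
  · rw [hun, ← pow_mul, mul_comm, pow_mul, hgj]

namespace IsQuarticChar

variable {K : Type*} [Field K] [Fintype K] {j : K} {χ : MulChar K GaussianInt}

lemma apply_eq (hχ : IsQuarticChar j χ) (h2 : (2 : K) ≠ 0) (hj : j ^ 2 = -1) {u : K} (hu : u ≠ 0)
    {n : ℕ} (hn : u ^ ((Fintype.card K - 1) / 4) = j ^ n) : χ u = gaussI ^ n := by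
  obtain ⟨m, hm, hm'⟩ := hχ u hu
  rw [hm]
  exact pow_eq_pow_iff_of_sq_eq_neg_one h2 hj (hm'.symm.trans hn)

/-- Reducing a quartic residue character gives the power map. -/
lemma map_apply (hχ : IsQuarticChar j χ) {R : Type*} [CommRing R] (f : GaussianInt →+* R)
    (g : K →+* R) (hfg : f gaussI = g j) {u : K} (hu : u ≠ 0) :
    f (χ u) = g u ^ ((Fintype.card K - 1) / 4) := by
  obtain ⟨m, hm, hm'⟩ := hχ u hu
  rw [hm, map_pow, hfg, ← map_pow, ← map_pow, hm']

lemma pow_four (hχ : IsQuarticChar j χ) {u : K} (hu : u ≠ 0) : χ u ^ 4 = 1 := by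
  obtain ⟨m, hm, -⟩ := hχ u hu
  rw [hm, ← pow_mul, mul_comm, pow_mul, gaussI_pow_four, one_pow]

lemma pow_four_eq_one (hχ : IsQuarticChar j χ) : χ ^ 4 = 1 := by
  refine MulChar.ext fun u => ?_
  rw [MulChar.pow_apply_coe, hχ.pow_four u.ne_zero, MulChar.one_apply_coe]

lemma inv_eq (hχ : IsQuarticChar j χ) : χ⁻¹ = χ ^ 3 := by
  rw [inv_eq_iff_mul_eq_one, ← pow_succ']; exact hχ.pow_four_eq_one

lemma star_apply (hχ : IsQuarticChar j χ) (u : K) : star (χ u) = χ⁻¹ u := by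
  by_cases hu : u = 0
  · subst hu; simp [MulChar.map_zero]
  · obtain ⟨m, hm, -⟩ := hχ u hu
    rw [hχ.inv_eq, MulChar.pow_apply' _ (by norm_num), hm, star_pow, ← pow_mul, mul_comm, pow_mul]
    congr 1

lemma sq_apply (hχ : IsQuarticChar j χ) [DecidableEq K] (h2 : (2 : K) ≠ 0) (hj : j ^ 2 = -1)
    (hq : 4 ∣ Fintype.card K - 1) (u : K) :
    (χ ^ 2) u = ((quadraticChar K u : ℤ) : GaussianInt) := by
  rw [MulChar.pow_apply' _ (by norm_num)]
  by_cases hu : u = 0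
  · subst hu; simp [MulChar.map_zero]
  have hc : ringChar K ≠ 2 := fun h => h2 (by
    have := ringChar.Nat.cast_ringChar (R := K); rw [h] at this; exact_mod_cast this)
  obtain ⟨m, hm, hm'⟩ := hχ u hu
  have hcard : Fintype.card K / 2 = (Fintype.card K - 1) / 4 * 2 := by
    have := Fintype.one_lt_card (α := K)
    omega
  have h1 := quadraticChar_eq_pow_of_char_ne_two' hc u
  rw [hcard, pow_mul, hm', ← pow_mul, mul_comm, pow_mul, hj] at h1
  rw [hm, ← pow_mul, mul_comm, pow_mul, gaussI_sq]
  have h11 : (1 : K) ≠ -1 := fun h => h2 (by linear_combination h)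
  rcases neg_one_pow_eq_or K m with h | h <;>
  rcases Nat.even_or_odd m with hm | hm <;>
  rcases quadraticChar_dichotomy hu with h' | h' <;>
  simp_all [hm.neg_one_pow]

end IsQuarticChar

lemma MulChar.pow_ne_one_of_apply_eq_gaussI {K : Type*} [Field K] {χ : MulChar K GaussianInt}
    (hg : ∃ g, χ g = gaussI) {n : ℕ} (hn : ¬ 4 ∣ n) : χ ^ n ≠ 1 := by
  obtain ⟨g, hg⟩ := hg
  intro h
  have hg0 : g ≠ 0 := by
    rintro rfl
    rw [MulChar.map_zero] at hg
    exact absurd hg (by decide)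
  have h1 : (χ ^ n) g = (1 : MulChar K GaussianInt) g := by rw [h]
  rw [MulChar.pow_apply' _ (by rintro rfl; exact hn (dvd_zero 4)), hg,
    MulChar.one_apply hg0.isUnit, gaussI_pow_mod] at h1
  have hlt := Nat.mod_lt n (show 0 < 4 by norm_num)
  have hne : n % 4 ≠ 0 := fun h => hn (Nat.dvd_of_mod_eq_zero h)
  generalize n % 4 = a at *
  interval_cases a
  · exact hne rfl
  all_goals exact absurd h1 (by decide)

/-! ### Frobenius traces and Jacobi sums -/

/-- The Jacobsthal sum `∑ ρ(x³ + D x)` over `𝔽_p`, where `ρ` is the quadratic character. -/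
def jacobsthal (p : ℕ) [Fact p.Prime] (D : ZMod p) : ℤ :=
  ∑ x : ZMod p, quadraticChar (ZMod p) (x ^ 3 + D * x)

lemma traceFrob_eq_neg_jacobsthal (D : ℤ) (p : ℕ) [Fact p.Prime] (hp2 : p ≠ 2)
    (hΔ : ¬ (p : ℤ) ∣ (curveE D).Δ) : traceFrob D p = -jacobsthal p (D : ZMod p) := by
  classical
  set W : WeierstrassCurve.Affine (ZMod p) :=
    ((curveE D).map (Int.castRingHom (ZMod p))).toAffine with hW
  have hWΔ : W.Δ ≠ 0 := by
    rw [hW]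
    change ((curveE D).map (Int.castRingHom (ZMod p))).Δ ≠ 0
    rw [WeierstrassCurve.map_Δ]
    intro h
    exact hΔ ((ZMod.intCast_zmod_eq_zero_iff_dvd _ _).1 (by simpa using h))
  have heq : ∀ x y : ZMod p, W.Equation x y ↔ y ^ 2 = x ^ 3 + (D : ZMod p) * x := by
    intro x y
    rw [WeierstrassCurve.Affine.equation_iff]
    simp [hW, curveE, WeierstrassCurve.toAffine]
  have e : W.Point ≃ Option {xy : ZMod p × ZMod p // xy.2 ^ 2 = xy.1 ^ 3 + (D : ZMod p) * xy.1} :=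
    { toFun := fun P => match P with
        | .zero => none
        | .some x y h => some ⟨(x, y), (heq x y).1
            ((WeierstrassCurve.Affine.equation_iff_nonsingular_of_Δ_ne_zero hWΔ).2 h)⟩
      invFun := fun o => match o with
        | none => .zero
        | some q => .some q.1.1 q.1.2
            ((WeierstrassCurve.Affine.equation_iff_nonsingular_of_Δ_ne_zero hWΔ).1
              ((heq _ _).2 q.2))
      left_inv := fun P => by cases P <;> rfl
      right_inv := fun o => by cases o <;> rfl }
  have hchar : ringChar (ZMod p) ≠ 2 := by rwa [ZMod.ringChar_zmod_n]
  have hcount : (Fintype.card {xy : ZMod p × ZMod p //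
      xy.2 ^ 2 = xy.1 ^ 3 + (D : ZMod p) * xy.1} : ℤ) = p + jacobsthal p (D : ZMod p) := by
    rw [Fintype.card_subtype, Finset.card_filter, Nat.cast_sum, Fintype.sum_prod_type]
    have : ∀ x : ZMod p, ∑ y : ZMod p, ((if y ^ 2 = x ^ 3 + (D : ZMod p) * x then 1 else 0 : ℕ) : ℤ)
        = quadraticChar (ZMod p) (x ^ 3 + D * x) + 1 := by
      intro x
      rw [← quadraticChar_card_sqrts hchar, ← Nat.cast_sum, ← Finset.card_filter]
      congr 2
      ext y; simp
    rw [Finset.sum_congr rfl fun x _ => this x, Finset.sum_add_distrib]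
    simp [jacobsthal, ZMod.card, add_comm]
  have : (Nat.card W.Point : ℤ) = p + jacobsthal p (D : ZMod p) + 1 := by
    rw [Nat.card_congr e, Nat.card_eq_fintype_card, Fintype.card_option]
    push_cast
    rw [hcount]
  rw [traceFrob, ← hW, this]
  ring

section JacobiSum

variable {p : ℕ} [Fact p.Prime] {j : ZMod p} {χ : MulChar (ZMod p) GaussianInt}

/-- The Jacobsthal sum in terms of Jacobi sums: substitute `u = x²`, using `ρ(x) = χ(x²)`. -/
lemma jacobsthal_eq_jacobiSum (hχ : IsQuarticChar j χ) (hj : j ^ 2 = -1) (hp : p % 4 = 1)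
    {D : ZMod p} (hD : D ≠ 0) :
    (jacobsthal p D : GaussianInt) =
      star (χ D) * (χ (-1) * jacobiSum χ (χ ^ 2)) +
        χ D * star (χ (-1) * jacobiSum χ (χ ^ 2)) := by
  have h2 : (2 : ZMod p) ≠ 0 := by
    intro h
    have := (ZMod.natCast_eq_zero_iff 2 p).1 (by exact_mod_cast h)
    have := (Nat.prime_dvd_prime_iff_eq Fact.out Nat.prime_two).1 this
    omega
  have hq : 4 ∣ Fintype.card (ZMod p) - 1 := by rw [ZMod.card]; omega
  have hchar : ringChar (ZMod p) ≠ 2 := by rw [ZMod.ringChar_zmod_n]; omega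
  have hρ := hχ.sq_apply h2 hj hq
  have hpow : ∀ u, (χ ^ 2) u = χ u ^ 2 := fun u => MulChar.pow_apply' _ (by norm_num) u
  have hstar : star (jacobiSum χ (χ ^ 2)) = ∑ u, χ⁻¹ u * (χ ^ 2) (1 - u) := by
    rw [jacobiSum, star_sum]
    refine Finset.sum_congr rfl fun u _ => ?_
    rw [star_mul', hχ.star_apply, hρ]
    simp
  have hneg1 : χ (-1) * χ (-1) = 1 := by rw [← map_mul]; simp
  have hstar1 : star (χ (-1)) = χ (-1) := by
    rw [hχ.star_apply, hχ.inv_eq, MulChar.pow_apply' _ (by norm_num)]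
    linear_combination χ (-1) * hneg1
  -- the substitution `u ↦ -D u` isolates the dependence on `D`
  have hsum : ∀ φ : MulChar (ZMod p) GaussianInt,
      ∑ u, φ u * (χ ^ 2) (u + D) = φ (-1) * (φ D * χ D ^ 2) * ∑ u, φ u * (χ ^ 2) (1 - u) := by
    intro φ
    rw [← Equiv.sum_comp (Equiv.mulLeft₀ (-D) (neg_ne_zero.2 hD)), Finset.mul_sum]
    refine Finset.sum_congr rfl fun u _ => ?_
    change φ (-D * u) * (χ ^ 2) (-D * u + D) = _
    rw [show -D * u + D = D * (1 - u) by ring, show -D * u = (-1) * (D * u) by ring,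
      map_mul, map_mul, map_mul, hpow D]
    ring
  have h1 : (jacobsthal p D : GaussianInt) = ∑ x : ZMod p, χ (x ^ 2) * (χ ^ 2) (x ^ 2 + D) := by
    rw [jacobsthal, Int.cast_sum]
    refine Finset.sum_congr rfl fun x _ => ?_
    rw [← hρ, show x ^ 3 + D * x = x * (x ^ 2 + D) by ring, map_mul, hpow x, map_pow]
  have h3 : ∑ x : ZMod p, χ (x ^ 2) * (χ ^ 2) (x ^ 2 + D) =
      ∑ u, (χ u + χ⁻¹ u) * (χ ^ 2) (u + D) := by
    rw [← Finset.sum_fiberwise (g := fun x : ZMod p => x ^ 2)]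
    refine Finset.sum_congr rfl fun u _ => ?_
    have : ∀ x ∈ Finset.univ.filter (fun x : ZMod p => x ^ 2 = u),
        χ (x ^ 2) * (χ ^ 2) (x ^ 2 + D) = χ u * (χ ^ 2) (u + D) := by
      intro x hx; rw [(Finset.mem_filter.1 hx).2]
    rw [Finset.sum_congr rfl this, Finset.sum_const, nsmul_eq_mul]
    have hc := quadraticChar_card_sqrts hchar u
    have : (((Finset.univ.filter (fun x : ZMod p => x ^ 2 = u)).card : ℤ) : GaussianInt) =
        χ u ^ 2 + 1 := by
      have hc' : ((Finset.univ.filter (fun x : ZMod p => x ^ 2 = u)).card : ℤ) =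
          quadraticChar (ZMod p) u + 1 := by
        rw [← hc]
        congr 2
        ext y; simp
      rw [hc', Int.cast_add, ← hρ, hpow, Int.cast_one]
    rw [Int.cast_natCast] at this
    rw [this, hχ.inv_eq, MulChar.pow_apply' χ (n := 3) (by norm_num)]
    ring
  have hs : star (χ D) = χ D ^ 3 := by
    rw [hχ.star_apply, hχ.inv_eq, MulChar.pow_apply' _ (by norm_num)]
  rw [h1, h3]
  simp_rw [add_mul]
  rw [Finset.sum_add_distrib, hsum χ, hsum χ⁻¹, star_mul', hstar, hstar1, hs, jacobiSum]
  have h4 := hχ.pow_four hD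
  rw [← hχ.star_apply (-1), hstar1, ← hχ.star_apply D, hs]
  linear_combination (χ (-1) * χ D * ∑ u, χ⁻¹ u * (χ ^ 2) (1 - u)) * h4

lemma IsQuarticChar.jacobiSum_mul_star (hχ : IsQuarticChar j χ) (hg : ∃ g, χ g = gaussI) :
    jacobiSum χ (χ ^ 2) * star (jacobiSum χ (χ ^ 2)) = (p : GaussianInt) := by
  have hstar : star (jacobiSum χ (χ ^ 2)) = jacobiSum χ⁻¹ (χ ^ 2)⁻¹ := by
    rw [jacobiSum, jacobiSum, star_sum]
    refine Finset.sum_congr rfl fun u _ => ?_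
    rw [star_mul', hχ.star_apply, MulChar.pow_apply' _ (by norm_num), star_pow, hχ.star_apply,
      ← inv_pow, MulChar.pow_apply' _ (by norm_num)]
  have hinj : Function.Injective GaussianInt.toComplex := fun a b h => by
    simpa using h
  have h1 : χ.ringHomComp GaussianInt.toComplex ≠ 1 := by
    rw [MulChar.ringHomComp_ne_one_iff hinj]
    simpa using MulChar.pow_ne_one_of_apply_eq_gaussI hg (n := 1) (by norm_num)
  have h2 : (χ ^ 2).ringHomComp GaussianInt.toComplex ≠ 1 := by
    rw [MulChar.ringHomComp_ne_one_iff hinj]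
    exact MulChar.pow_ne_one_of_apply_eq_gaussI hg (n := 2) (by norm_num)
  have h3 : χ.ringHomComp GaussianInt.toComplex * (χ ^ 2).ringHomComp GaussianInt.toComplex
      ≠ 1 := by
    rw [← MulChar.ringHomComp_mul, MulChar.ringHomComp_ne_one_iff hinj, ← pow_succ']
    exact MulChar.pow_ne_one_of_apply_eq_gaussI hg (n := 3) (by norm_num)
  have hr : ringChar ℂ ≠ ringChar (ZMod p) := by
    rw [ZMod.ringChar_zmod_n, ringChar.eq_zero]
    exact (Fact.out : p.Prime).ne_zero.symm
  have := jacobiSum_mul_jacobiSum_inv hr h1 h2 h3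
  rw [MulChar.ringHomComp_inv, MulChar.ringHomComp_inv, jacobiSum_ringHomComp,
    jacobiSum_ringHomComp, ← map_mul, ZMod.card] at this
  rw [hstar]
  exact hinj (by rw [this, map_natCast])

/-- Since `χ - 1` is divisible by `1 + i` and `χ² - 1` by `2` on nonzero arguments, the Jacobi sum
is `-p` modulo `2 + 2i`. -/
lemma IsQuarticChar.dvd_jacobiSum_add (hχ : IsQuarticChar j χ) (hg : ∃ g, χ g = gaussI) :
    (⟨2, 2⟩ : GaussianInt) ∣ jacobiSum χ (χ ^ 2) + p := by
  have h1 : χ ≠ 1 := by simpa using MulChar.pow_ne_one_of_apply_eq_gaussI hg (n := 1) (by norm_num)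
  have h2 : χ ^ 2 ≠ 1 := MulChar.pow_ne_one_of_apply_eq_gaussI hg (n := 2) (by norm_num)
  have e : jacobiSum χ (χ ^ 2) + p =
      ∑ x ∈ Finset.univ \ {0, 1}, (χ x - 1) * ((χ ^ 2) (1 - x) - 1) := by
    have s1 : ∑ x ∈ Finset.univ \ {0, 1}, χ x = -1 := by
      rw [Finset.sum_sdiff_eq_sub (Finset.subset_univ _), MulChar.sum_eq_zero_of_ne_one h1,
        Finset.sum_pair zero_ne_one]
      simp [MulChar.map_zero]
    have s2 : ∑ x ∈ Finset.univ \ {0, 1}, (χ ^ 2) (1 - x) = -1 := by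
      rw [Finset.sum_sdiff_eq_sub (Finset.subset_univ _), Finset.sum_pair zero_ne_one,
        show ∑ x : ZMod p, (χ ^ 2) (1 - x) = ∑ x, (χ ^ 2) x from
          Equiv.sum_comp (Equiv.subLeft (1 : ZMod p)) (fun x => (χ ^ 2) x),
        MulChar.sum_eq_zero_of_ne_one h2]
      simp [MulChar.map_zero]
    have s3 : ∑ x ∈ Finset.univ \ ({0, 1} : Finset (ZMod p)), (1 : GaussianInt) = p - 2 := by
      rw [Finset.sum_sdiff_eq_sub (Finset.subset_univ _), Finset.sum_pair zero_ne_one]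
      simp [ZMod.card]; norm_num
    have s4 : ∀ x : ZMod p, (χ x - 1) * ((χ ^ 2) (1 - x) - 1) =
        χ x * (χ ^ 2) (1 - x) - χ x - (χ ^ 2) (1 - x) + 1 := fun x => by ring
    simp_rw [s4]
    rw [Finset.sum_add_distrib, Finset.sum_sub_distrib, Finset.sum_sub_distrib, s1, s2, s3,
      jacobiSum_eq_sum_sdiff]
    ring
  rw [e]
  refine Finset.dvd_sum fun x hx => ?_
  simp only [Finset.mem_sdiff, Finset.mem_univ, true_and, Finset.mem_insert,
    Finset.mem_singleton, not_or] at hx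
  obtain ⟨m, hm, -⟩ := hχ x hx.1
  obtain ⟨n, hn, -⟩ := hχ (1 - x) (sub_ne_zero.2 (Ne.symm hx.2))
  rw [hm, MulChar.pow_apply' _ (by norm_num), hn, ← pow_mul, mul_comm, gaussI_pow_mod m,
    mul_comm n 2, pow_mul, gaussI_sq]
  have h22 : (⟨2, 2⟩ : GaussianInt) = 2 * ⟨1, 1⟩ := by decide
  rw [h22]
  refine mul_dvd_mul ?_ ?_
  · rcases neg_one_pow_eq_or GaussianInt n with h | h <;> rw [h]
    · simp
    · exact ⟨-1, by norm_num⟩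
  · have hlt := Nat.mod_lt m (show 0 < 4 by norm_num)
    generalize m % 4 = a at *
    interval_cases a
    exacts [⟨0, by decide⟩, ⟨⟨0, 1⟩, by decide⟩, ⟨⟨-1, 1⟩, by decide⟩, ⟨-1, by decide⟩]

/-- Modulo the prime of `ℤ[i]` above `p` for which `χ` is the quartic residue character, the Jacobi sum is a
power sum of degree less than `p - 1`, hence zero. -/
lemma IsQuarticChar.map_jacobiSum (hχ : IsQuarticChar j χ) (hj : j ^ 2 = -1) (hp : p % 4 = 1) :
    gaussLift j hj (jacobiSum χ (χ ^ 2)) = 0 := by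
  have hp1 := (Fact.out : p.Prime).one_lt
  set m := (p - 1) / 4 with hm
  have hm4 : m * 4 = p - 1 := Nat.div_mul_cancel (by omega)
  have hm0 : m ≠ 0 := by omega
  have hmap : ∀ u : ZMod p, gaussLift j hj (χ u) = u ^ m := by
    intro u
    by_cases hu : u = 0
    · subst hu; rw [MulChar.map_zero, map_zero, zero_pow hm0]
    · have := hχ.map_apply (gaussLift j hj) (RingHom.id _) (gaussLift_gaussI j hj) hu
      rw [ZMod.card] at this
      exact this
  rw [jacobiSum, map_sum]
  have : ∀ u : ZMod p, gaussLift j hj (χ u * (χ ^ 2) (1 - u)) =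
      ∑ k ∈ Finset.range (m * 2 + 1), ((-1) ^ k * ((m * 2).choose k : ZMod p)) * u ^ (m + k) := by
    intro u
    rw [map_mul, MulChar.pow_apply' _ (by norm_num), map_pow, hmap, hmap, ← pow_mul, sub_eq_neg_add,
      add_pow, Finset.mul_sum]
    refine Finset.sum_congr rfl fun k _ => ?_
    rw [one_pow, neg_pow, pow_add]
    ring
  rw [Finset.sum_congr rfl fun u _ => this u, Finset.sum_comm]
  refine Finset.sum_eq_zero fun k hk => ?_
  rw [← Finset.mul_sum, FiniteField.sum_pow_lt_card_sub_one, mul_zero]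
  rw [ZMod.card]
  have := Finset.mem_range.1 hk
  omega

lemma ZMod.two_ne_zero_of_mod_four (hp : p % 4 = 1) : (2 : ZMod p) ≠ 0 := by
  intro h
  have := (ZMod.natCast_eq_zero_iff 2 p).1 (by exact_mod_cast h)
  have := (Nat.prime_dvd_prime_iff_eq Fact.out Nat.prime_two).1 this
  omega

lemma IsQuarticChar.apply_neg_one (hχ : IsQuarticChar j χ) (hj : j ^ 2 = -1) (hp : p % 4 = 1) :
    χ (-1) = (-1) ^ ((p - 1) / 4) := by
  rw [hχ.apply_eq (ZMod.two_ne_zero_of_mod_four hp) hj (neg_ne_zero.2 one_ne_zero)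
    (n := 2 * ((p - 1) / 4)) (by rw [ZMod.card, pow_mul, hj]), pow_mul, gaussI_sq]

/-- The Jacobi sum attached to the quartic residue character of `p = X² + β²`, with the sign of `X`
normalised by `X ≡ 1 (mod 4)`. -/
lemma IsQuarticChar.jacobiSum_eq (hχ : IsQuarticChar j χ) (hg : ∃ g, χ g = gaussI)
    (hj : j ^ 2 = -1) {X β : ℤ} (hpX : (p : ℤ) = X ^ 2 + β ^ 2) (hX : X % 4 = 1) (hβ : 2 ∣ β)
    (hjX : j * X = β) : χ (-1) * jacobiSum χ (χ ^ 2) = -⟨X, β⟩ := by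
  obtain ⟨w, rfl⟩ := hβ
  obtain ⟨y, rfl⟩ : ∃ y, X = 4 * y + 1 := ⟨X / 4, by omega⟩
  have hp8 : (p : ℤ) = 8 * (2 * y ^ 2 + y) + 1 + 4 * w ^ 2 := by rw [hpX]; ring
  have hp : p % 4 = 1 := by omega
  have hp0 : (0 : ℤ) < p := by exact_mod_cast (Fact.out : p.Prime).pos
  rw [hχ.apply_neg_one hj hp]
  have hnorm := hχ.jacobiSum_mul_star hg
  have hmod := hχ.map_jacobiSum hj hp
  obtain ⟨⟨c, d⟩, hcd⟩ := hχ.dvd_jacobiSum_add hg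
  rw [gaussLift_apply] at hmod
  rcases hJ : jacobiSum χ (χ ^ 2) with ⟨a, b⟩
  rw [hJ] at hnorm hcd hmod
  have e1 : a ^ 2 + b ^ 2 = p := by
    have := congrArg Zsqrtd.re hnorm
    simp [Zsqrtd.re_mul] at this
    linear_combination this
  have e2 : a + p = 2 * c - 2 * d := by
    have := congrArg Zsqrtd.re hcd
    simp [Zsqrtd.re_mul] at this
    linear_combination this
  have e3 : b = 2 * c + 2 * d := by
    have := congrArg Zsqrtd.im hcd
    simp [Zsqrtd.im_mul] at this
    linear_combination this
  have e4 : (p : ℤ) ∣ a * (4 * y + 1) + b * (2 * w) := by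
    rw [← ZMod.intCast_zmod_eq_zero_iff_dvd]
    push_cast at hjX ⊢
    simp only [] at hmod
    linear_combination (4 * (y : ZMod p) + 1) * hmod - (b : ZMod p) * hjX
  obtain ⟨k, hk⟩ := e4
  -- the Jacobi sum has the norm of `X + β i` and is divisible by the same prime above `p`, so it is
  -- `k (X + β i)` with `k = ± 1`
  have hk1 : k ^ 2 ≤ 1 := by
    have : (p * k) ^ 2 + (a * (2 * w) - b * (4 * y + 1)) ^ 2 = (p : ℤ) ^ 2 := by
      rw [← hk]
      calc _ = (a ^ 2 + b ^ 2) * ((4 * y + 1) ^ 2 + (2 * w) ^ 2) := by ring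
        _ = _ := by rw [e1, ← hpX]; ring
    nlinarith [sq_nonneg (a * (2 * w) - b * (4 * y + 1)), mul_pos hp0 hp0]
  have hkodd : k ≠ 0 := by
    rintro rfl
    -- `a X + b β` is odd
    have : a * (4 * y + 1) + b * (2 * w) = 2 * (2 * a * y + b * w) + a := by ring
    omega
  have hk2 : k ^ 2 = 1 := by
    have : 0 < k ^ 2 := by positivity
    omega
  have e5 : a * (2 * w) = b * (4 * y + 1) := by
    have h : (p * k) ^ 2 + (a * (2 * w) - b * (4 * y + 1)) ^ 2 = (p : ℤ) ^ 2 := by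
      rw [← hk]
      calc _ = (a ^ 2 + b ^ 2) * ((4 * y + 1) ^ 2 + (2 * w) ^ 2) := by ring
        _ = _ := by rw [e1, ← hpX]; ring
    have : (a * (2 * w) - b * (4 * y + 1)) ^ 2 = 0 := by linear_combination h - p ^ 2 * hk2
    linarith [pow_eq_zero_iff (two_ne_zero) |>.1 this]
  have ea : a = k * (4 * y + 1) := by
    have : (p : ℤ) * (a - k * (4 * y + 1)) = 0 := by
      linear_combination a * hpX + (4 * y + 1) * hk + 2 * w * e5
    rcases mul_eq_zero.1 this with h | h <;> linarith
  have eb : b = k * (2 * w) := by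
    have : (p : ℤ) * (b - k * (2 * w)) = 0 := by
      linear_combination b * hpX + (2 * w) * hk - (4 * y + 1) * e5
    rcases mul_eq_zero.1 this with h | h <;> linarith
  -- the congruence modulo `2 + 2 i` fixes the sign
  have hexp : (((p - 1) / 4 : ℕ) : ℤ) = 2 * (2 * y ^ 2 + y) + w ^ 2 := by omega
  have hw : ∀ v : ℤ, w = 2 * v + 1 → w ^ 2 = 4 * (v ^ 2 + v) + 1 := by rintro v rfl; ring
  have hw' : ∀ v : ℤ, w = v + v → w ^ 2 = 4 * v ^ 2 := by rintro v rfl; ring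
  rcases mul_self_eq_one_iff.1 ((sq k).symm.trans hk2) with rfl | rfl
  · have hodd : Odd ((p - 1) / 4) := by
      rcases Int.even_or_odd w with ⟨v, hv⟩ | ⟨v, hv⟩
      · have := hw' v hv; omega
      · have := hw v hv
        rw [Nat.odd_iff]; omega
    rw [hodd.neg_one_pow, ea, eb]
    simp
  · have heven : Even ((p - 1) / 4) := by
      rcases Int.even_or_odd w with ⟨v, hv⟩ | ⟨v, hv⟩
      · have := hw' v hv
        rw [Nat.even_iff]; omega
      · have := hw v hv; omega
    rw [heven.neg_one_pow, ea, eb, one_mul]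
    ext <;> simp

/-- For `p = X² + β²` the trace of Frobenius `a_p(E_D)` is `2β` exactly when `χ(D) = i`, and
`-2β` exactly when `χ(D) = -i`. -/
lemma IsQuarticChar.traceFrob_eq_iff (hχ : IsQuarticChar j χ) (hg : ∃ g, χ g = gaussI)
    (hj : j ^ 2 = -1) {X β : ℤ} (hpX : (p : ℤ) = X ^ 2 + β ^ 2) (hX : X % 4 = 1) (hβ : 2 ∣ β)
    (hβ0 : β ≠ 0) (hjX : j * X = β) {D : ℤ} (hΔ : ¬ (p : ℤ) ∣ (curveE D).Δ) :
    (traceFrob D p = 2 * β ↔ χ (D : ZMod p) = gaussI) ∧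
    (traceFrob D p = 2 * -β ↔ χ (D : ZMod p) = -gaussI) := by
  have hp : p % 4 = 1 := by
    obtain ⟨w, rfl⟩ := hβ
    obtain ⟨y, rfl⟩ : ∃ y, X = 4 * y + 1 := ⟨X / 4, by omega⟩
    have hp8 : (p : ℤ) = 8 * (2 * y ^ 2 + y) + 1 + 4 * w ^ 2 := by rw [hpX]; ring
    omega
  have hD : (D : ZMod p) ≠ 0 := by
    rw [Ne, ZMod.intCast_zmod_eq_zero_iff_dvd]
    intro h
    apply hΔ
    rw [show (curveE D).Δ = D * (-64 * D ^ 2) by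
      simp [curveE, WeierstrassCurve.Δ, WeierstrassCurve.b₂, WeierstrassCurve.b₄,
        WeierstrassCurve.b₆, WeierstrassCurve.b₈]
      ring]
    exact Dvd.dvd.mul_right h _
  have hS := jacobsthal_eq_jacobiSum hχ hj hp hD
  rw [hχ.jacobiSum_eq hg hj hpX hX hβ hjX] at hS
  rw [traceFrob_eq_neg_jacobsthal D p (by omega) hΔ]
  obtain ⟨n, hn, -⟩ := hχ _ hD
  rw [hn] at hS ⊢
  rw [gaussI_pow_mod] at hS ⊢
  have hlt := Nat.mod_lt n (show 0 < 4 by norm_num)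
  have hS' := congrArg Zsqrtd.re hS
  have g3 : gaussI ^ 3 = -gaussI := by decide
  generalize n % 4 = a at *
  interval_cases a
  · simp [gaussI, Zsqrtd.ext_iff] at hS' ⊢
    omega
  · simp [gaussI, Zsqrtd.ext_iff] at hS' ⊢
    omega
  · rw [gaussI_sq] at hS' ⊢
    simp [gaussI, Zsqrtd.ext_iff] at hS' ⊢
    omega
  · rw [g3] at hS' ⊢
    simp [Zsqrtd.re_mul, gaussI, Zsqrtd.ext_iff] at hS' ⊢
    omega

end JacobiSum

/-! ### The quartic character of `2` -/

section SupplementaryLaws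

variable {p : ℕ} [Fact p.Prime]

lemma legendreSym_eq_jacobiSym_natAbs (hp : p % 4 = 1) {n : ℤ} (hn : Odd n) :
    legendreSym p n = jacobiSym p n.natAbs := by
  have hodd : Odd n.natAbs := Int.natAbs_odd.2 hn
  have h1 : legendreSym p (-1) = 1 := by
    rw [legendreSym.at_neg_one (by omega), ZMod.χ₄_nat_one_mod_four hp]
  have h2 : legendreSym p n = legendreSym p n.natAbs := by
    rcases Int.natAbs_eq n with h | h
    · rw [← h]
    · conv_lhs => rw [h, neg_eq_neg_one_mul, legendreSym.mul, h1, one_mul]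
  rw [h2, jacobiSym.quadratic_reciprocity_one_mod_four hp hodd, jacobiSym.legendreSym.to_jacobiSym]

lemma isCoprime_of_prime_eq_sq_add_sq {X β : ℤ} (hpX : (p : ℤ) = X ^ 2 + β ^ 2) :
    IsCoprime X β := by
  have hp := Nat.prime_iff_prime_int.1 (Fact.out : p.Prime)
  rw [Int.isCoprime_iff_gcd_eq_one]
  by_contra hg
  obtain ⟨q, hq, hqd⟩ := Nat.exists_prime_and_dvd hg
  have h1 : (q : ℤ) ∣ X := (Int.natCast_dvd_natCast.2 hqd).trans (Int.gcd_dvd_left _ _)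
  have h2 : (q : ℤ) ∣ β := (Int.natCast_dvd_natCast.2 hqd).trans (Int.gcd_dvd_right _ _)
  have h3 : ((q ^ 2 : ℕ) : ℤ) ∣ p := by
    rw [hpX]; push_cast
    exact dvd_add (pow_dvd_pow_of_dvd h1 2) (pow_dvd_pow_of_dvd h2 2)
  have h4 : q ^ 2 ∣ p := Int.natCast_dvd_natCast.1 h3
  have h5 := (Nat.dvd_prime Fact.out).1 h4
  have hq2 := hq.two_le
  rcases h5 with h5 | h5
  · nlinarith
  · have : Squarefree p := (Fact.out : p.Prime).prime.squarefree
    have := this q (by rw [← sq]; exact h4)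
    rw [Nat.isUnit_iff] at this
    omega

/-- Gauss's evaluation of the quartic character of `2`: as `(X + β)² ≡ 2 X β = 2 j X² (mod p)`, the
power `(2 j)^((p-1)/4)` is the product of the Legendre symbols of `X + β` and `X`. The latter is `1`,
and the former is `(2 / (X + β))` because `2 p = (X + β)² + (X - β)²`. -/
lemma two_pow_mul_pow {j : ZMod p} {X β : ℤ} (hp : p % 4 = 1) (hpX : (p : ℤ) = X ^ 2 + β ^ 2)
    (hX : Odd X) (hβ : Even β) (hjX : j * X = β) :
    (2 : ZMod p) ^ ((p - 1) / 4) * j ^ ((p - 1) / 4) =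
      ((ZMod.χ₈ ((X + β).natAbs : ZMod 8) : ℤ) : ZMod p) := by
  have hcop := isCoprime_of_prime_eq_sq_add_sq hpX
  set m := (p - 1) / 4 with hm
  have hp2 : p / 2 = m * 2 := by omega
  have hoddsum : Odd (X + β) := hX.add_even hβ
  have hzp : ((X : ZMod p)) ^ 2 + (β : ZMod p) ^ 2 = 0 := by
    have := congrArg (Int.cast : ℤ → ZMod p) hpX
    push_cast at this
    rw [← this]; simp
  have hlX : legendreSym p X = 1 := by
    rw [legendreSym_eq_jacobiSym_natAbs hp hX, jacobiSym.mod_left, hpX]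
    have : (X ^ 2 + β ^ 2) % (X.natAbs : ℤ) = β ^ 2 % (X.natAbs : ℤ) := by
      apply Int.emod_emod_of_dvd _ dvd_rfl |>.symm.trans
      rw [Int.add_emod, Int.emod_eq_zero_of_dvd (Int.natAbs_dvd.2 (dvd_pow_self X two_ne_zero)),
        zero_add, Int.emod_emod_of_dvd _ dvd_rfl, Int.emod_emod_of_dvd _ dvd_rfl]
    rw [this, ← jacobiSym.mod_left]
    apply jacobiSym.sq_one'
    rw [Int.gcd_comm]
    exact (Int.isCoprime_iff_gcd_eq_one.1 hcop :)
  have hlS : legendreSym p (X + β) = ZMod.χ₈ ((X + β).natAbs : ZMod 8) := by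
    rw [legendreSym_eq_jacobiSym_natAbs hp hoddsum]
    have hodd : Odd (X + β).natAbs := Int.natAbs_odd.2 hoddsum
    have h2 := jacobiSym.at_two hodd
    have hmul : jacobiSym (2 * p) (X + β).natAbs = 1 := by
      have e : (2 * (p : ℤ)) = (X + β) * (X + β) + (X - β) ^ 2 := by rw [hpX]; ring
      have : (2 * (p : ℤ)) % ((X + β).natAbs : ℤ) = (X - β) ^ 2 % ((X + β).natAbs : ℤ) := by
        rw [e, Int.add_emod, Int.emod_eq_zero_of_dvd (Int.natAbs_dvd.2 (dvd_mul_right _ _)),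
          zero_add, Int.emod_emod_of_dvd _ dvd_rfl]
      rw [jacobiSym.mod_left, this, ← jacobiSym.mod_left]
      apply jacobiSym.sq_one'
      have h3 : IsCoprime (X - β) (X + β) := by
        have h4 : IsCoprime 2 (X + β) := by
          obtain ⟨t, ht⟩ := hoddsum
          exact ⟨-t, 1, by linarith⟩
        have h5 : IsCoprime X (X + β) := by
          have := hcop.add_mul_left_right 1
          rwa [mul_one, add_comm] at this
        have h6 := (h4.mul_left h5).add_mul_right_left (-1)
        rwa [show 2 * X + -1 * (X + β) = X - β by ring] at h6
      exact (Int.isCoprime_iff_gcd_eq_one.1 h3 :)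
    rw [jacobiSym.mul_left, h2] at hmul
    rcases ZMod.isQuadratic_χ₈ ((X + β).natAbs : ZMod 8) with h | h | h <;> rw [h] at hmul ⊢ <;>
      linarith
  have e1 : ((X : ZMod p)) ^ (m * 2) = 1 := by
    rw [← hp2, ← legendreSym.eq_pow, hlX]; simp
  have e2 : ((X : ZMod p) + β) ^ (m * 2) = ((ZMod.χ₈ ((X + β).natAbs : ZMod 8) : ℤ) : ZMod p) := by
    rw [← hlS, legendreSym.eq_pow, hp2]; push_cast; rfl
  rw [← e2, mul_comm m 2, pow_mul]
  have : ((X : ZMod p) + β) ^ 2 = 2 * j * X ^ 2 := by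
    linear_combination hzp - 2 * X * hjX
  rw [this, mul_pow, mul_pow, ← pow_mul, mul_comm 2 m, e1, mul_one]

lemma IsQuarticChar.apply_two {j : ZMod p} {χ : MulChar (ZMod p) GaussianInt}
    (hχ : IsQuarticChar j χ) (hj : j ^ 2 = -1) {X β : ℤ} (hpX : (p : ℤ) = X ^ 2 + β ^ 2)
    (hX : X % 4 = 1) (hjX : j * X = β) :
    (β % 8 = 2 → χ 2 = gaussI) ∧ (4 ∣ β → χ 2 = if 8 ∣ β then 1 else -1) := by
  have key : 2 ∣ β → p % 4 = 1 ∧ (2 : ZMod p) ^ ((p - 1) / 4) * j ^ ((p - 1) / 4) =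
      ((ZMod.χ₈ ((X + β).natAbs : ZMod 8) : ℤ) : ZMod p) := by
    intro hβ
    have hp : p % 4 = 1 := by
      obtain ⟨w, rfl⟩ := hβ
      obtain ⟨y, rfl⟩ : ∃ y, X = 4 * y + 1 := ⟨X / 4, by omega⟩
      have hp8 : (p : ℤ) = 8 * (2 * y ^ 2 + y) + 1 + 4 * w ^ 2 := by rw [hpX]; ring
      omega
    exact ⟨hp, two_pow_mul_pow hp hpX (Int.odd_iff.2 (by omega)) (Int.even_iff.2 (by omega)) hjX⟩
  have fin : ∀ n e : ℕ, p % 4 = 1 → ((p - 1) / 4) % 4 = e % 4 → (2 : ZMod p) ^ ((p - 1) / 4) * j ^ e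
      = j ^ n → χ 2 = gaussI ^ (n + 3 * e) := by
    intro n e hp he h
    refine hχ.apply_eq (ZMod.two_ne_zero_of_mod_four hp) hj (ZMod.two_ne_zero_of_mod_four hp) ?_
    rw [ZMod.card, pow_add, ← h, mul_assoc, ← pow_add, pow_mod_four_of_sq_eq_neg_one hj (e + 3 * e),
      show (e + 3 * e) % 4 = 0 by omega, pow_zero, mul_one]
  obtain ⟨y, rfl⟩ : ∃ y, X = 4 * y + 1 := ⟨X / 4, by omega⟩
  constructor
  · intro hβ
    obtain ⟨hp, h⟩ := key (by omega)
    obtain ⟨w, rfl⟩ : ∃ w, β = 8 * w + 2 := ⟨β / 8, by omega⟩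
    have hp8 : (p : ℤ) = 16 * (y ^ 2 + 4 * w ^ 2 + 2 * w) + 8 * y + 5 := by rw [hpX]; ring
    rw [pow_mod_four_of_sq_eq_neg_one hj ((p - 1) / 4), ZMod.χ₈_nat_eq_if_mod_eight] at h
    rcases Int.even_or_odd' y with ⟨z, rfl | rfl⟩
    · rw [if_neg (by omega), if_neg (by omega), show (p - 1) / 4 % 4 = 1 by omega] at h
      rw [fin 2 1 hp (by omega) (by rw [h, hj]; simp)]
      decide
    · rw [if_neg (by omega), if_pos (by omega), show (p - 1) / 4 % 4 = 3 by omega] at h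
      rw [fin 0 3 hp (by omega) (by rw [h]; simp)]
      decide
  · intro hβ
    obtain ⟨hp, h⟩ := key (by omega)
    obtain ⟨w, rfl⟩ := hβ
    have hp8 : (p : ℤ) = 16 * (y ^ 2 + w ^ 2) + 8 * y + 1 := by rw [hpX]; ring
    rw [pow_mod_four_of_sq_eq_neg_one hj ((p - 1) / 4), ZMod.χ₈_nat_eq_if_mod_eight] at h
    rw [if_neg (by omega)] at h
    rcases Int.even_or_odd' y with ⟨z, rfl | rfl⟩ <;> rcases Int.even_or_odd' w with ⟨v, rfl | rfl⟩
    · rw [if_pos (by omega), show (p - 1) / 4 % 4 = 0 by omega] at h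
      rw [fin 0 0 hp (by omega) (by rw [h]; simp), if_pos (by omega)]
      decide
    · rw [if_neg (by omega), show (p - 1) / 4 % 4 = 0 by omega] at h
      rw [fin 2 0 hp (by omega) (by rw [h, hj]; simp), if_neg (by omega)]
      decide
    · rw [if_neg (by omega), show (p - 1) / 4 % 4 = 2 by omega] at h
      rw [fin 2 2 hp (by omega) (by rw [h, hj]; simp), if_pos (by omega)]
      decide
    · rw [if_pos (by omega), show (p - 1) / 4 % 4 = 2 by omega] at h
      rw [fin 0 2 hp (by omega) (by rw [h]; simp), if_neg (by omega)]
      decide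

end SupplementaryLaws

/-! ### Quartic Gauss sums -/

section Reciprocity

variable {p : ℕ} [Fact p.Prime] {j : ZMod p} {χ : MulChar (ZMod p) GaussianInt}

/-- For `p = X² + β²` the fourth power of the quartic Gauss sum `g(χ)` is `p (X + β i)²`, and
`g(χ) g(χ³) = χ(-1) p`. -/
lemma IsQuarticChar.gaussSum_pow_four (hχ : IsQuarticChar j χ) (hg : ∃ g, χ g = gaussI)
    (hj : j ^ 2 = -1) {X β : ℤ} (hpX : (p : ℤ) = X ^ 2 + β ^ 2) (hX : X % 4 = 1) (hβ : 2 ∣ β)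
    (hjX : j * X = β) {F : Type*} [Field F] (hF2 : (2 : F) ≠ 0) (hFp : (p : F) ≠ 0) {i : F}
    (hi : i ^ 2 = -1) {ψ : AddChar (ZMod p) F} (hψ : ψ.IsPrimitive) :
    gaussSum (χ.ringHomComp (gaussLift i hi)) ψ ^ 4 = p * (X + β * i) ^ 2 ∧
    gaussSum (χ.ringHomComp (gaussLift i hi)) ψ *
      gaussSum (χ.ringHomComp (gaussLift i hi) ^ 3) ψ = gaussLift i hi (χ (-1)) * p := by
  set f := gaussLift i hi with hf
  set φ := χ.ringHomComp f with hφ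
  have hfI : f gaussI = i := gaussLift_gaussI i hi
  have h11 : (1 : F) ≠ -1 := fun h => hF2 (by linear_combination h)
  have hp : p % 4 = 1 := by
    obtain ⟨w, rfl⟩ := hβ
    obtain ⟨y, rfl⟩ : ∃ y, X = 4 * y + 1 := ⟨X / 4, by omega⟩
    have hp8 : (p : ℤ) = 8 * (2 * y ^ 2 + y) + 1 + 4 * w ^ 2 := by rw [hpX]; ring
    omega
  obtain ⟨g, hg'⟩ := id hg
  have hg0 : g ≠ 0 := by
    rintro rfl
    rw [MulChar.map_zero] at hg'
    exact absurd hg' (by decide)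
  have hφg : φ g = i := by rw [hφ, MulChar.ringHomComp_apply, hg', hfI]
  have hi1 : i ≠ 1 := by rintro rfl; exact h11 (by simpa using hi)
  have hφ2 : φ ^ 2 ≠ 1 := by
    intro h
    have h1 : (φ ^ 2) g = (1 : MulChar (ZMod p) F) g := by rw [h]
    rw [MulChar.pow_apply' _ (by norm_num), hφg, MulChar.one_apply hg0.isUnit, hi] at h1
    exact h11 h1.symm
  have hφ4 : φ ^ 4 = 1 := by
    rw [hφ, MulChar.ringHomComp_pow, hχ.pow_four_eq_one, MulChar.ringHomComp_one]
  have hφ3 : φ * φ ^ 2 ≠ 1 := by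
    intro h
    rw [← pow_succ'] at h
    have : φ = 1 := by rw [← hφ4, pow_succ, h, one_mul]
    exact hφ2 (by rw [this, one_pow])
  have hφ1 : φ ≠ 1 := fun h => hφ2 (by rw [h, one_pow])
  have hord : orderOf φ = 2 ^ 2 := orderOf_eq_prime_pow (by simpa using hφ2) (by simpa using hφ4)
  have hG3 : gaussSum φ ψ * gaussSum (φ ^ 3) ψ = f (χ (-1)) * p := by
    have := gaussSum_mul_gaussSum_pow_orderOf_sub_one hφ1 hψ
    rw [hord, ZMod.card] at this
    exact this
  refine ⟨?_, hG3⟩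
  have hJ : gaussSum (φ ^ 3) ψ * jacobiSum φ (φ ^ 2) = gaussSum φ ψ * gaussSum (φ ^ 2) ψ := by
    have := jacobiSum_mul_nontrivial hφ3 ψ
    rwa [← pow_succ'] at this
  have hneg1 : f (χ (-1)) * f (χ (-1)) = 1 := by rw [← map_mul, ← map_mul]; simp
  have hquad : (φ ^ 2).IsQuadratic := by
    intro a
    by_cases ha : a = 0
    · left; subst ha; rw [MulChar.map_zero]
    · right
      rw [MulChar.pow_apply' _ (by norm_num)]
      have : (φ a ^ 2 - 1) * (φ a ^ 2 + 1) = 0 := by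
        have h4 : (φ ^ 4) a = 1 := by rw [hφ4, MulChar.one_apply (Ne.isUnit ha)]
        rw [MulChar.pow_apply' _ (by norm_num)] at h4
        linear_combination h4
      rcases mul_eq_zero.1 this with h | h
      · left; linear_combination h
      · right; linear_combination h
  have hG2 : gaussSum (φ ^ 2) ψ ^ 2 = p := by
    rw [gaussSum_sq hφ2 hquad hψ, ZMod.card, MulChar.pow_apply' _ (by norm_num)]
    rw [hφ, MulChar.ringHomComp_apply, sq, hneg1, one_mul]
  have hval : f (χ (-1)) * jacobiSum φ (φ ^ 2) = -(X + β * i) := by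
    rw [hφ, MulChar.ringHomComp_pow, jacobiSum_ringHomComp, ← map_mul,
      hχ.jacobiSum_eq hg hj hpX hX hβ hjX, map_neg, hf, gaussLift_apply]
  have h1 : gaussSum φ ψ ^ 2 * gaussSum (φ ^ 2) ψ = -(X + β * i) * p := by
    linear_combination jacobiSum φ (φ ^ 2) * hG3 - gaussSum φ ψ * hJ + p * hval
  have h2 : gaussSum φ ψ ^ 4 * p = p * (X + β * i) ^ 2 * p := by
    linear_combination -gaussSum φ ψ ^ 4 * hG2 +
      (gaussSum φ ψ ^ 2 * gaussSum (φ ^ 2) ψ - (X + β * i) * p) * h1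
  exact mul_right_cancel₀ hFp h2

/-- Applying Frobenius to the quartic Gauss sum evaluates the quartic character of a prime `l`. -/
lemma IsQuarticChar.map_apply_prime (hχ : IsQuarticChar j χ) (hg : ∃ g, χ g = gaussI)
    (hj : j ^ 2 = -1) {X β : ℤ} (hpX : (p : ℤ) = X ^ 2 + β ^ 2) (hX : X % 4 = 1) (hβ : 2 ∣ β)
    (hjX : j * X = β) {l : ℕ} [Fact l.Prime] (hlp : l ≠ p) (hl2 : l ≠ 2)
    {K : Type*} [Field K] [CharP K l] {i : K} (hi : i ^ 2 = -1) :
    (l % 4 = 1 → gaussLift i hi (χ l) * (p * (X + β * i) ^ 2) ^ ((l - 1) / 4) = 1) ∧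
    (l % 4 = 3 → gaussLift i hi (χ l) ^ 3 * (p * (X + β * i) ^ 2) ^ ((l + 1) / 4) =
      gaussLift i hi (χ (-1)) * p) := by
  have hKp : (p : K) ≠ 0 := by
    rw [Ne, CharP.cast_eq_zero_iff K l]
    intro h
    exact hlp ((Nat.prime_dvd_prime_iff_eq Fact.out Fact.out).1 h)
  have hK2 : (2 : K) ≠ 0 := by
    intro h
    have : ((2 : ℕ) : K) = 0 := by exact_mod_cast h
    rw [CharP.cast_eq_zero_iff K l] at this
    exact hl2 ((Nat.prime_dvd_prime_iff_eq Fact.out Nat.prime_two).1 this)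
  let pp : ℕ+ := ⟨p, (Fact.out : p.Prime).pos⟩
  let Ψ := AddChar.primitiveZModChar pp K hKp
  let F := CyclotomicField Ψ.n K
  let ψ : AddChar (ZMod p) F := Ψ.char
  have hψ : ψ.IsPrimitive := Ψ.prim
  let e : K →+* F := algebraMap K F
  have he : Function.Injective e := e.injective
  have : CharP F l := charP_of_injective_algebraMap he l
  have hi' : e i ^ 2 = -1 := by rw [← map_pow, hi, map_neg, map_one]
  have hF2 : (2 : F) ≠ 0 := fun h => hK2 (he (by rw [map_ofNat, h, map_zero]))
  have hFp : (p : F) ≠ 0 := fun h => hKp (he (by rw [map_natCast, h, map_zero]))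
  have hlift : ∀ z, gaussLift (e i) hi' z = e (gaussLift i hi z) := by
    intro z; simp [gaussLift_apply]
  obtain ⟨hG4, hG3⟩ := hχ.gaussSum_pow_four hg hj hpX hX hβ hjX hF2 hFp hi' hψ
  set φ := χ.ringHomComp (gaussLift (e i) hi') with hφ
  have hφ4 : φ ^ 4 = 1 := by
    rw [hφ, MulChar.ringHomComp_pow, hχ.pow_four_eq_one, MulChar.ringHomComp_one]
  have hlu : IsUnit (l : ZMod p) := by
    rw [ZMod.isUnit_iff_coprime]
    exact (Nat.coprime_primes Fact.out Fact.out).2 hlp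
  have hφl : φ l = e (gaussLift i hi (χ l)) := by
    rw [hφ, MulChar.ringHomComp_apply, hlift]
  have hfrob := gaussSum_frob l φ ψ
  rw [AddChar.pow_mulShift] at hfrob
  have hne : gaussSum φ ψ ≠ 0 := by
    intro h
    rw [h, zero_mul, hlift] at hG3
    have hneg1 : χ (-1) * χ (-1) = 1 := by rw [← map_mul]; simp
    have : e (gaussLift i hi (χ (-1))) * e (gaussLift i hi (χ (-1))) = 1 := by
      rw [← map_mul, ← map_mul, hneg1]; simp
    rcases mul_eq_zero.1 hG3.symm with h | h
    · rw [h] at this; simp at this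
    · exact hFp h
  constructor
  · intro hl
    have hφl1 : φ ^ l = φ := by
      conv_lhs => rw [← Nat.div_add_mod l 4, hl, pow_add, pow_mul, hφ4, one_pow, one_mul, pow_one]
    have h1 := gaussSum_mulShift φ ψ hlu.unit
    rw [hlu.unit_spec] at h1
    rw [hφl1] at hfrob
    rw [← hfrob] at h1
    have h2 : φ l * gaussSum φ ψ ^ (l - 1) = 1 := by
      refine mul_right_cancel₀ hne ?_
      rw [one_mul, mul_assoc, ← pow_succ, Nat.sub_add_cancel (Fact.out : l.Prime).one_le]
      exact h1
    apply he
    rw [map_one, ← h2, map_mul, hφl]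
    congr 1
    rw [show l - 1 = 4 * ((l - 1) / 4) by omega, pow_mul, hG4,
      Nat.mul_div_cancel_left _ (by norm_num : 0 < 4)]
    simp
  · intro hl
    have hφl1 : φ ^ l = φ ^ 3 := by
      conv_lhs => rw [← Nat.div_add_mod l 4, hl, pow_add, pow_mul, hφ4, one_pow, one_mul]
    have h1 := gaussSum_mulShift (φ ^ 3) ψ hlu.unit
    rw [hlu.unit_spec] at h1
    rw [hφl1] at hfrob
    rw [← hfrob, MulChar.pow_apply' _ (by norm_num)] at h1
    have h2 : φ l ^ 3 * gaussSum φ ψ ^ (l + 1) = gaussLift (e i) hi' (χ (-1)) * p := by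
      rw [← hG3, ← h1]; ring
    apply he
    rw [map_mul, map_mul, map_natCast e, ← hlift, ← h2, map_pow, hφl]
    congr 1
    rw [show l + 1 = 4 * ((l + 1) / 4) by omega, pow_mul, hG4,
      Nat.mul_div_cancel_left _ (by norm_num : 0 < 4)]
    simp

end Reciprocity

/-! ### Quartic reciprocity for rational primes -/

lemma gaussLift_gaussI_pow_inj {K : Type*} [Field K] (h2 : (2 : K) ≠ 0) {i : K} (hi : i ^ 2 = -1)
    {u v : GaussianInt} (hu : ∃ n : ℕ, u = gaussI ^ n) (hv : ∃ n : ℕ, v = gaussI ^ n)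
    (h : gaussLift i hi u = gaussLift i hi v) : u = v := by
  obtain ⟨m, rfl⟩ := hu
  obtain ⟨n, rfl⟩ := hv
  rw [map_pow, map_pow, gaussLift_gaussI] at h
  exact pow_eq_pow_iff_of_sq_eq_neg_one h2 hi h

lemma IsQuarticChar.exists_eq_pow {K : Type*} [Field K] [Fintype K] {j : K}
    {χ : MulChar K GaussianInt} (hχ : IsQuarticChar j χ) {u : K} (hu : u ≠ 0) :
    ∃ n : ℕ, χ u = gaussI ^ n :=
  let ⟨n, hn, _⟩ := hχ u hu
  ⟨n, hn⟩

/-- `φ` describes, as a function of `X` modulo the odd prime `l`, the quartic residue symbol of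
`l* = (-1)^((l-1)/2) l` modulo the primes `p = X² + β²` with `X ≡ 1 (mod 4)`. It vanishes at the
residues `X` for which `l ∣ X² + β²`. -/
structure IsLocalSymbol (l : ℕ) [Fact l.Prime] (β : ℤ) (φ : ZMod l → GaussianInt) : Prop where
  apply_eq_zero : ∀ x, x ^ 2 + (β : ZMod l) ^ 2 = 0 → φ x = 0
  pow_four : ∀ x, x ^ 2 + (β : ZMod l) ^ 2 ≠ 0 → φ x ^ 4 = 1
  sum_pow : ¬ (l : ℤ) ∣ β → ∀ n : ℕ, ¬ 4 ∣ n → ∑ x, φ x ^ n = -1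
  eq_one : (l : ℤ) ∣ β → ∀ x, x ^ 2 + (β : ZMod l) ^ 2 ≠ 0 → φ x = 1
  reciprocity : ∀ (p : ℕ) [Fact p.Prime] (j : ZMod p) (χ : MulChar (ZMod p) GaussianInt) (X : ℤ),
    IsQuarticChar j χ → (∃ g, χ g = gaussI) → j ^ 2 = -1 → (p : ℤ) = X ^ 2 + β ^ 2 → X % 4 = 1 →
    j * X = β → l ≠ p → χ (if l % 4 = 3 then -(l : ZMod p) else l) = φ X

lemma exists_isLocalSymbol_of_mod_four_eq_one (l : ℕ) [Fact l.Prime] (hl : l % 4 = 1) (β : ℤ)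
    (hβ : 2 ∣ β) : ∃ φ, IsLocalSymbol l β φ := by
  have h2 : (2 : ZMod l) ≠ 0 := ZMod.two_ne_zero_of_mod_four hl
  obtain ⟨i, hi⟩ : ∃ i : ZMod l, i ^ 2 = -1 := by
    obtain ⟨i, hi⟩ := ZMod.exists_sq_eq_neg_one_iff.2 (show l % 4 ≠ 3 by omega)
    exact ⟨i, by rw [sq, hi]⟩
  obtain ⟨ψ, hψ, hg⟩ := exists_isQuarticChar (K := ZMod l) (by rw [ZMod.card]; omega) hi
  have hfac : ∀ x : ZMod l, x ^ 2 + (β : ZMod l) ^ 2 = (x + β * i) * (x - β * i) := by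
    intro x; linear_combination (β : ZMod l) ^ 2 * hi
  refine ⟨fun x => ψ ((x + β * i) / (x - β * i)), ?_, ?_, ?_, ?_, ?_⟩
  · intro x hx
    rw [hfac] at hx
    rcases mul_eq_zero.1 hx with h | h <;> simp only [h] <;> simp [MulChar.map_zero]
  · intro x hx
    rw [hfac] at hx
    exact hψ.pow_four (div_ne_zero (left_ne_zero_of_mul hx) (right_ne_zero_of_mul hx))
  · intro hlβ n hn
    have hβ0 : (β : ZMod l) ≠ 0 := by rwa [Ne, ZMod.intCast_zmod_eq_zero_iff_dvd]
    have hi0 : i ≠ 0 := by rintro rfl; norm_num at hi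
    set c : ZMod l := β * i with hc
    have hc0 : c ≠ 0 := mul_ne_zero hβ0 hi0
    have hn0 : n ≠ 0 := by rintro rfl; exact hn (dvd_zero 4)
    have hθ := MulChar.pow_ne_one_of_apply_eq_gaussI hg hn
    have hsum := MulChar.sum_eq_zero_of_ne_one hθ
    simp_rw [← MulChar.pow_apply' ψ hn0]
    -- `x ↦ (x + c) / (x - c)` maps `x ≠ c` bijectively to the elements other than `1`
    rw [← Finset.add_sum_erase _ _ (Finset.mem_univ c)]
    rw [← Finset.add_sum_erase _ _ (Finset.mem_univ (1 : ZMod l)), map_one] at hsum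
    have : ∑ x ∈ Finset.univ.erase c, (ψ ^ n) ((x + c) / (x - c)) =
        ∑ z ∈ Finset.univ.erase 1, (ψ ^ n) z := by
      refine Finset.sum_nbij' (fun x => (x + c) / (x - c)) (fun z => c * (z + 1) / (z - 1))
        ?_ ?_ ?_ ?_ ?_
      · intro x hx
        have hx' : x - c ≠ 0 := sub_ne_zero.2 (Finset.ne_of_mem_erase hx)
        refine Finset.mem_erase.2 ⟨?_, Finset.mem_univ _⟩
        rw [Ne, div_eq_one_iff_eq hx']
        intro h
        exact mul_ne_zero h2 hc0 (by linear_combination h)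
      · intro z hz
        have hz' : z - 1 ≠ 0 := sub_ne_zero.2 (Finset.ne_of_mem_erase hz)
        refine Finset.mem_erase.2 ⟨?_, Finset.mem_univ _⟩
        rw [Ne, div_eq_iff hz']
        intro h
        exact mul_ne_zero h2 hc0 (by linear_combination h)
      · intro x hx
        have hx' : x - c ≠ 0 := sub_ne_zero.2 (Finset.ne_of_mem_erase hx)
        have : (x + c) / (x - c) - 1 = 2 * c / (x - c) := by field_simp; ring
        simp only [this]
        field_simp
        ring
      · intro z hz
        have hz' : z - 1 ≠ 0 := sub_ne_zero.2 (Finset.ne_of_mem_erase hz)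
        have e1 : c * (z + 1) / (z - 1) - c = 2 * c / (z - 1) := by field_simp; ring
        simp only [e1]
        field_simp
        ring
      · intro x _; rfl
    rw [this, sub_self, div_zero, MulChar.map_zero]
    linear_combination hsum
  · intro hlβ x hx
    have hβ0 : (β : ZMod l) = 0 := by rwa [ZMod.intCast_zmod_eq_zero_iff_dvd]
    have hx0 : x ≠ 0 := by rintro rfl; rw [hβ0] at hx; simp at hx
    simp only [hβ0, zero_mul, add_zero, sub_zero, div_self hx0, map_one]
  · intro p _ j χ X hχ hgχ hj hpX hX hjX hlp
    rw [if_neg (by omega)]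
    have hlu : (l : ZMod p) ≠ 0 := by
      rw [Ne, ZMod.natCast_eq_zero_iff]
      intro h
      exact hlp ((Nat.prime_dvd_prime_iff_eq Fact.out Fact.out).1 h).symm
    have hpu : (p : ZMod l) ≠ 0 := by
      rw [Ne, ZMod.natCast_eq_zero_iff]
      intro h
      exact hlp ((Nat.prime_dvd_prime_iff_eq Fact.out Fact.out).1 h)
    have hpAB : (p : ZMod l) = (X + β * i) * (X - β * i) := by
      rw [← hfac]
      exact_mod_cast congrArg (Int.cast : ℤ → ZMod l) hpX
    have hA : ((X : ZMod l) + β * i) ≠ 0 := fun h => hpu (by rw [hpAB, h, zero_mul])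
    have hB : ((X : ZMod l) - β * i) ≠ 0 := fun h => hpu (by rw [hpAB, h, mul_zero])
    have hmain := (hχ.map_apply_prime hgχ hj hpX hX hβ hjX hlp (by omega) hi (K := ZMod l)).1 hl
    refine gaussLift_gaussI_pow_inj h2 hi (hχ.exists_eq_pow hlu)
      (hψ.exists_eq_pow (div_ne_zero hA hB)) ?_
    have hr := hψ.map_apply (gaussLift i hi) (RingHom.id _) (gaussLift_gaussI i hi)
      (div_ne_zero hA hB)
    rw [hr, ZMod.card, RingHom.id_apply, div_pow]
    rw [hpAB] at hmain
    set A := (X : ZMod l) + β * i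
    set B := (X : ZMod l) - β * i
    set n := (l - 1) / 4 with hn
    have hA4 : A ^ n * A ^ n * A ^ n * A ^ n = 1 := by
      rw [← pow_add, ← pow_add, ← pow_add, show n + n + n + n = l - 1 by omega]
      exact ZMod.pow_card_sub_one_eq_one hA
    have hmain' : gaussLift i hi (χ l) * (A ^ n * A ^ n * A ^ n * B ^ n) = 1 := by
      rw [← hmain, ← mul_pow, ← mul_pow, ← mul_pow]
      congr 2; ring
    rw [eq_div_iff (pow_ne_zero _ hB)]
    linear_combination A ^ n * hmain' - gaussLift i hi (χ l) * B ^ n * hA4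

/-- The ring `ℤ[i] / l`, a field with `l²` elements when `l ≡ 3 (mod 4)`. -/
abbrev GaussMod (l : ℕ) := QuadraticAlgebra (ZMod l) (-1) 0

lemma exists_isLocalSymbol_of_mod_four_eq_three (l : ℕ) [Fact l.Prime] (hl : l % 4 = 3) (β : ℤ)
    (hβ : 2 ∣ β) : ∃ φ, IsLocalSymbol l β φ := by
  classical
  have hnsq : ∀ r : ZMod l, r ^ 2 ≠ -1 := by
    intro r hr
    exact ZMod.exists_sq_eq_neg_one_iff.1 ⟨r, by rw [← sq, hr]⟩ hl
  have hFact : Fact (∀ r : ZMod l, r ^ 2 ≠ -1 + 0 * r) := ⟨fun r => by simpa using hnsq r⟩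
  let E : GaussMod l ≃ ZMod l × ZMod l := QuadraticAlgebra.equivProd _ _
  let _ : Fintype (GaussMod l) := Fintype.ofEquiv _ E.symm
  have hCK : CharP (GaussMod l) l :=
    charP_of_injective_algebraMap (algebraMap (ZMod l) (GaussMod l)).injective l
  have hcard : Fintype.card (GaussMod l) = l ^ 2 := by
    rw [Fintype.card_congr E, Fintype.card_prod, ZMod.card, sq]
  obtain ⟨k, hlk⟩ : ∃ k, l = 4 * k + 3 := ⟨l / 4, by omega⟩
  have hl2 : l ^ 2 = 4 * ((2 * k + 1) * (2 * (k + 1))) + 1 := by rw [hlk]; ring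
  have hm : (Fintype.card (GaussMod l) - 1) / 4 = (2 * k + 1) * (2 * (k + 1)) := by
    rw [hcard]; omega
  let i : GaussMod l := ⟨0, 1⟩
  have hi : i ^ 2 = -1 := by
    rw [sq]; ext <;> simp [i, QuadraticAlgebra.re_one, QuadraticAlgebra.im_one]
  have h2 : (2 : GaussMod l) ≠ 0 := by
    intro h
    have : ((2 : ℕ) : GaussMod l) = 0 := by exact_mod_cast h
    rw [CharP.cast_eq_zero_iff (GaussMod l) l] at this
    have := Nat.le_of_dvd (by norm_num) this
    omega
  obtain ⟨ψ, hψ, hg⟩ := exists_isQuarticChar (K := GaussMod l) (by rw [hcard]; omega) hi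
  have hβ0 : ∀ x y : ZMod l, x ^ 2 + y ^ 2 = 0 ↔ (⟨x, y⟩ : GaussMod l) = 0 := by
    intro x y
    rw [← QuadraticAlgebra.norm_eq_zero_iff_eq_zero, QuadraticAlgebra.norm_def]
    ring_nf
  -- the character is trivial on the prime field
  have hconst : ∀ c : ZMod l, c ≠ 0 → ψ (⟨c, 0⟩ : GaussMod l) = 1 := by
    intro c hc
    have hC : (⟨c, 0⟩ : GaussMod l) = algebraMap (ZMod l) (GaussMod l) c := rfl
    have := hψ.apply_eq h2 hi (u := (⟨c, 0⟩ : GaussMod l)) (n := 0)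
      (fun h => hc (by simpa using (hβ0 c 0).2 h)) (by
        rw [hm, hC, ← map_pow, show (2 * k + 1) * (2 * (k + 1)) = (l - 1) * (k + 1) by
          rw [hlk, Nat.add_sub_assoc (by norm_num)]; ring,
          pow_mul, ZMod.pow_card_sub_one_eq_one hc, one_pow, map_one, pow_zero])
    simpa using this
  refine ⟨fun x => ψ (⟨x, β⟩ : GaussMod l), ?_, ?_, ?_, ?_, ?_⟩
  · intro x hx
    simp only [(hβ0 _ _).1 hx, MulChar.map_zero]
  · intro x hx
    exact hψ.pow_four (fun h => hx ((hβ0 _ _).2 h))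
  · intro hlβ n hn
    have hb0 : (β : ZMod l) ≠ 0 := by rwa [Ne, ZMod.intCast_zmod_eq_zero_iff_dvd]
    have hn0 : n ≠ 0 := by rintro rfl; exact hn (dvd_zero 4)
    have hθ := MulChar.pow_ne_one_of_apply_eq_gaussI hg hn
    have hsum := MulChar.sum_eq_zero_of_ne_one hθ
    simp_rw [← MulChar.pow_apply' ψ hn0]
    set S := ∑ x : ZMod l, (ψ ^ n) (⟨x, β⟩ : GaussMod l) with hS
    have hconst' : ∀ c : ZMod l, c ≠ 0 → (ψ ^ n) (⟨c, 0⟩ : GaussMod l) = 1 := fun c hc => by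
      rw [MulChar.pow_apply' ψ hn0, hconst c hc, one_pow]
    have hrow : ∀ b : ZMod l, b ≠ 0 → ∑ x : ZMod l, (ψ ^ n) (⟨x, b⟩ : GaussMod l) = S := by
      intro b hb
      have hc : b / β ≠ 0 := div_ne_zero hb hb0
      rw [hS, ← Equiv.sum_comp (Equiv.mulLeft₀ (b / β) hc)]
      refine Finset.sum_congr rfl fun x _ => ?_
      have : (⟨b / β * x, b⟩ : GaussMod l) = ⟨b / β, 0⟩ * ⟨x, β⟩ := by
        ext
        · simp
        · simp [div_mul_cancel₀ _ hb0]
      change (ψ ^ n) (⟨b / β * x, b⟩ : GaussMod l) = _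
      rw [this, map_mul, hconst' _ hc, one_mul]
    have hrow0 : ∑ x : ZMod l, (ψ ^ n) (⟨x, 0⟩ : GaussMod l) = (l : GaussianInt) - 1 := by
      rw [← Finset.add_sum_erase _ _ (Finset.mem_univ (0 : ZMod l)),
        Finset.sum_congr rfl fun x hx => hconst' x (Finset.ne_of_mem_erase hx)]
      have : (⟨0, 0⟩ : GaussMod l) = 0 := rfl
      rw [this, MulChar.map_zero, Finset.sum_const, Finset.card_erase_of_mem (Finset.mem_univ _),
        Finset.card_univ, ZMod.card, nsmul_one, zero_add, Nat.cast_sub (by omega), Nat.cast_one]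
    have htot : ∑ u : (GaussMod l), (ψ ^ n) u = ∑ b : ZMod l, ∑ x : ZMod l, (ψ ^ n) (⟨x, b⟩ : GaussMod l) := by
      rw [← Equiv.sum_comp E.symm, Fintype.sum_prod_type_right]
      rfl
    rw [htot, ← Finset.add_sum_erase _ _ (Finset.mem_univ (0 : ZMod l)), hrow0,
      Finset.sum_congr rfl fun b hb => hrow b (Finset.ne_of_mem_erase hb), Finset.sum_const,
      Finset.card_erase_of_mem (Finset.mem_univ _), Finset.card_univ, ZMod.card, nsmul_eq_mul,
      Nat.cast_sub (by omega), Nat.cast_one] at hsum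
    have hl0 : (l : GaussianInt) - 1 ≠ 0 := by
      rw [sub_ne_zero]
      exact_mod_cast (show l ≠ 1 by omega)
    refine mul_left_cancel₀ hl0 ?_
    linear_combination hsum
  · intro hlβ x hx
    have hb0 : (β : ZMod l) = 0 := by rwa [ZMod.intCast_zmod_eq_zero_iff_dvd]
    have hx0 : x ≠ 0 := by rintro rfl; rw [hb0] at hx; simp at hx
    simp only [hb0]
    exact hconst x hx0
  · intro p _ j χ X hχ hgχ hj hpX hX hjX hlp
    rw [if_pos hl]
    have hlu : (l : ZMod p) ≠ 0 := by
      rw [Ne, ZMod.natCast_eq_zero_iff]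
      intro h
      exact hlp ((Nat.prime_dvd_prime_iff_eq Fact.out Fact.out).1 h).symm
    have hpu : (p : GaussMod l) ≠ 0 := by
      rw [Ne, CharP.cast_eq_zero_iff (GaussMod l) l]
      intro h
      exact hlp ((Nat.prime_dvd_prime_iff_eq Fact.out Fact.out).1 h)
    have hA' : (⟨(X : ZMod l), (β : ZMod l)⟩ : GaussMod l) = X + β * i := by
      ext <;> simp [i]
    set A : GaussMod l := ⟨(X : ZMod l), (β : ZMod l)⟩ with hA
    have hfr : A ^ l = X - β * i := by
      have hil : i ^ l = -i := by
        rw [pow_mod_four_of_sq_eq_neg_one hi, hl, pow_succ, hi, neg_one_mul]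
      have hcast : ∀ z : ℤ, (z : GaussMod l) ^ l = z := by
        intro z
        rw [← map_intCast (algebraMap (ZMod l) (GaussMod l)), ← map_pow, ZMod.pow_card]
      rw [hA', add_pow_char, mul_pow, hil, hcast, hcast]
      ring
    have hpA : (p : GaussMod l) = A ^ (l + 1) := by
      have : (p : GaussMod l) = X ^ 2 + β ^ 2 := by exact_mod_cast congrArg (Int.cast : ℤ → (GaussMod l)) hpX
      rw [pow_succ, hfr, hA', this]
      linear_combination (β : GaussMod l) ^ 2 * hi
    have hA0 : A ≠ 0 := fun h => hpu (by rw [hpA, h, zero_pow (by omega)])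
    have hmain := (hχ.map_apply_prime hgχ hj hpX hX hβ hjX hlp (by omega) hi (K := GaussMod l)).2 hl
    rw [← hA', hpA, ← pow_add, ← pow_mul] at hmain
    refine gaussLift_gaussI_pow_inj h2 hi (hχ.exists_eq_pow (neg_ne_zero.2 hlu))
      (hψ.exists_eq_pow hA0) ?_
    have hr := hψ.map_apply (gaussLift i hi) (RingHom.id _) (gaussLift_gaussI i hi) hA0
    have hneg : χ (-(l : ZMod p)) = χ (-1) * χ l := by rw [← map_mul, neg_one_mul]
    rw [hr, RingHom.id_apply, hm, hneg, map_mul]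
    rw [show (l + 1 + 2) * ((l + 1) / 4) = (2 * k + 1) * (2 * (k + 1)) + (l + 1) by
      rw [show (l + 1) / 4 = k + 1 by omega, hlk]; ring, pow_add, ← mul_assoc] at hmain
    have hmain' := mul_right_cancel₀ (pow_ne_zero _ hA0) hmain
    have hc4 : gaussLift i hi (χ l) ^ 4 = 1 := by rw [← map_pow, hχ.pow_four hlu, map_one]
    linear_combination A ^ ((2 * k + 1) * (2 * (k + 1))) * hc4 - gaussLift i hi (χ l) * hmain'

lemma exists_isLocalSymbol (l : ℕ) [Fact l.Prime] (hl : l ≠ 2) (β : ℤ) (hβ : 2 ∣ β) :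
    ∃ φ, IsLocalSymbol l β φ := by
  have := (Fact.out : l.Prime).eq_two_or_odd
  rcases (show l % 4 = 1 ∨ l % 4 = 3 by omega) with h | h
  · exact exists_isLocalSymbol_of_mod_four_eq_one l h β hβ
  · exact exists_isLocalSymbol_of_mod_four_eq_three l h β hβ

/-! ### Consequences of the Hardy-Littlewood conjecture -/

/-- The residues `k` modulo `m` for which the values `(m x + k)² + β²` are prime to `m`. -/
def admissibleResidues (m : ℕ) (β : ℤ) : Finset ℕ :=
  (Finset.range m).filter (fun k : ℕ => IsCoprime ((k : ℤ) ^ 2 + β ^ 2) m)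

/-- The primes `p = x² + β² ≤ N` with `x ≡ k (mod m)`. -/
def residuePrimes (m : ℕ) (β : ℤ) (k N : ℕ) : Set ℕ :=
  {p : ℕ | p.Prime ∧ p ≤ N ∧ ∃ x : ℕ, x % m = k ∧ (p : ℤ) = (x : ℤ) ^ 2 + β ^ 2}

lemma residuePrimes_finite (m : ℕ) (β : ℤ) (k N : ℕ) : (residuePrimes m β k N).Finite :=
  (Set.finite_Iic N).subset fun _ hp => hp.2.1

lemma ncard_residuePrimes {m : ℕ} {β : ℤ} {k : ℕ} (hk : k < m) (N : ℕ) :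
    (residuePrimes m β k N).ncard =
      quadPrimeCount ((m : ℤ) ^ 2) (2 * m * k) (k ^ 2 + β ^ 2) (N + 1) := by
  rw [quadPrimeCount]
  congr 1
  ext p
  simp only [residuePrimes, Set.mem_ofPred_eq, Nat.lt_succ_iff]
  refine and_congr_right fun _ => and_congr_right fun _ => ⟨?_, ?_⟩
  · rintro ⟨x, hx, hp⟩
    refine ⟨x / m, ?_⟩
    have : (x : ℤ) = m * (x / m : ℕ) + k := by
      rw [← hx]; exact_mod_cast (Nat.div_add_mod x m).symm
    rw [hp]
    nth_rewrite 1 [this]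
    ring
  · rintro ⟨x, hp⟩
    refine ⟨m * x + k, ?_, ?_⟩
    · rw [Nat.mul_add_mod, Nat.mod_eq_of_lt hk]
    · rw [hp]; push_cast; ring

/-- The Hardy-Littlewood constant of `(m x + k)² + β²` does not depend on the residue `k`: the
discriminant is `-(2 m β)²`, and the linear coefficient is divisible by every prime of the leading
one. -/
lemma isHLConstant_congr {m : ℕ} (hm : 0 < m) (β : ℤ) (k k' : ℕ) {δ : ℝ}
    (h : IsHLConstant ((m : ℤ) ^ 2) (2 * m * k) (k ^ 2 + β ^ 2) δ) (hm2 : 2 ∣ m) :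
    IsHLConstant ((m : ℤ) ^ 2) (2 * m * k') (k' ^ 2 + β ^ 2) δ := by
  obtain ⟨t, rfl⟩ := hm2
  have key : ∀ k : ℕ, hlFiniteFactor (((2 * t : ℕ) : ℤ) ^ 2) (2 * (2 * t : ℕ) * k) =
      2 / Real.sqrt ((((2 * t : ℕ) : ℤ) ^ 2 : ℤ) : ℝ) *
        ∏ p ∈ (((2 * t : ℕ) : ℤ) ^ 2).natAbs.primeFactors.filter (fun p : ℕ => 2 < p),
          ((p : ℝ) / ((p : ℝ) - 1)) := by
    intro k
    have h1 : Int.gcd 2 (((2 * t : ℕ) : ℤ) ^ 2 + 2 * (2 * t : ℕ) * k) = 2 := by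
      rw [show ((2 * t : ℕ) : ℤ) ^ 2 + 2 * (2 * t : ℕ) * k = 2 * (2 * t ^ 2 + 2 * t * k) by
        push_cast; ring]
      exact Nat.dvd_antisymm (Int.natCast_dvd_natCast.1 (Int.gcd_dvd_left _ _))
        (Int.dvd_coe_gcd (dvd_refl 2) (dvd_mul_right _ _) |> Int.natCast_dvd_natCast.1)
    rw [hlFiniteFactor, h1]
    congr 2
    ext p
    simp only [Finset.mem_filter, Nat.mem_primeFactors]
    constructor
    · rintro ⟨h1, h2, -⟩; exact ⟨h1, h2⟩
    · rintro ⟨⟨h1, h2, h3⟩, h4⟩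
      refine ⟨⟨h1, h2, h3⟩, h4, ?_⟩
      rw [Int.natAbs_pow, Int.natAbs_natCast] at h2
      have := h1.dvd_of_dvd_pow h2
      exact (Dvd.dvd.mul_left (Int.natCast_dvd_natCast.2 this) 2).mul_right _
  have hpart : ∀ k : ℕ, hlPartialProduct (((2 * t : ℕ) : ℤ) ^ 2) (2 * (2 * t : ℕ) * k)
      (k ^ 2 + β ^ 2) = hlPartialProduct (((2 * t : ℕ) : ℤ) ^ 2) 0 (β ^ 2) := by
    intro k
    funext n
    rw [hlPartialProduct, hlPartialProduct]
    congr! 5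
    ring
  rw [IsHLConstant, key, hpart] at h ⊢
  exact h

lemma tendsto_sqrt_div_log_atTop :
    Tendsto (fun N : ℕ => Real.sqrt ((N + 1 : ℕ) : ℝ) / Real.log ((N + 1 : ℕ) : ℝ)) atTop atTop := by
  have h1 : Tendsto (fun x : ℝ => Real.log x / x ^ (1 / 2 : ℝ)) atTop (𝓝[>] 0) := by
    rw [tendsto_nhdsWithin_iff]
    refine ⟨(isLittleO_log_rpow_atTop (by norm_num : (0 : ℝ) < 1 / 2)).tendsto_div_nhds_zero, ?_⟩
    filter_upwards [eventually_gt_atTop 1] with x hx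
    exact div_pos (Real.log_pos hx) (Real.rpow_pos_of_pos (by linarith) _)
  have h2 := h1.inv_tendsto_nhdsGT_zero
  have h3 : Tendsto (fun N : ℕ => ((N + 1 : ℕ) : ℝ)) atTop atTop :=
    tendsto_natCast_atTop_atTop.comp (tendsto_add_atTop_nat 1)
  refine (h2.comp h3).congr fun N => ?_
  simp [Real.sqrt_eq_rpow]

/-- Under the Hardy-Littlewood conjecture the primes `p = x² + β²` are asymptotically equally
distributed among the admissible residue classes of `x`. The common constant is nonzero because the
conjecture provides infinitely many such primes. -/
lemma HardyLittlewoodConjecture.exists_tendsto_residuePrimes (hHL : HardyLittlewoodConjecture)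
    {m : ℕ} (hm : 0 < m) (hm2 : 2 ∣ m) {β : ℤ} (hβ : β ≠ 0) (hA : (admissibleResidues m β).Nonempty) :
    ∃ δ : ℝ, δ ≠ 0 ∧ ∀ k ∈ admissibleResidues m β,
      Tendsto (fun N : ℕ => ((residuePrimes m β k N).ncard : ℝ) /
        (Real.sqrt ((N + 1 : ℕ) : ℝ) / Real.log ((N + 1 : ℕ) : ℝ))) atTop (𝓝 δ) := by
  have hm0 : (m : ℤ) ≠ 0 := by exact_mod_cast hm.ne'
  have hk := fun k (hkA : k ∈ admissibleResidues m β) =>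
    hHL ((m : ℤ) ^ 2) (2 * m * k) (k ^ 2 + β ^ 2) (by positivity)
    (by
      have hc : IsCoprime ((k : ℤ) ^ 2 + β ^ 2) m := (Finset.mem_filter.1 hkA).2
      have h1 : IsCoprime ((m : ℤ) ^ 2) (k ^ 2 + β ^ 2) := hc.symm.pow_left
      rw [Int.isCoprime_iff_gcd_eq_one] at h1
      refine Nat.dvd_one.1 (h1 ▸ Int.dvd_gcd ?_ ?_)
      · exact Int.gcd_dvd_left _ _
      · exact (Int.gcd_dvd_right _ _).trans (Int.gcd_dvd_right _ _))
    (by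
      rintro ⟨-, hc2⟩
      have hc : IsCoprime ((k : ℤ) ^ 2 + β ^ 2) m := (Finset.mem_filter.1 hkA).2
      have := hc.isUnit_of_dvd' hc2.two_dvd (by exact_mod_cast hm2)
      norm_num [Int.isUnit_iff] at this)
    (by
      rintro ⟨r, hr⟩
      have h1 : (2 * (m : ℤ) * k) ^ 2 - 4 * (m : ℤ) ^ 2 * (k ^ 2 + β ^ 2) = -(2 * m * β) ^ 2 := by
        ring
      rw [h1] at hr
      have : 0 < (2 * (m : ℤ) * β) ^ 2 := by positivity
      nlinarith [mul_self_nonneg r])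
  obtain ⟨k₀, hk₀⟩ := hA
  obtain ⟨⟨δ, hδ, hδas⟩, hinf⟩ := hk k₀ hk₀
  have hδ0 : δ ≠ 0 := by
    rintro rfl
    simp only [zero_mul] at hδas
    have hz : ∀ᶠ n : ℕ in atTop,
        (quadPrimeCount ((m : ℤ) ^ 2) (2 * m * k₀) (k₀ ^ 2 + β ^ 2) n : ℝ) = 0 :=
      isEquivalent_zero_iff_eventually_zero.1 hδas
    obtain ⟨n₀, hn₀⟩ := eventually_atTop.1 hz
    obtain ⟨p, hp⟩ := hinf.nonempty
    have h1 := hn₀ (max n₀ (p + 1)) (le_max_left _ _)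
    rw [Nat.cast_eq_zero, quadPrimeCount, Set.ncard_eq_zero
      ((Set.finite_Iio (max n₀ (p + 1))).subset fun _ h => h.2.1)] at h1
    have : p ∈ (∅ : Set ℕ) := h1 ▸ ⟨hp.1, lt_max_of_lt_right (Nat.lt_succ_self p), hp.2⟩
    exact this
  refine ⟨δ, hδ0, fun k hkA => ?_⟩
  obtain ⟨⟨δ', hδ', has⟩, -⟩ := hk k hkA
  obtain rfl : δ' = δ := tendsto_nhds_unique hδ' (isHLConstant_congr hm β k₀ k hδ hm2)
  have has' := has.comp_tendsto (tendsto_add_atTop_nat 1)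
  have hs := tendsto_sqrt_div_log_atTop
  have hne : ∀ᶠ N : ℕ in atTop, Real.sqrt ((N + 1 : ℕ) : ℝ) / Real.log ((N + 1 : ℕ) : ℝ) ≠ 0 :=
    hs.eventually_ne_atTop 0
  have hone := (isEquivalent_iff_tendsto_one
    (hne.mono fun N hN => mul_ne_zero hδ0 hN)).1 has'
  have := hone.const_mul δ'
  rw [mul_one] at this
  refine this.congr' (hne.mono fun N hN => ?_)
  have hkm : k < m := Finset.mem_range.1 (Finset.mem_filter.1 hkA).1
  simp only [Pi.div_apply, Function.comp_apply, ncard_residuePrimes hkm]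
  field_simp

lemma residuePrimes_disjoint {m : ℕ} {β : ℤ} {k k' : ℕ} (hkk : k ≠ k') (N : ℕ) :
    Disjoint (residuePrimes m β k N) (residuePrimes m β k' N) := by
  rw [Set.disjoint_left]
  rintro p ⟨-, -, x, hx, hp⟩ ⟨-, -, y, hy, hp'⟩
  have : (x : ℤ) ^ 2 = y ^ 2 := by linarith
  have : x ^ 2 = y ^ 2 := by exact_mod_cast this
  have := Nat.pow_left_injective two_ne_zero this
  exact hkk (by rw [← hx, ← hy, this])

/-- The number of primes `p = x² + β² ≤ N` with a property that, outside a finite set, amounts to a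
congruence condition on `x` modulo `m`. -/
lemma tendsto_ncard_quadPrimes {m : ℕ} (hm : 0 < m) {β : ℤ} {δ : ℝ}
    (hδ : ∀ k ∈ admissibleResidues m β,
      Tendsto (fun N : ℕ => ((residuePrimes m β k N).ncard : ℝ) /
        (Real.sqrt ((N + 1 : ℕ) : ℝ) / Real.log ((N + 1 : ℕ) : ℝ))) atTop (𝓝 δ))
    {T : ℕ → Prop} {G : Finset ℕ} (hG : G ⊆ admissibleResidues m β) {B : Set ℕ} (hB : B.Finite)
    (hT : ∀ p : ℕ, p.Prime → p ∉ B → ∀ x : ℕ, (p : ℤ) = (x : ℤ) ^ 2 + β ^ 2 →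
      x % m ∈ admissibleResidues m β → (T p ↔ x % m ∈ G)) :
    Tendsto (fun N : ℕ => (Set.ncard {p ∈ quadPrimes β N | T p} : ℝ) /
        (Real.sqrt ((N + 1 : ℕ) : ℝ) / Real.log ((N + 1 : ℕ) : ℝ))) atTop (𝓝 (G.card * δ)) := by
  classical
  set s : ℕ → ℝ := fun N => Real.sqrt ((N + 1 : ℕ) : ℝ) / Real.log ((N + 1 : ℕ) : ℝ) with hs
  set B' : Set ℕ := B ∪ m.primeFactors with hB'
  have hB'fin : B'.Finite := hB.union (Finset.finite_toSet _)
  have hsfin : ∀ N, {p ∈ quadPrimes β N | T p}.Finite := fun N =>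
    (Set.finite_Iic N).subset fun _ hp => hp.1.2.1
  -- the residue class of `x` is admissible unless `p` divides `m`
  have hadm : ∀ p : ℕ, p.Prime → p ∉ m.primeFactors → ∀ x : ℕ, (p : ℤ) = (x : ℤ) ^ 2 + β ^ 2 →
      x % m ∈ admissibleResidues m β := by
    intro p hp hpm x hpx
    refine Finset.mem_filter.2 ⟨Finset.mem_range.2 (Nat.mod_lt _ hm), ?_⟩
    have hcop : IsCoprime (p : ℤ) m := by
      rw [Nat.isCoprime_iff_coprime, hp.coprime_iff_not_dvd]
      exact fun h => hpm (Nat.mem_primeFactors.2 ⟨hp, h, hm.ne'⟩)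
    obtain ⟨q, hq⟩ : (m : ℤ) ∣ (x : ℤ) - (x % m : ℕ) := by
      rw [Int.natCast_mod]; exact Int.dvd_self_sub_emod
    have hx : (x : ℤ) = m * q + (x % m : ℕ) := by linarith
    have h2 : ((x % m : ℕ) : ℤ) ^ 2 + β ^ 2 = p + m * (-(m * q ^ 2) - 2 * q * (x % m : ℕ)) := by
      rw [hpx]; linear_combination -((x : ℤ) + m * q + (x % m : ℕ)) * hx
    rw [h2]
    exact hcop.add_mul_left_left _
  set U : ℕ → Set ℕ := fun N => ⋃ k ∈ G, residuePrimes m β k N with hU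
  have hUfin : ∀ N, (U N).Finite := fun N =>
    Set.Finite.biUnion (Finset.finite_toSet G) fun k _ => residuePrimes_finite m β k N
  have hUcard : ∀ N, ((U N).ncard : ℝ) = ∑ k ∈ G, ((residuePrimes m β k N).ncard : ℝ) := by
    intro N
    have : (U N).ncard = ∑ k ∈ G, (residuePrimes m β k N).ncard := by
      have hU' : U N = ((G.biUnion fun k => (residuePrimes_finite m β k N).toFinset : Finset ℕ) :
          Set ℕ) := by
        ext p; simp [hU]
      rw [hU', Set.ncard_coe_finset, Finset.card_biUnion]
      · exact Finset.sum_congr rfl fun k _ => (Set.ncard_eq_toFinset_card _ _).symm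
      · intro k _ k' _ hkk
        refine Set.Finite.disjoint_toFinset.2 ?_
        exact residuePrimes_disjoint hkk N
    exact_mod_cast this
  have hmem : ∀ N p, p ∉ B' → (p ∈ {p ∈ quadPrimes β N | T p} ↔ p ∈ U N) := by
    intro N p hpB
    rw [hB', Set.mem_union, not_or] at hpB
    simp only [hU, Set.mem_iUnion, quadPrimes, Set.mem_ofPred_eq, residuePrimes]
    constructor
    · rintro ⟨⟨hp, hpN, x, hx⟩, hTp⟩
      have hx' : (p : ℤ) = (x.natAbs : ℤ) ^ 2 + β ^ 2 := by rw [Int.natAbs_sq]; linarith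
      have hA := hadm p hp hpB.2 _ hx'
      exact ⟨_, (hT p hp hpB.1 _ hx' hA).1 hTp, hp, hpN, _, rfl, hx'⟩
    · rintro ⟨k, hk, hp, hpN, x, rfl, hx⟩
      exact ⟨⟨hp, hpN, x, by linarith⟩, (hT p hp hpB.1 x hx (hadm p hp hpB.2 x hx)).2 hk⟩
  have hdiff : ∀ N, |((Set.ncard {p ∈ quadPrimes β N | T p} : ℕ) : ℝ) - ((U N).ncard : ℝ)| ≤
      B'.ncard := by
    intro N
    have h1 : {p ∈ quadPrimes β N | T p}.ncard ≤ (U N).ncard + B'.ncard := by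
      refine (Set.ncard_le_ncard ?_ ((hUfin N).union hB'fin)).trans (Set.ncard_union_le _ _)
      intro p hp
      by_cases hpB : p ∈ B'
      · exact Or.inr hpB
      · exact Or.inl ((hmem N p hpB).1 hp)
    have h2 : (U N).ncard ≤ {p ∈ quadPrimes β N | T p}.ncard + B'.ncard := by
      refine (Set.ncard_le_ncard ?_ ((hsfin N).union hB'fin)).trans (Set.ncard_union_le _ _)
      intro p hp
      by_cases hpB : p ∈ B'
      · exact Or.inr hpB
      · exact Or.inl ((hmem N p hpB).2 hp)
    have h1' : (({p ∈ quadPrimes β N | T p}.ncard : ℕ) : ℝ) ≤ (U N).ncard + B'.ncard := by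
      exact_mod_cast h1
    have h2' : ((U N).ncard : ℝ) ≤ ({p ∈ quadPrimes β N | T p}.ncard : ℕ) + B'.ncard := by
      exact_mod_cast h2
    rw [abs_le]; constructor <;> linarith
  have hst : Tendsto s atTop atTop := tendsto_sqrt_div_log_atTop
  have hUlim : Tendsto (fun N => ((U N).ncard : ℝ) / s N) atTop (𝓝 (G.card * δ)) := by
    have : ∀ N, ((U N).ncard : ℝ) / s N = ∑ k ∈ G, ((residuePrimes m β k N).ncard : ℝ) / s N :=
      fun N => by rw [hUcard, Finset.sum_div]
    simp_rw [this]
    rw [← nsmul_eq_mul, ← Finset.sum_const]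
    exact tendsto_finsetSum _ fun k hk => hδ k (hG hk)
  have herr : Tendsto (fun N => (((Set.ncard {p ∈ quadPrimes β N | T p} : ℕ) : ℝ) -
      ((U N).ncard : ℝ)) / s N) atTop (𝓝 0) := by
    refine squeeze_zero_norm' (a := fun N => (B'.ncard : ℝ) / s N) ?_
      (hst.const_div_atTop _)
    filter_upwards [hst.eventually_gt_atTop 0] with N hN
    rw [norm_div, Real.norm_eq_abs, Real.norm_eq_abs, abs_of_pos hN]
    gcongr
    exact hdiff N
  have := herr.add hUlim
  rw [zero_add] at this
  refine this.congr fun N => ?_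
  rw [← add_div, sub_add_cancel]

/-- Under the Hardy-Littlewood conjecture, a property of the primes `p = x² + β²` which amounts to
a congruence condition on `x` has the expected density. -/
lemma HardyLittlewoodConjecture.tendsto_ratio (hHL : HardyLittlewoodConjecture)
    {m : ℕ} (hm : 0 < m) (hm2 : 2 ∣ m) {β : ℤ} (hβ : β ≠ 0) (hA : (admissibleResidues m β).Nonempty)
    {T : ℕ → Prop} {G : Finset ℕ} (hG : G ⊆ admissibleResidues m β) {B : Set ℕ} (hB : B.Finite)
    (hT : ∀ p : ℕ, p.Prime → p ∉ B → ∀ x : ℕ, (p : ℤ) = (x : ℤ) ^ 2 + β ^ 2 →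
      x % m ∈ admissibleResidues m β → (T p ↔ x % m ∈ G)) :
    Tendsto (fun N : ℕ => (Set.ncard {p ∈ quadPrimes β N | T p} : ℝ) /
        (Set.ncard (quadPrimes β N) : ℝ)) atTop
      (𝓝 ((G.card : ℝ) / (admissibleResidues m β).card)) := by
  obtain ⟨δ, hδ0, hδ⟩ := hHL.exists_tendsto_residuePrimes hm hm2 hβ hA
  have h1 := tendsto_ncard_quadPrimes hm hδ hG hB hT
  have h2 := tendsto_ncard_quadPrimes (T := fun _ => True) hm hδ (Finset.Subset.refl _)
    Set.finite_empty (fun _ _ _ _ _ h => iff_of_true trivial h)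
  simp only [and_true, Set.ofPred_mem_eq] at h2
  have hA0 : ((admissibleResidues m β).card : ℝ) ≠ 0 := by
    exact_mod_cast (Finset.card_pos.2 hA).ne'
  have h3 := h1.div h2 (mul_ne_zero hA0 hδ0)
  rw [mul_div_mul_right _ _ hδ0] at h3
  refine h3.congr' ((tendsto_sqrt_div_log_atTop.eventually_ne_atTop 0).mono fun N hN => ?_)
  simp only [Pi.div_apply]
  rw [div_div_div_cancel_right₀ hN]

/-! ### Sums over the admissible residues -/

/-- The residue `± k` with the sign chosen such that `± k ≡ 1 (mod 4)` for odd `k`. -/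
def signedResidue (k : ℕ) : ℤ := if k % 4 = 1 then k else -k

/-- The number of residues `x` modulo `l` with `l ∤ x² + β²`. -/
def localCount (l : ℕ) [NeZero l] (β : ℤ) : ℕ :=
  (Finset.univ.filter (fun x : ZMod l => x ^ 2 + (β : ZMod l) ^ 2 ≠ 0)).card

lemma IsLocalSymbol.sum_pow_eq {l : ℕ} [Fact l.Prime] {β : ℤ} {φ : ZMod l → GaussianInt}
    (hφ : IsLocalSymbol l β φ) {n : ℕ} (hn : n ≠ 0) :
    ∑ x, φ x ^ n = ((if 4 ∣ n ∨ (l : ℤ) ∣ β then (localCount l β : ℤ) else -1 : ℤ) :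
      GaussianInt) := by
  split_ifs with h
  · have h1 : ∀ x, φ x ^ n = if x ^ 2 + (β : ZMod l) ^ 2 ≠ 0 then 1 else 0 := by
      intro x
      split_ifs with hx
      · rcases h with ⟨k, rfl⟩ | h
        · rw [pow_mul, hφ.pow_four x hx, one_pow]
        · rw [hφ.eq_one h x hx, one_pow]
      · rw [hφ.apply_eq_zero x (not_not.1 hx), zero_pow hn]
    rw [Finset.sum_congr rfl fun x _ => h1 x, Finset.sum_boole, localCount]
    simp
  · rw [not_or] at h
    rw [hφ.sum_pow h.2 n h.1]
    simp

lemma localCount_eq {l : ℕ} [Fact l.Prime] (hl2 : l ≠ 2) {β : ℤ} (hβ : ¬ (l : ℤ) ∣ β) :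
    localCount l β = if l % 4 = 1 then l - 2 else l := by
  have hβ0 : (β : ZMod l) ≠ 0 := by rwa [Ne, ZMod.intCast_zmod_eq_zero_iff_dvd]
  have hodd := (Fact.out : l.Prime).eq_two_or_odd
  have h2 : (2 : ZMod l) ≠ 0 := by
    intro h
    have := (ZMod.natCast_eq_zero_iff 2 l).1 (by exact_mod_cast h)
    exact hl2 ((Nat.prime_dvd_prime_iff_eq Fact.out Nat.prime_two).1 this)
  split_ifs with hl
  · obtain ⟨i, hi⟩ : ∃ i : ZMod l, i ^ 2 = -1 := by
      obtain ⟨i, hi⟩ := ZMod.exists_sq_eq_neg_one_iff.2 (show l % 4 ≠ 3 by omega)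
      exact ⟨i, by rw [sq, hi]⟩
    have hi0 : i ≠ 0 := by rintro rfl; norm_num at hi
    have hne : (β : ZMod l) * i ≠ -(β * i) := by
      intro h
      exact mul_ne_zero h2 (mul_ne_zero hβ0 hi0) (by linear_combination h)
    have : Finset.univ.filter (fun x : ZMod l => x ^ 2 + (β : ZMod l) ^ 2 ≠ 0) =
        Finset.univ \ {(β : ZMod l) * i, -(β * i)} := by
      ext x
      have : x ^ 2 + (β : ZMod l) ^ 2 = (x - β * i) * (x - -(β * i)) := by
        linear_combination (β : ZMod l) ^ 2 * hi
      simp only [Finset.mem_filter, Finset.mem_univ, true_and, Finset.mem_sdiff,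
        Finset.mem_insert, Finset.mem_singleton, this, Ne, mul_eq_zero, sub_eq_zero]
    rw [localCount, this, Finset.card_sdiff_of_subset (Finset.subset_univ _), Finset.card_univ,
      ZMod.card, Finset.card_pair hne]
  · have : Finset.univ.filter (fun x : ZMod l => x ^ 2 + (β : ZMod l) ^ 2 ≠ 0) = Finset.univ := by
      refine Finset.filter_true_of_mem fun x _ h => ?_
      refine ZMod.exists_sq_eq_neg_one_iff.1 (⟨x / β, ?_⟩ : IsSquare (-1 : ZMod l))
        (by omega : l % 4 = 3)
      field_simp
      linear_combination -h
    rw [localCount, this, Finset.card_univ, ZMod.card]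

lemma localCount_pos {l : ℕ} [Fact l.Prime] (hl2 : l ≠ 2) (β : ℤ) : 0 < localCount l β := by
  by_cases hβ : (l : ℤ) ∣ β
  · have hβ0 : (β : ZMod l) = 0 := by rwa [ZMod.intCast_zmod_eq_zero_iff_dvd]
    exact Finset.card_pos.2 ⟨1, by simp [hβ0]⟩
  · rw [localCount_eq hl2 hβ]
    have := (Fact.out : l.Prime).two_le
    split_ifs <;> omega

section CRT

variable {ι : Type*} [Fintype ι] (q : ι → ℕ) [∀ i, Fact (q i).Prime]

/-- The Chinese remainder theorem: a sum over the odd residues modulo `4 ∏ qᵢ` factors. -/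
lemma sum_odd_residues (hinj : Function.Injective q) (hodd : ∀ i, q i ≠ 2) {R : Type*} [CommRing R]
    (f : ∀ i, ZMod (q i) → R) :
    ∑ k ∈ (Finset.range (4 * ∏ i, q i)).filter Odd, ∏ i, f i (signedResidue k : ℤ) =
      2 * ∏ i, ∑ x, f i x := by
  classical
  have hq : ∀ i, (q i).Prime := fun i => Fact.out
  have hcop : Pairwise (Function.onFun Nat.Coprime q) := fun i j hij =>
    (Nat.coprime_primes (hq i) (hq j)).2 (hinj.ne hij)
  have h4 : Nat.Coprime 4 (∏ i, q i) := Nat.Coprime.prod_right fun i _ => by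
    have : Nat.Coprime (2 ^ 2) (q i) :=
      ((Nat.coprime_primes Nat.prime_two (hq i)).2 (hodd i).symm).pow_left 2
    exact this
  have hm : 0 < 4 * ∏ i, q i := Nat.mul_pos (by norm_num) (Finset.prod_pos fun i _ => (hq i).pos)
  have : NeZero (4 * ∏ i, q i) := ⟨hm.ne'⟩
  let e : ZMod (4 * ∏ i, q i) ≃+* ZMod 4 × (∀ i, ZMod (q i)) :=
    (ZMod.chineseRemainder h4).trans ((RingEquiv.refl _).prodCongr (ZMod.prodEquivPi q hcop))
  have he : ∀ k : ℕ, e k = ((k : ZMod 4), fun i => (k : ZMod (q i))) := by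
    intro k
    rw [map_natCast]
    rfl
  have h1 : ∑ k ∈ (Finset.range (4 * ∏ i, q i)).filter Odd,
      ∏ i, f i (signedResidue k : ℤ) =
      ∑ u ∈ ({1, 3} : Finset (ZMod 4)) ×ˢ (Finset.univ : Finset (∀ i, ZMod (q i))),
        ∏ i, f i (if u.1 = 1 then u.2 i else -u.2 i) := by
    refine Finset.sum_nbij' (fun k => e (k : ℕ)) (fun u => (e.symm u).val) ?_ ?_ ?_ ?_ ?_
    · intro k hk
      have hk2 := Nat.odd_iff.1 (Finset.mem_filter.1 hk).2
      rw [he, Finset.mem_product]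
      refine ⟨?_, Finset.mem_univ _⟩
      rcases (show k % 4 = 1 ∨ k % 4 = 3 by omega) with h | h
      · have : (k : ZMod 4) = 1 := by rw [← ZMod.natCast_mod k 4, h]; rfl
        simp [this]
      · have : (k : ZMod 4) = 3 := by rw [← ZMod.natCast_mod k 4, h]; rfl
        simp [this]
    · intro u hu
      refine Finset.mem_filter.2 ⟨Finset.mem_range.2 (ZMod.val_lt _), ?_⟩
      have h := congrArg Prod.fst (he (e.symm u).val)
      rw [ZMod.natCast_zmod_val, RingEquiv.apply_symm_apply] at h
      have hu1 := (Finset.mem_product.1 hu).1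
      generalize (e.symm u).val = k at h
      simp only [] at h
      rw [h, ← ZMod.natCast_mod k 4] at hu1
      have hlt := Nat.mod_lt k (show 0 < 4 by norm_num)
      rw [Nat.odd_iff]
      have : k % 4 = 1 ∨ k % 4 = 3 := by
        generalize k % 4 = a at *
        interval_cases a
        · exact absurd hu1 (by decide)
        · left; rfl
        · exact absurd hu1 (by decide)
        · right; rfl
      omega
    · intro k hk
      have := Finset.mem_range.1 (Finset.mem_filter.1 hk).1
      rw [RingEquiv.symm_apply_apply, ZMod.val_natCast, Nat.mod_eq_of_lt this]
    · intro u _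
      rw [ZMod.natCast_zmod_val, RingEquiv.apply_symm_apply]
    · intro k hk
      rw [he]
      have hk2 := Nat.odd_iff.1 (Finset.mem_filter.1 hk).2
      refine Finset.prod_congr rfl fun i _ => ?_
      rcases (show k % 4 = 1 ∨ k % 4 = 3 by omega) with h | h
      · have h1 : (k : ZMod 4) = 1 := by rw [← ZMod.natCast_mod k 4, h]; rfl
        simp [signedResidue, h, h1]
      · have h1 : (k : ZMod 4) ≠ 1 := by rw [← ZMod.natCast_mod k 4, h]; decide
        simp [signedResidue, h, h1]
  have h2 : ∀ g : ∀ i, ZMod (q i) → R,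
      ∑ w : (∀ i, ZMod (q i)), ∏ i, g i (w i) = ∏ i, ∑ x, g i x := by
    intro g
    rw [Finset.prod_univ_sum, Fintype.piFinset_univ]
  rw [h1, Finset.sum_product, Finset.sum_pair (by decide)]
  simp only [if_true, if_neg (show ¬ (3 : ZMod 4) = 1 by decide)]
  rw [h2, h2 (fun i x => f i (-x)), two_mul]
  congr 1
  exact Finset.prod_congr rfl fun i _ => Equiv.sum_comp (Equiv.neg _) (f i)

lemma mem_admissibleResidues_iff {β : ℤ} (hβ : 2 ∣ β) (k : ℕ) :
    k ∈ admissibleResidues (4 * ∏ i, q i) β ↔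
      k ∈ (Finset.range (4 * ∏ i, q i)).filter Odd ∧
        ∀ i, ((signedResidue k : ℤ) : ZMod (q i)) ^ 2 + (β : ZMod (q i)) ^ 2 ≠ 0 := by
  have hsq : ∀ i, ((signedResidue k : ℤ) : ZMod (q i)) ^ 2 + (β : ZMod (q i)) ^ 2 =
      (((k : ℤ) ^ 2 + β ^ 2 : ℤ) : ZMod (q i)) := by
    intro i
    rw [signedResidue]
    split_ifs <;> push_cast <;> ring
  simp only [hsq, Ne, ZMod.intCast_zmod_eq_zero_iff_dvd]
  rw [admissibleResidues, Finset.mem_filter, Finset.mem_filter, and_assoc]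
  refine and_congr_right fun _ => ?_
  push_cast
  rw [IsCoprime.mul_right_iff, IsCoprime.prod_right_iff]
  refine and_congr ?_ ?_
  · have h1 : IsCoprime ((k : ℤ) ^ 2 + β ^ 2) (4 : ℤ) ↔ IsCoprime ((k : ℤ) ^ 2 + β ^ 2) (2 : ℤ) := by
      rw [show (4 : ℤ) = 2 ^ 2 by norm_num, IsCoprime.pow_right_iff (by norm_num)]
    have h2 : IsCoprime ((k : ℤ) ^ 2 + β ^ 2) (2 : ℤ) ↔ Odd ((k : ℤ) ^ 2 + β ^ 2) := by
      rw [isCoprime_comm, Int.isCoprime_iff_gcd_eq_one, ← Int.natAbs_odd]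
      change Nat.Coprime 2 _ ↔ _
      rw [Nat.coprime_two_left]
    have h3 : Even (β ^ 2) := (even_iff_two_dvd.2 hβ).pow_of_ne_zero (by norm_num)
    rw [h1, h2, ← Int.odd_coe_nat k]
    constructor
    · intro h
      have := (Int.odd_add.1 h).2 h3
      exact Int.Odd.of_mul_left (n := (k : ℤ)) (by rwa [← sq])
    · intro h
      exact h.pow.add_even h3
  · simp only [Finset.mem_univ, forall_const]
    refine forall_congr' fun i => ?_
    rw [isCoprime_comm]
    exact (Nat.prime_iff_prime_int.1 Fact.out : Prime (q i : ℤ)).coprime_iff_not_dvd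

variable {q}

/-- The local symbols vanish exactly at the residues that are not admissible, so that the sum may be
extended to all odd residues, where it factors. -/
lemma sum_admissibleResidues (hinj : Function.Injective q) (hodd : ∀ i, q i ≠ 2) {β : ℤ}
    (hβ : 2 ∣ β) {φ : ∀ i, ZMod (q i) → GaussianInt} (hφ : ∀ i, IsLocalSymbol (q i) β (φ i))
    {e : ι → ℕ} (he : ∀ i, e i ≠ 0) :
    ∑ k ∈ admissibleResidues (4 * ∏ i, q i) β, ∏ i, φ i (signedResidue k : ℤ) ^ e i =
      ((2 * ∏ i, (if 4 ∣ e i ∨ (q i : ℤ) ∣ β then (localCount (q i) β : ℤ) else -1) : ℤ) :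
        GaussianInt) := by
  have h1 := sum_odd_residues q hinj hodd (fun i x => φ i x ^ e i)
  rw [Int.cast_mul, Int.cast_prod, ← Finset.prod_congr rfl fun i _ => (hφ i).sum_pow_eq (he i)]
  rw [Int.cast_ofNat, ← h1]
  refine Finset.sum_subset (fun k hk => ((mem_admissibleResidues_iff q hβ k).1 hk).1) ?_
  intro k hk hkA
  rw [mem_admissibleResidues_iff q hβ, not_and] at hkA
  have := hkA hk
  push Not at this
  obtain ⟨i, hi⟩ := this
  exact Finset.prod_eq_zero (Finset.mem_univ i) (by
    rw [(hφ i).apply_eq_zero _ hi, zero_pow (he i)])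

end CRT

/-! ### The distribution of the residue symbol -/

section Densities

variable {ι : Type*} [Fintype ι] {q : ι → ℕ} [∀ i, Fact (q i).Prime]

/-- The product `∏ φᵢ(X)^(eᵢ)` of local symbols, for `X` the signed residue in the class of `k`. -/
def residueSymbol (φ : ∀ i, ZMod (q i) → GaussianInt) (e : ι → ℕ) (k : ℕ) : GaussianInt :=
  ∏ i, φ i (signedResidue k : ℤ) ^ e i

lemma four_mul_ite_eq_gaussI {w : GaussianInt} (hw : w ^ 4 = 1) :
    4 * (if w = gaussI then 1 else 0 : GaussianInt) =
      w ^ 4 - gaussI * w - w ^ 2 + gaussI * w ^ 3 := by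
  have hI := gaussI_sq
  have h : (w - 1) * (w + 1) * ((w - gaussI) * (w + gaussI)) = 0 := by
    linear_combination hw - (w ^ 2 - 1) * hI
  rcases mul_eq_zero.1 h with h | h <;> rcases mul_eq_zero.1 h with h | h
  · obtain rfl : w = 1 := by linear_combination h
    decide
  · obtain rfl : w = -1 := by linear_combination h
    decide
  · obtain rfl : w = gaussI := by linear_combination h
    decide
  · obtain rfl : w = -gaussI := by linear_combination h
    decide

lemma residueSymbol_pow (φ : ∀ i, ZMod (q i) → GaussianInt) (e : ι → ℕ) (k n : ℕ) :
    residueSymbol φ e k ^ n = ∏ i, φ i (signedResidue k : ℤ) ^ (n * e i) := by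
  rw [residueSymbol, ← Finset.prod_pow]
  exact Finset.prod_congr rfl fun i _ => by rw [← pow_mul, mul_comm]

lemma residueSymbol_pow_four {β : ℤ} (hβ : 2 ∣ β) {φ : ∀ i, ZMod (q i) → GaussianInt}
    (hφ : ∀ i, IsLocalSymbol (q i) β (φ i)) (e : ι → ℕ) {k : ℕ}
    (hk : k ∈ admissibleResidues (4 * ∏ i, q i) β) : residueSymbol φ e k ^ 4 = 1 := by
  rw [residueSymbol_pow]
  refine Finset.prod_eq_one fun i _ => ?_
  rw [pow_mul, (hφ i).pow_four _ (((mem_admissibleResidues_iff q hβ k).1 hk).2 i), one_pow]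

variable (q) in
/-- The mean over the admissible residues of a product of powers of local symbols: a factor
`-1 / τ(qᵢ)` for each `qᵢ ∤ β`, and a factor `1` for the `qᵢ ∣ β` and at the indices in `triv`, where
the power of the symbol is trivial. -/
noncomputable def meanSymbol (β : ℤ) (triv : ι → Prop) [DecidablePred triv] : ℝ :=
  ∏ i, if triv i ∨ (q i : ℤ) ∣ β then 1 else -1 / (localCount (q i) β : ℝ)

lemma card_admissibleResidues (hinj : Function.Injective q) (hodd : ∀ i, q i ≠ 2) {β : ℤ}
    (hβ : 2 ∣ β) {φ : ∀ i, ZMod (q i) → GaussianInt} (hφ : ∀ i, IsLocalSymbol (q i) β (φ i)) :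
    ((admissibleResidues (4 * ∏ i, q i) β).card : ℤ) = 2 * ∏ i, (localCount (q i) β : ℤ) := by
  have h := sum_admissibleResidues hinj hodd hβ hφ (e := fun _ => 4) (fun _ => by norm_num)
  have h1 : ∀ k ∈ admissibleResidues (4 * ∏ i, q i) β,
      ∏ i, φ i (signedResidue k : ℤ) ^ 4 = 1 := by
    intro k hk
    refine Finset.prod_eq_one fun i _ => ?_
    rw [(hφ i).pow_four _ (((mem_admissibleResidues_iff q hβ k).1 hk).2 i)]
  rw [Finset.sum_congr rfl h1, Finset.sum_const, nsmul_one] at h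
  simp only [dvd_refl, true_or, if_true] at h
  exact_mod_cast h

/-- The sums over the admissible residues of the powers of the residue symbol, normalised. -/
lemma sum_residueSymbol_pow (hinj : Function.Injective q) (hodd : ∀ i, q i ≠ 2) {β : ℤ}
    (hβ : 2 ∣ β) {φ : ∀ i, ZMod (q i) → GaussianInt} (hφ : ∀ i, IsLocalSymbol (q i) β (φ i))
    {e : ι → ℕ} (he : ∀ i, e i ≠ 0) {n : ℕ} (hn : n ≠ 0) :
    ∃ S : ℤ, ∑ k ∈ admissibleResidues (4 * ∏ i, q i) β, residueSymbol φ e k ^ n = (S : GaussianInt) ∧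
      (S : ℝ) = (admissibleResidues (4 * ∏ i, q i) β).card *
        meanSymbol q β (fun i => 4 ∣ n * e i) := by
  refine ⟨_, (Finset.sum_congr rfl fun k _ => residueSymbol_pow φ e k n).trans
    (sum_admissibleResidues hinj hodd hβ hφ (fun i => mul_ne_zero hn (he i))), ?_⟩
  have h := card_admissibleResidues hinj hodd hβ hφ
  have h' : ((admissibleResidues (4 * ∏ i, q i) β).card : ℝ) = 2 * ∏ i, (localCount (q i) β : ℝ) := by
    exact_mod_cast congrArg (Int.cast : ℤ → ℝ) h
  rw [h', meanSymbol, mul_assoc, ← Finset.prod_mul_distrib]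
  push_cast
  congr 1
  refine Finset.prod_congr rfl fun i _ => ?_
  have hpos : (localCount (q i) β : ℝ) ≠ 0 := by
    exact_mod_cast (localCount_pos (hodd i) β).ne'
  split_ifs
  · simp
  · field_simp

/-- Fourier inversion on the fourth roots of unity: the proportion of the admissible residues at
which `c ∏ φᵢ^(eᵢ)` takes the value `i`, for `c = ± i` and for `c = ± 1`. -/
lemma card_filter_residueSymbol (hinj : Function.Injective q) (hodd : ∀ i, q i ≠ 2) {β : ℤ}
    (hβ : 2 ∣ β) {φ : ∀ i, ZMod (q i) → GaussianInt} (hφ : ∀ i, IsLocalSymbol (q i) β (φ i))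
    {e : ι → ℕ} (he : ∀ i, ¬ 4 ∣ e i) {κ : ℤ} (hκ : κ ^ 2 = 1) :
    ((((admissibleResidues (4 * ∏ i, q i) β).filter
        fun k => (κ : GaussianInt) * gaussI * residueSymbol φ e k = gaussI).card : ℝ) /
      (admissibleResidues (4 * ∏ i, q i) β).card =
      1 / 4 * (1 + meanSymbol q β (fun i => e i % 4 = 2) +
        κ * (2 * meanSymbol q β (fun _ => False)))) ∧
    ((((admissibleResidues (4 * ∏ i, q i) β).filter
        fun k => (κ : GaussianInt) * residueSymbol φ e k = gaussI).card : ℝ) /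
      (admissibleResidues (4 * ∏ i, q i) β).card =
      1 / 4 * (1 - meanSymbol q β (fun i => e i % 4 = 2))) := by
  have he0 : ∀ i, e i ≠ 0 := fun i h => he i (by rw [h]; exact dvd_zero 4)
  set A := admissibleResidues (4 * ∏ i, q i) β with hA
  have hAcard : (A.card : ℝ) ≠ 0 := by
    have h := card_admissibleResidues hinj hodd hβ hφ
    have : 0 < (A.card : ℤ) := by
      rw [h]
      exact mul_pos (by norm_num) (Finset.prod_pos fun i _ => by
        exact_mod_cast localCount_pos (hodd i) β)
    exact_mod_cast this.ne'
  obtain ⟨S1, hS1, hS1'⟩ := sum_residueSymbol_pow hinj hodd hβ hφ he0 one_ne_zero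
  obtain ⟨S2, hS2, hS2'⟩ := sum_residueSymbol_pow hinj hodd hβ hφ he0 two_ne_zero
  obtain ⟨S3, hS3, hS3'⟩ := sum_residueSymbol_pow hinj hodd hβ hφ he0 three_ne_zero
  rw [← hA] at hS1 hS1' hS2 hS2' hS3 hS3'
  have hS4 : ∑ k ∈ A, residueSymbol φ e k ^ 4 = A.card := by
    rw [Finset.sum_congr rfl fun k hk => residueSymbol_pow_four hβ hφ e hk, Finset.sum_const,
      nsmul_one]
  have m1 : meanSymbol q β (fun i => 4 ∣ 1 * e i) = meanSymbol q β (fun _ => False) := by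
    unfold meanSymbol
    refine Finset.prod_congr rfl fun i _ => if_congr (or_congr_left ?_) rfl rfl
    have := he i
    rw [iff_false]
    omega
  have m3 : meanSymbol q β (fun i => 4 ∣ 3 * e i) = meanSymbol q β (fun _ => False) := by
    unfold meanSymbol
    refine Finset.prod_congr rfl fun i _ => if_congr (or_congr_left ?_) rfl rfl
    have := he i
    rw [iff_false]
    omega
  have m2 : meanSymbol q β (fun i => 4 ∣ 2 * e i) = meanSymbol q β (fun i => e i % 4 = 2) := by
    unfold meanSymbol
    refine Finset.prod_congr rfl fun i _ => if_congr (or_congr_left ?_) rfl rfl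
    have := he i
    beta_reduce
    omega
  rw [m1] at hS1'
  rw [m2] at hS2'
  rw [m3] at hS3'
  have hS13 : S3 = S1 := by
    have : (S3 : ℝ) = S1 := hS3'.trans hS1'.symm
    exact_mod_cast this
  have hI := gaussI_sq
  have hκ' : (κ : GaussianInt) ^ 2 = 1 := by exact_mod_cast congrArg (Int.cast : ℤ → GaussianInt) hκ
  have key : ∀ c : GaussianInt, c ^ 4 = 1 →
      4 * ((A.filter fun k => c * residueSymbol φ e k = gaussI).card : GaussianInt) =
        A.card - gaussI * c * S1 - c ^ 2 * S2 + gaussI * c ^ 3 * S1 := by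
    intro c hc
    rw [← Finset.sum_boole, Finset.mul_sum,
      Finset.sum_congr rfl fun k hk => four_mul_ite_eq_gaussI (w := c * residueSymbol φ e k)
        (by rw [mul_pow, hc, one_mul, residueSymbol_pow_four hβ hφ e hk])]
    simp only [mul_pow, ← mul_assoc]
    rw [Finset.sum_add_distrib, Finset.sum_sub_distrib, Finset.sum_sub_distrib, ← Finset.mul_sum,
      ← Finset.mul_sum, ← Finset.mul_sum, ← Finset.mul_sum, hS4, hS2, hS3, hS13, hc, one_mul]
    simp only [pow_one] at hS1
    rw [hS1]
  constructor
  · have h := key (κ * gaussI) (by linear_combination κ ^ 4 * gaussI_pow_four + (κ ^ 2 + 1) * hκ')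
    have h' : 4 * ((A.filter fun k => κ * gaussI * residueSymbol φ e k = gaussI).card : GaussianInt) =
        ((A.card + 2 * κ * S1 + S2 : ℤ) : GaussianInt) := by
      rw [h]
      push_cast
      linear_combination (-κ * S1 - κ ^ 2 * S2 + κ ^ 3 * S1 * (gaussI ^ 2 - 1)) * hI +
        (S2 + κ * S1) * hκ'
    have h'' : (4 * ((A.filter fun k => κ * gaussI * residueSymbol φ e k = gaussI).card : ℤ)) =
        A.card + 2 * κ * S1 + S2 := by exact_mod_cast h'
    have h3 : (4 * ((A.filter fun k => κ * gaussI * residueSymbol φ e k = gaussI).card : ℝ)) =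
        A.card + 2 * κ * S1 + S2 := by exact_mod_cast congrArg (Int.cast : ℤ → ℝ) h''
    rw [div_eq_iff hAcard]
    rw [hS1', hS2'] at h3
    linear_combination (1 / 4) * h3
  · have h := key κ (by linear_combination (κ ^ 2 + 1) * hκ')
    have h' : 4 * ((A.filter fun k => κ * residueSymbol φ e k = gaussI).card : GaussianInt) =
        ((A.card - S2 : ℤ) : GaussianInt) := by
      rw [h]
      push_cast
      linear_combination (-S2 + gaussI * κ * S1) * hκ'
    have h'' : (4 * ((A.filter fun k => κ * residueSymbol φ e k = gaussI).card : ℤ)) =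
        A.card - S2 := by exact_mod_cast h'
    have h3 : (4 * ((A.filter fun k => κ * residueSymbol φ e k = gaussI).card : ℝ)) =
        A.card - S2 := by exact_mod_cast congrArg (Int.cast : ℤ → ℝ) h''
    rw [div_eq_iff hAcard]
    rw [hS2'] at h3
    linear_combination (1 / 4) * h3

end Densities

/-! ### Densities in terms of the residue symbol -/

section TraceDensity

variable {ι : Type*} [Fintype ι] {q : ι → ℕ} [∀ i, Fact (q i).Prime]

lemma quadPrimes_neg (r : ℤ) (N : ℕ) : quadPrimes (-r) N = quadPrimes r N := by
  simp [quadPrimes]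

/-- If the quartic residue symbol of `D` modulo `p = X² + β²` is `c ∏ φᵢ(X)^(eᵢ)`, then the trace
densities of `E_D` are the proportions of the residues where this product is `± i`. -/
lemma HardyLittlewoodConjecture.hasTraceDensity (hHL : HardyLittlewoodConjecture)
    {β : ℤ} (hβ : 2 ∣ β) (hβ0 : β ≠ 0)
    (hA : (admissibleResidues (4 * ∏ i, q i) β).Nonempty)
    {φ : ∀ i, ZMod (q i) → GaussianInt} {e : ι → ℕ} {D : ℤ} (hD : D ≠ 0) {c : GaussianInt}
    (hc : ∀ (p : ℕ) [Fact p.Prime] (j : ZMod p) (χ : MulChar (ZMod p) GaussianInt) (X : ℤ),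
      IsQuarticChar j χ → (∃ g, χ g = gaussI) → j ^ 2 = -1 → (p : ℤ) = X ^ 2 + β ^ 2 →
      X % 4 = 1 → j * X = β → (∀ i, q i ≠ p) →
      χ (D : ZMod p) = c * ∏ i, φ i (X : ZMod (q i)) ^ e i) :
    HasTraceDensity D β
      ((((admissibleResidues (4 * ∏ i, q i) β).filter
        fun k => c * residueSymbol φ e k = gaussI).card : ℝ) /
          (admissibleResidues (4 * ∏ i, q i) β).card) ∧
    HasTraceDensity D (-β)
      ((((admissibleResidues (4 * ∏ i, q i) β).filter
        fun k => -c * residueSymbol φ e k = gaussI).card : ℝ) /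
          (admissibleResidues (4 * ∏ i, q i) β).card) := by
  classical
  have hm : 0 < 4 * ∏ i, q i := Nat.mul_pos (by norm_num)
    (Finset.prod_pos fun i _ => (Fact.out : (q i).Prime).pos)
  have hm2 : 2 ∣ 4 * ∏ i, q i := Dvd.dvd.mul_right (by norm_num) _
  have hΔ : (curveE D).Δ ≠ 0 := by
    have : (curveE D).Δ = -64 * D ^ 3 := by
      simp [curveE, WeierstrassCurve.Δ, WeierstrassCurve.b₂, WeierstrassCurve.b₄,
        WeierstrassCurve.b₆, WeierstrassCurve.b₈]
      ring
    rw [this]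
    exact mul_ne_zero (by norm_num) (pow_ne_zero _ hD)
  set B : Set ℕ := {p | (p : ℤ) ∣ (curveE D).Δ} ∪ Set.range q with hB
  have hBfin : B.Finite := by
    refine Set.Finite.union ?_ (Set.finite_range q)
    refine (Set.finite_Iic (curveE D).Δ.natAbs).subset fun p hp => ?_
    exact Nat.le_of_dvd (Int.natAbs_pos.2 hΔ) (Int.natCast_dvd.1 hp)
  have key : ∀ p : ℕ, p.Prime → p ∉ B → ∀ x : ℕ, (p : ℤ) = (x : ℤ) ^ 2 + β ^ 2 →
      x % (4 * ∏ i, q i) ∈ admissibleResidues (4 * ∏ i, q i) β →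
      (traceFrob D p = 2 * β ↔ c * residueSymbol φ e (x % (4 * ∏ i, q i)) = gaussI) ∧
      (traceFrob D p = 2 * -β ↔ -c * residueSymbol φ e (x % (4 * ∏ i, q i)) = gaussI) := by
    intro p hp hpB x hpx hxA
    have : Fact p.Prime := ⟨hp⟩
    rw [hB, Set.mem_union, not_or] at hpB
    have hx4 : (x % (4 * ∏ i, q i)) % 4 = x % 4 := Nat.mod_mod_of_dvd _ (dvd_mul_right _ _)
    have hkodd := (Finset.mem_filter.1 ((mem_admissibleResidues_iff q hβ _).1 hxA).1).2
    rw [Nat.odd_iff] at hkodd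
    set X := signedResidue x with hXdef
    have hX : X % 4 = 1 := by
      rw [hXdef, signedResidue]; split_ifs <;> omega
    have hpX : (p : ℤ) = X ^ 2 + β ^ 2 := by
      rw [hpx, hXdef, signedResidue]; split_ifs <;> ring
    have hXr : ∀ i, ((signedResidue (x % (4 * ∏ i, q i)) : ℤ) : ZMod (q i)) = (X : ZMod (q i)) := by
      intro i
      have hd : q i ∣ 4 * ∏ i, q i :=
        Dvd.dvd.mul_left (Finset.dvd_prod_of_mem q (Finset.mem_univ i)) 4
      have h1 : ((x % (4 * ∏ i, q i) : ℕ) : ZMod (q i)) = (x : ZMod (q i)) := by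
        rw [ZMod.natCast_eq_natCast_iff', Nat.mod_mod_of_dvd _ hd]
      rw [hXdef, signedResidue, signedResidue, hx4]
      split_ifs
      · rw [Int.cast_natCast, h1, Int.cast_natCast]
      · rw [Int.cast_neg, Int.cast_natCast, h1, Int.cast_neg, Int.cast_natCast]
    have hX0 : (X : ZMod p) ≠ 0 := by
      rw [Ne, ZMod.intCast_zmod_eq_zero_iff_dvd]
      intro h
      have h2 : (p : ℤ) ∣ β ^ 2 := by
        have : β ^ 2 = p - X ^ 2 := by linarith
        rw [this]
        exact dvd_sub dvd_rfl (h.trans (dvd_pow_self X two_ne_zero))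
      have hpp := Nat.prime_iff_prime_int.1 hp
      exact hpp.not_isUnit ((isCoprime_of_prime_eq_sq_add_sq hpX).isUnit_of_dvd' h
        (hpp.dvd_of_dvd_pow h2))
    set j : ZMod p := β / X with hj
    have hjX : j * X = β := div_mul_cancel₀ _ hX0
    have hj2 : j ^ 2 = -1 := by
      have h0 : (X : ZMod p) ^ 2 + (β : ZMod p) ^ 2 = 0 := by
        have := congrArg (Int.cast : ℤ → ZMod p) hpX
        push_cast at this
        rw [← this]; simp
      rw [hj, div_pow, div_eq_iff (pow_ne_zero _ hX0)]
      linear_combination h0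
    have hp4 : 4 ∣ Fintype.card (ZMod p) - 1 := by
      rw [ZMod.card]
      obtain ⟨w, rfl⟩ := hβ
      obtain ⟨y, hy⟩ : ∃ y, X = 4 * y + 1 := ⟨X / 4, by omega⟩
      have hp8 : (p : ℤ) = 8 * (2 * y ^ 2 + y) + 1 + 4 * w ^ 2 := by rw [hpX, hy]; ring
      omega
    obtain ⟨χ, hχ, hg⟩ := exists_isQuarticChar hp4 hj2
    have hval := hc p j χ X hχ hg hj2 hpX hX hjX (fun i h => hpB.2 ⟨i, h⟩)
    have hval' : χ (D : ZMod p) = c * residueSymbol φ e (x % (4 * ∏ i, q i)) := by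
      rw [hval, residueSymbol]
      simp only [hXr]
    obtain ⟨h1, h2⟩ := hχ.traceFrob_eq_iff hg hj2 hpX hX hβ hβ0 hjX hpB.1
    rw [hval'] at h1 h2
    exact ⟨h1, h2.trans (by rw [neg_mul, neg_eq_iff_eq_neg])⟩
  constructor
  · refine hHL.tendsto_ratio hm hm2 hβ0 hA (Finset.filter_subset _ _) hBfin ?_
    intro p hp hpB x hpx hxA
    rw [Finset.mem_filter, and_iff_right hxA, ← (key p hp hpB x hpx hxA).1]
    exact and_iff_right fun h => hpB (Or.inl h)
  · unfold HasTraceDensity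
    simp only [quadPrimes_neg]
    refine hHL.tendsto_ratio hm hm2 hβ0 hA (Finset.filter_subset _ _) hBfin ?_
    intro p hp hpB x hpx hxA
    rw [Finset.mem_filter, and_iff_right hxA, ← (key p hp hpB x hpx hxA).2]
    exact and_iff_right fun h => hpB (Or.inl h)

lemma IsQuarticChar.apply_neg_one_eq {p : ℕ} [Fact p.Prime] {j : ZMod p}
    {χ : MulChar (ZMod p) GaussianInt} (hχ : IsQuarticChar j χ) (hj : j ^ 2 = -1) {X β : ℤ}
    (hpX : (p : ℤ) = X ^ 2 + β ^ 2) (hX : X % 4 = 1) :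
    (β % 8 = 2 → χ (-1) = -1) ∧ (4 ∣ β → χ (-1) = 1) := by
  obtain ⟨y, rfl⟩ : ∃ y, X = 4 * y + 1 := ⟨X / 4, by omega⟩
  constructor
  · intro hβ
    obtain ⟨w, rfl⟩ : ∃ w, β = 8 * w + 2 := ⟨β / 8, by omega⟩
    have hp8 : (p : ℤ) = 8 * (2 * y ^ 2 + y + 8 * w ^ 2 + 4 * w) + 5 := by rw [hpX]; ring
    rw [hχ.apply_neg_one hj (by omega), Odd.neg_one_pow (Nat.odd_iff.2 (by omega))]
  · rintro ⟨w, rfl⟩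
    have hp8 : (p : ℤ) = 8 * (2 * y ^ 2 + y + 2 * w ^ 2) + 1 := by rw [hpX]; ring
    rw [hχ.apply_neg_one hj (by omega), Even.neg_one_pow (Nat.even_iff.2 (by omega))]

/-- The densities for `D = ε 2^σ ∏ qᵢ^(eᵢ)`. For `β ≡ 2 (mod 8)` the symbol of `ε 2^σ` is `± i`, and
passing from `qᵢ* = ± qᵢ` to `qᵢ` costs a sign at the `qᵢ ≡ 3 (mod 4)`; for `4 ∣ β` the symbol of
`ε 2^σ` is `± 1`, which makes the contributions of the odd powers cancel. -/
lemma HardyLittlewoodConjecture.hasTraceDensity_prod (hHL : HardyLittlewoodConjecture)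
    (hinj : Function.Injective q) (hodd : ∀ i, q i ≠ 2) {β : ℤ} (hβ0 : β ≠ 0)
    {e : ι → ℕ} (he : ∀ i, ¬ 4 ∣ e i) {ε : ℤ} (hε : ε = 1 ∨ ε = -1) {σ : ℕ} (hσ : σ = 1 ∨ σ = 3)
    {D : ℤ} (hD : D = ε * 2 ^ σ * ∏ i, (q i : ℤ) ^ e i) :
    (β % 8 = 2 → ∀ κ : ℤ, κ = ε * (if σ = 1 then 1 else -1) *
        ∏ i, (if q i % 4 = 3 then -1 else 1) ^ e i →
      HasTraceDensity D β (1 / 4 * (1 + meanSymbol q β (fun i => e i % 4 = 2) +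
        κ * (2 * meanSymbol q β (fun _ => False)))) ∧
      HasTraceDensity D (-β) (1 / 4 * (1 + meanSymbol q β (fun i => e i % 4 = 2) -
        κ * (2 * meanSymbol q β (fun _ => False))))) ∧
    (4 ∣ β →
      HasTraceDensity D β (1 / 4 * (1 - meanSymbol q β (fun i => e i % 4 = 2))) ∧
      HasTraceDensity D (-β) (1 / 4 * (1 - meanSymbol q β (fun i => e i % 4 = 2)))) := by
  have hε0 : ε ≠ 0 := by rcases hε with rfl | rfl <;> norm_num
  have hD0 : D ≠ 0 := by
    rw [hD]
    refine mul_ne_zero (mul_ne_zero hε0 (by positivity)) (Finset.prod_ne_zero_iff.2 fun i _ => ?_)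
    exact pow_ne_zero _ (by exact_mod_cast (Fact.out : (q i).Prime).ne_zero)
  have hA : 2 ∣ β → (admissibleResidues (4 * ∏ i, q i) β).Nonempty := by
    intro hβ
    choose φ hφ using fun i => exists_isLocalSymbol (q i) (hodd i) β hβ
    rw [← Finset.card_pos]
    have h := card_admissibleResidues hinj hodd hβ hφ
    have : 0 < ((admissibleResidues (4 * ∏ i, q i) β).card : ℤ) := by
      rw [h]
      exact mul_pos (by norm_num) (Finset.prod_pos fun i _ => by
        exact_mod_cast localCount_pos (hodd i) β)
    exact_mod_cast this
  -- the symbol of `D` in terms of the symbols of `-1`, `2` and of the primes `qᵢ* = ± qᵢ`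
  have hχD : ∀ (p : ℕ) [Fact p.Prime] (χ : MulChar (ZMod p) GaussianInt),
      χ (D : ZMod p) = χ (ε : ZMod p) * χ 2 ^ σ * ∏ i, χ (q i : ZMod p) ^ e i := by
    intro p _ χ
    rw [hD]
    push_cast
    rw [map_mul, map_mul, map_pow, map_prod]
    simp only [map_pow]
  constructor
  · intro hβ8 κ hκ
    have hβ : 2 ∣ β := by omega
    choose φ hφ using fun i => exists_isLocalSymbol (q i) (hodd i) β hβ
    have hκ2 : κ ^ 2 = 1 := by
      rw [hκ, mul_pow, mul_pow, ← Finset.prod_pow, Finset.prod_eq_one, mul_one]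
      · rcases hε with rfl | rfl <;> split_ifs <;> norm_num
      · intro i _
        rw [← pow_mul, mul_comm, pow_mul]
        split_ifs <;> norm_num
    have hdens := hHL.hasTraceDensity hβ hβ0 (hA hβ) (φ := φ) (e := e) (D := D)
      hD0 (c := κ * gaussI) (by
        intro p _ j χ X hχ hg hj hpX hX hjX hqp
        have h2 := (hχ.apply_two hj hpX hX hjX).1 hβ8
        have hn := (hχ.apply_neg_one_eq hj hpX hX).1 hβ8
        have hq : ∀ i, χ (q i : ZMod p) = (if q i % 4 = 3 then -1 else 1) * φ i (X : ZMod (q i)) := by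
          intro i
          rw [← (hφ i).reciprocity p j χ X hχ hg hj hpX hX hjX (hqp i)]
          split_ifs
          · rw [← hn, ← map_mul]; congr 1; ring
          · rw [one_mul]
        have hεχ : χ (ε : ZMod p) = ε := by
          rcases hε with rfl | rfl
          · simp
          · simpa using hn
        have hσχ : χ 2 ^ σ = (if σ = 1 then 1 else -1) * gaussI := by
          rw [h2]
          rcases hσ with rfl | rfl <;> decide
        rw [hχD, hεχ, hσχ, hκ]
        simp only [hq, mul_pow]
        rw [Finset.prod_mul_distrib]
        push_cast
        split_ifs <;> ring)
    constructor
    · rw [← (card_filter_residueSymbol hinj hodd hβ hφ he hκ2).1]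
      exact hdens.1
    · have := (card_filter_residueSymbol hinj hodd hβ hφ he (κ := -κ) (by rw [neg_sq, hκ2])).1
      rw [sub_eq_add_neg, ← neg_mul]
      have hcast : ((-κ : ℤ) : ℝ) = -(κ : ℝ) := by push_cast; rfl
      rw [← hcast, ← this]
      have hcast' : ((-κ : ℤ) : GaussianInt) * gaussI = -(κ * gaussI) := by push_cast; ring
      simp only [hcast']
      exact hdens.2
  · intro hβ4
    have hβ : 2 ∣ β := by omega
    choose φ hφ using fun i => exists_isLocalSymbol (q i) (hodd i) β hβ
    -- `κ` is the value of `χ` at `2`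
    set κ : ℤ := if 8 ∣ β then 1 else -1 with hκ
    have hκ2 : κ ^ 2 = 1 := by rw [hκ]; split_ifs <;> norm_num
    have hdens := hHL.hasTraceDensity hβ hβ0 (hA hβ) (φ := φ) (e := e) (D := D)
      hD0 (c := (κ : GaussianInt)) (by
        intro p _ j χ X hχ hg hj hpX hX hjX hqp
        have h2 := (hχ.apply_two hj hpX hX hjX).2 hβ4
        have hn := (hχ.apply_neg_one_eq hj hpX hX).2 hβ4
        have hq : ∀ i, χ (q i : ZMod p) = φ i (X : ZMod (q i)) := by
          intro i
          rw [← (hφ i).reciprocity p j χ X hχ hg hj hpX hX hjX (hqp i)]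
          split_ifs
          · rw [← one_mul (χ (q i : ZMod p)), ← hn, ← map_mul]; congr 1; ring
          · rfl
        have hεχ : χ (ε : ZMod p) = 1 := by
          rcases hε with rfl | rfl
          · simp
          · simpa using hn
        have hσχ : χ 2 ^ σ = (κ : GaussianInt) := by
          rw [h2, hκ]
          rcases hσ with rfl | rfl <;> split_ifs <;> norm_num
        rw [hχD, hεχ, hσχ, one_mul]
        simp only [hq])
    constructor
    · rw [← (card_filter_residueSymbol hinj hodd hβ hφ he hκ2).2]
      exact hdens.1
    · have := (card_filter_residueSymbol hinj hodd hβ hφ he (κ := -κ) (by rw [neg_sq, hκ2])).2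
      rw [← this]
      have hcast' : ((-κ : ℤ) : GaussianInt) = -(κ : GaussianInt) := by push_cast; ring
      simp only [hcast']
      exact hdens.2

end TraceDensity

/-! ### The arithmetic quantities in the formulas -/

/-- The value `τ(l)` at a prime `l`. -/
def tauPrime (l : ℕ) : ℕ := if l % 4 = 1 then l - 2 else l

/-- The mean of the local symbol at the odd prime `l`, over the residues `X` with
`l ∤ X² + β²`. -/
noncomputable def primeMean (β : ℤ) (l : ℕ) : ℝ :=
  if (l : ℤ) ∣ β then 1 else -1 / (tauPrime l : ℝ)

/-- The sign `(-1 / l)` at an odd prime `l`. -/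
def primeSign (l : ℕ) : ℤ := if l % 4 = 3 then -1 else 1

lemma tauFun_eq_prod_of_squarefree {n : ℕ} (hn : Squarefree n) :
    tauFun n = ∏ l ∈ n.primeFactors, tauPrime l := by
  refine Finset.prod_congr rfl fun l hl => ?_
  have hlp := Nat.prime_of_mem_primeFactors hl
  have h1 : n.factorization l = 1 := by
    refine le_antisymm (hn.natFactorization_le_one l) ?_
    exact (hlp.dvd_iff_one_le_factorization hn.ne_zero).1 (Nat.dvd_of_mem_primeFactors hl)
  rw [h1, Nat.sub_self, pow_zero, one_mul, tauPrime]

lemma primeFactors_prod_filter (n : ℕ) (s : ℕ → Prop) [DecidablePred s] :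
    (∏ l ∈ n.primeFactors.filter s, l).primeFactors = n.primeFactors.filter s :=
  Nat.primeFactors_prod fun _ hl => Nat.prime_of_mem_primeFactors (Finset.mem_filter.1 hl).1

lemma primeFactors_partCoprime (β : ℤ) (n : ℕ) :
    (partCoprime β n).primeFactors = n.primeFactors.filter (fun l : ℕ => ¬ (l : ℤ) ∣ β) :=
  primeFactors_prod_filter n _

lemma partDividing_mul_partCoprime (β : ℤ) {n : ℕ} (hn : Squarefree n) :
    partDividing β n * partCoprime β n = n := by
  rw [partDividing, partCoprime, Finset.prod_filter_mul_prod_filter_not,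
    Nat.prod_primeFactors_of_squarefree hn]

lemma partCoprime_dvd (β : ℤ) {n : ℕ} (hn : Squarefree n) : partCoprime β n ∣ n :=
  Dvd.intro_left _ (partDividing_mul_partCoprime β hn)

/-- `P`, `Q`, `L` are squarefree and pairwise coprime. -/
structure SquarefreeTriple (P Q L : ℕ) : Prop where
  sqP : Squarefree P
  sqQ : Squarefree Q
  sqL : Squarefree L
  copPQ : Nat.Coprime P Q
  copPL : Nat.Coprime P L
  copQL : Nat.Coprime Q L

lemma SquarefreeTriple.of_squarefree {P Q L : ℕ} (h : Squarefree (P * Q * L)) :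
    SquarefreeTriple P Q L := by
  obtain ⟨h1, h2, h3⟩ := Nat.squarefree_mul_iff.1 h
  obtain ⟨h4, h5, h6⟩ := Nat.squarefree_mul_iff.1 h2
  exact ⟨h5, h6, h3, h4, h1.coprime_mul_right, h1.coprime_mul_left⟩

lemma SquarefreeTriple.partCoprime {P Q L : ℕ} (h : SquarefreeTriple P Q L) (β : ℤ) :
    SquarefreeTriple (partCoprime β P) (partCoprime β Q) (partCoprime β L) :=
  have dP := partCoprime_dvd β h.sqP
  have dQ := partCoprime_dvd β h.sqQ
  have dL := partCoprime_dvd β h.sqL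
  ⟨h.sqP.squarefree_of_dvd dP, h.sqQ.squarefree_of_dvd dQ, h.sqL.squarefree_of_dvd dL,
    h.copPQ.of_dvd dP dQ, h.copPL.of_dvd dP dL, h.copQL.of_dvd dQ dL⟩

lemma SquarefreeTriple.prod_primeFactors {P Q L : ℕ} (h : SquarefreeTriple P Q L) {R : Type*}
    [CommMonoid R] (f : ℕ → R) :
    ∏ l ∈ (P * Q * L).primeFactors, f l =
      (∏ l ∈ P.primeFactors, f l) * (∏ l ∈ Q.primeFactors, f l) * ∏ l ∈ L.primeFactors, f l := by
  rw [(Nat.Coprime.mul_left h.copPL h.copQL).primeFactors_mul,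
    Finset.prod_union (Nat.Coprime.mul_left h.copPL h.copQL).disjoint_primeFactors,
    h.copPQ.primeFactors_mul, Finset.prod_union h.copPQ.disjoint_primeFactors]

lemma neg_one_pow_numPrimes (n : ℕ) : (-1 : ℝ) ^ numPrimes n = ∏ _l ∈ n.primeFactors, (-1 : ℝ) := by
  rw [Finset.prod_const, numPrimes]

lemma prod_primeMean (β : ℤ) (n : ℕ) :
    ∏ l ∈ n.primeFactors, primeMean β l =
      (-1 : ℝ) ^ numPrimes (partCoprime β n) /
        ((∏ l ∈ (partCoprime β n).primeFactors, tauPrime l : ℕ) : ℝ) := by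
  rw [neg_one_pow_numPrimes, primeFactors_partCoprime, Nat.cast_prod, ← Finset.prod_div_distrib,
    Finset.prod_filter]
  refine Finset.prod_congr rfl fun l _ => ?_
  rw [primeMean, ite_not]

lemma SquarefreeTriple.quadTerm_eq {P Q L : ℕ} (h : SquarefreeTriple P Q L) (β : ℤ) :
    quadTerm (_root_.partCoprime β P) (_root_.partCoprime β L) =
      (∏ l ∈ P.primeFactors, primeMean β l) * ∏ l ∈ L.primeFactors, primeMean β l := by
  have h' := h.partCoprime β
  rw [quadTerm, tauFun_eq_prod_of_squarefree
    ((Nat.squarefree_mul h'.copPL).2 ⟨h'.sqP, h'.sqL⟩), h'.copPL.primeFactors_mul,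
    Finset.prod_union h'.copPL.disjoint_primeFactors, prod_primeMean, prod_primeMean, pow_add,
    Nat.cast_mul, div_mul_div_comm]

lemma neg_one_pow_half_eq_χ₄ {d : ℕ} (hd : Odd d) : (-1 : ℤ) ^ ((d - 1) / 2) = ZMod.χ₄ d := by
  rw [ZMod.χ₄_eq_neg_one_pow (Nat.odd_iff.1 hd)]
  congr 1
  have := Nat.odd_iff.1 hd
  omega

lemma χ₄_natCast_eq_primeSign {l : ℕ} (hl : Odd l) : ZMod.χ₄ (l : ZMod 4) = primeSign l := by
  rw [ZMod.χ₄_nat_eq_if_mod_four, primeSign]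
  have := Nat.odd_iff.1 hl
  split_ifs <;> first | rfl | omega

lemma χ₄_partDividing (β : ℤ) {n : ℕ} (hn : Odd n) :
    ZMod.χ₄ (partDividing β n : ZMod 4) =
      ∏ l ∈ n.primeFactors.filter (fun l : ℕ => (l : ℤ) ∣ β), primeSign l := by
  rw [partDividing, Nat.cast_prod, map_prod]
  refine Finset.prod_congr rfl fun l hl => χ₄_natCast_eq_primeSign ?_
  exact hn.of_dvd_nat (Nat.dvd_of_mem_primeFactors (Finset.mem_filter.1 hl).1)

lemma odd_partDividing (β : ℤ) {n : ℕ} (hn : Odd n) (hsf : Squarefree n) :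
    Odd (partDividing β n) :=
  hn.of_dvd_nat (Dvd.intro _ (partDividing_mul_partCoprime β hsf))

/-- The sign `(-1)^((d-1)/2)` is the product of the signs `(-1 / l)` of the primes dividing `P L` and
`β`. -/
lemma neg_one_pow_dPart (β : ℤ) {P Q L : ℕ} (h : SquarefreeTriple P Q L) (hP : Odd P) (hQ : Odd Q)
    (hL : Odd L) :
    (-1 : ℤ) ^ ((dPart β P Q L - 1) / 2) =
      (∏ l ∈ P.primeFactors.filter (fun l : ℕ => (l : ℤ) ∣ β), primeSign l) *
        ∏ l ∈ L.primeFactors.filter (fun l : ℕ => (l : ℤ) ∣ β), primeSign l := by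
  have oP := odd_partDividing β hP h.sqP
  have oQ := odd_partDividing β hQ h.sqQ
  have oL := odd_partDividing β hL h.sqL
  have hsq : ∀ {n : ℕ}, Odd n → ZMod.χ₄ (n : ZMod 4) ^ 2 = 1 := by
    intro n hn
    rw [χ₄_natCast_eq_primeSign hn, primeSign]
    split_ifs <;> norm_num
  have hodd : Odd (dPart β P Q L) := (oP.mul oQ.pow).mul oL.pow
  rw [neg_one_pow_half_eq_χ₄ hodd, dPart, Nat.cast_mul, Nat.cast_mul, map_mul, map_mul,
    Nat.cast_pow, Nat.cast_pow, map_pow, map_pow, hsq oQ, mul_one, pow_succ, hsq oL, one_mul,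
    χ₄_partDividing β hP, χ₄_partDividing β hL]

/-- The sign of `-1 / τ(l)` against `(-1 / l)`, collected over the primes of `n`. -/
lemma prod_primeSign_mul_neg_one_pow (β : ℤ) {n : ℕ} (hn : Odd n) :
    ((∏ l ∈ n.primeFactors, primeSign l : ℤ) : ℝ) * (-1) ^ numPrimes (partCoprime β n) =
      (-1) ^ (numPrimesMod (partCoprime β n) 1 + numPrimesMod (partCoprime β n) 5) *
        ((∏ l ∈ n.primeFactors.filter (fun l : ℕ => (l : ℤ) ∣ β), primeSign l : ℤ) : ℝ) := by
  have h1 : (-1 : ℝ) ^ (numPrimesMod (partCoprime β n) 1 + numPrimesMod (partCoprime β n) 5) =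
      ∏ l ∈ n.primeFactors.filter (fun l : ℕ => ¬ (l : ℤ) ∣ β), (-(primeSign l : ℝ)) := by
    rw [pow_add, numPrimesMod, numPrimesMod, primeFactors_partCoprime, ← Finset.prod_const,
      ← Finset.prod_const, Finset.prod_filter, Finset.prod_filter (s := Finset.filter _ _),
      ← Finset.prod_mul_distrib]
    refine Finset.prod_congr rfl fun l hl => ?_
    have hl : Odd l := hn.of_dvd_nat (Nat.dvd_of_mem_primeFactors (Finset.mem_filter.1 hl).1)
    have hl := Nat.odd_iff.1 hl
    rw [primeSign]
    split_ifs <;> first | omega | norm_num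
  rw [h1, neg_one_pow_numPrimes, primeFactors_partCoprime,
    ← Finset.prod_filter_mul_prod_filter_not n.primeFactors (fun l : ℕ => (l : ℤ) ∣ β)]
  push_cast
  rw [mul_assoc, ← Finset.prod_mul_distrib, mul_comm]
  congr 1
  exact Finset.prod_congr rfl fun l _ => by ring

/-- The signs of the quartic term are those of the means `-1 / τ(l)` and of `(-1 / l)`, the latter for
all the primes of `P L`: the exponent `r₁ + r₅ + t₁ + t₅` counts the primes `l ≡ 1 (mod 4)` not
dividing `β`, and `(d - 1) / 2` takes care of the primes dividing `β`. -/
lemma SquarefreeTriple.quarticTerm_eq {P Q L : ℕ} (h : SquarefreeTriple P Q L) (hP : Odd P)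
    (hQ : Odd Q) (hL : Odd L) (β : ℤ) :
    quarticTerm (_root_.partCoprime β P) (_root_.partCoprime β Q) (_root_.partCoprime β L)
        ((dPart β P Q L - 1) / 2) =
      (((∏ l ∈ P.primeFactors, primeSign l) * ∏ l ∈ L.primeFactors, primeSign l : ℤ) : ℝ) *
        (2 * ∏ l ∈ (P * Q * L).primeFactors, primeMean β l) := by
  have h' := h.partCoprime β
  have hsq : Squarefree (_root_.partCoprime β P * _root_.partCoprime β Q *
      _root_.partCoprime β L) :=
    (Nat.squarefree_mul (Nat.Coprime.mul_left h'.copPL h'.copQL)).2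
      ⟨(Nat.squarefree_mul h'.copPQ).2 ⟨h'.sqP, h'.sqQ⟩, h'.sqL⟩
  rw [quarticTerm, tauFun_eq_prod_of_squarefree hsq, h'.prod_primeFactors, h.prod_primeFactors,
    prod_primeMean, prod_primeMean, prod_primeMean]
  have e1 := prod_primeSign_mul_neg_one_pow β hP
  have e2 := prod_primeSign_mul_neg_one_pow β hL
  have e3 : (-1 : ℝ) ^ ((dPart β P Q L - 1) / 2) =
      ((∏ l ∈ P.primeFactors.filter (fun l : ℕ => (l : ℤ) ∣ β), primeSign l : ℤ) : ℝ) *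
        ((∏ l ∈ L.primeFactors.filter (fun l : ℕ => (l : ℤ) ∣ β), primeSign l : ℤ) : ℝ) := by
    rw [← Int.cast_mul, ← neg_one_pow_dPart β h hP hQ hL]
    push_cast
    rfl
  have e4 : ∀ a b c d s m : ℕ, (-1 : ℝ) ^ (a + b + c + d + s + m) =
      (-1) ^ (a + b) * (-1) ^ (c + d) * (-1) ^ s * (-1) ^ m := by
    intro a b c d s m; rw [← pow_add, ← pow_add, ← pow_add]; congr 1; ring
  rw [e4, e3, Int.cast_mul, div_mul_div_comm, div_mul_div_comm, mul_div_assoc', mul_div_assoc',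
    Nat.cast_mul, Nat.cast_mul]
  congr 1
  linear_combination (-2 * (-1 : ℝ) ^ numPrimes (_root_.partCoprime β Q) *
    ((∏ l ∈ L.primeFactors, primeSign l : ℤ) : ℝ) *
      (-1) ^ numPrimes (_root_.partCoprime β L)) * e1 -
    (2 * (-1 : ℝ) ^ numPrimes (_root_.partCoprime β Q) *
      (-1) ^ (numPrimesMod (_root_.partCoprime β P) 1 + numPrimesMod (_root_.partCoprime β P) 5) *
        ((∏ l ∈ P.primeFactors.filter (fun l : ℕ => (l : ℤ) ∣ β), primeSign l : ℤ) : ℝ)) * e2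

/-! ### Densities for `D = ε 2^σ P Q² L³` -/

/-- The exponent of the prime `l` in `P Q² L³`, for `l ∣ P Q L` with `P Q L` squarefree. -/
def tripleExponent (P Q l : ℕ) : ℕ := if l ∣ P then 1 else if l ∣ Q then 2 else 3

lemma SquarefreeTriple.prod_tripleExponent {P Q L : ℕ} (h : SquarefreeTriple P Q L) {R : Type*}
    [CommMonoid R] (f : ℕ → ℕ → R) :
    ∏ l ∈ (P * Q * L).primeFactors, f l (tripleExponent P Q l) =
      (∏ l ∈ P.primeFactors, f l 1) * (∏ l ∈ Q.primeFactors, f l 2) *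
        ∏ l ∈ L.primeFactors, f l 3 := by
  have hne : ∀ {A B l : ℕ}, A.Coprime B → l ∈ B.primeFactors → ¬ l ∣ A := fun hAB hl hA =>
    (Nat.prime_of_mem_primeFactors hl).one_lt.ne'
      (Nat.eq_one_of_dvd_coprimes hAB hA (Nat.dvd_of_mem_primeFactors hl))
  rw [h.prod_primeFactors]
  congr 1
  · congr 1
    · refine Finset.prod_congr rfl fun l hl => ?_
      rw [tripleExponent, if_pos (Nat.dvd_of_mem_primeFactors hl)]
    · refine Finset.prod_congr rfl fun l hl => ?_
      rw [tripleExponent, if_neg (hne h.copPQ hl), if_pos (Nat.dvd_of_mem_primeFactors hl)]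
  · refine Finset.prod_congr rfl fun l hl => ?_
    rw [tripleExponent, if_neg (hne h.copPL hl), if_neg (hne h.copQL hl)]

lemma SquarefreeTriple.prod_pow_tripleExponent {P Q L : ℕ} (h : SquarefreeTriple P Q L) :
    ∏ l ∈ (P * Q * L).primeFactors, (l : ℤ) ^ tripleExponent P Q l =
      P * Q ^ 2 * L ^ 3 := by
  rw [h.prod_tripleExponent (fun l e => (l : ℤ) ^ e), Finset.prod_pow, Finset.prod_pow,
    Finset.prod_pow, pow_one, ← Nat.cast_prod, ← Nat.cast_prod, ← Nat.cast_prod,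
    Nat.prod_primeFactors_of_squarefree h.sqP, Nat.prod_primeFactors_of_squarefree h.sqQ,
    Nat.prod_primeFactors_of_squarefree h.sqL]

lemma SquarefreeTriple.prod_primeSign_pow {P Q L : ℕ} (h : SquarefreeTriple P Q L) :
    ∏ l ∈ (P * Q * L).primeFactors, primeSign l ^ tripleExponent P Q l =
      (∏ l ∈ P.primeFactors, primeSign l) * ∏ l ∈ L.primeFactors, primeSign l := by
  have hsq : ∀ l, primeSign l ^ 2 = 1 := fun l => by rw [primeSign]; split_ifs <;> norm_num
  rw [h.prod_tripleExponent (fun l e => primeSign l ^ e)]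
  simp [hsq, pow_succ' _ 2]

lemma SquarefreeTriple.prod_ite_primeMean {P Q L : ℕ} (h : SquarefreeTriple P Q L) (β : ℤ) :
    ∏ l ∈ (P * Q * L).primeFactors,
        (if tripleExponent P Q l % 4 = 2 then 1 else primeMean β l) =
      (∏ l ∈ P.primeFactors, primeMean β l) * ∏ l ∈ L.primeFactors, primeMean β l := by
  rw [h.prod_tripleExponent (fun l e => if e % 4 = 2 then 1 else primeMean β l)]
  simp

/-- The densities in terms of the parts of `P`, `Q`, `L` prime to `β`. -/
theorem HardyLittlewoodConjecture.hasTraceDensity_triple (hHL : HardyLittlewoodConjecture)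
    {β : ℤ} (hβ0 : β ≠ 0) {P Q L : ℕ} (hodd : Odd (P * Q * L)) (hsf : Squarefree (P * Q * L))
    {ε : ℤ} (hε : ε = 1 ∨ ε = -1) {σ : ℕ} (hσ : σ = 1 ∨ σ = 3) {D : ℤ}
    (hD : D = ε * 2 ^ σ * P * Q ^ 2 * L ^ 3) :
    (β % 8 = 2 → ∀ s : ℤ, s = (if σ = 1 then 1 else -1) →
      HasTraceDensity D β (1 / 4 * (1 + quadTerm (partCoprime β P) (partCoprime β L) +
        s * (ε * quarticTerm (partCoprime β P) (partCoprime β Q) (partCoprime β L)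
          ((dPart β P Q L - 1) / 2)))) ∧
      HasTraceDensity D (-β) (1 / 4 * (1 + quadTerm (partCoprime β P) (partCoprime β L) -
        s * (ε * quarticTerm (partCoprime β P) (partCoprime β Q) (partCoprime β L)
          ((dPart β P Q L - 1) / 2))))) ∧
    (4 ∣ β →
      HasTraceDensity D β (1 / 4 * (1 - quadTerm (partCoprime β P) (partCoprime β L))) ∧
      HasTraceDensity D (-β) (1 / 4 * (1 - quadTerm (partCoprime β P) (partCoprime β L)))) := by
  have h := SquarefreeTriple.of_squarefree hsf
  have hPQ := (Nat.odd_mul.1 hodd).1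
  have hoP := (Nat.odd_mul.1 hPQ).1
  have hoQ := (Nat.odd_mul.1 hPQ).2
  have hoL := (Nat.odd_mul.1 hodd).2
  let q : (P * Q * L).primeFactors → ℕ := fun i => i
  have : ∀ i, Fact (q i).Prime := fun i => ⟨Nat.prime_of_mem_primeFactors i.2⟩
  have hq2 : ∀ i, q i ≠ 2 := fun i hi => by
    have := hodd.of_dvd_nat (Nat.dvd_of_mem_primeFactors i.2)
    change Odd (q i) at this
    rw [hi] at this
    exact absurd this (by decide)
  let e : (P * Q * L).primeFactors → ℕ := fun i => tripleExponent P Q i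
  have he : ∀ i, ¬ 4 ∣ e i := fun i => by
    simp only [e, tripleExponent]
    split_ifs <;> decide
  have hprod : ∏ i, (q i : ℤ) ^ e i = P * Q ^ 2 * L ^ 3 := by
    rw [← h.prod_pow_tripleExponent]
    exact Finset.prod_coe_sort _ (fun l : ℕ => (l : ℤ) ^ tripleExponent P Q l)
  have hsign : ∏ i, (if q i % 4 = 3 then -1 else 1 : ℤ) ^ e i =
      (∏ l ∈ P.primeFactors, primeSign l) * ∏ l ∈ L.primeFactors, primeSign l := by
    rw [← h.prod_primeSign_pow]
    exact Finset.prod_coe_sort _ (fun l : ℕ => primeSign l ^ tripleExponent P Q l)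
  have hmean : ∀ i, (if (q i : ℤ) ∣ β then 1 else -1 / (localCount (q i) β : ℝ)) =
      primeMean β (q i) := by
    intro i
    rw [primeMean]
    split_ifs with hi
    · rfl
    · rw [localCount_eq (hq2 i) hi, tauPrime]
  have hm1 : meanSymbol q β (fun _ => False) = ∏ l ∈ (P * Q * L).primeFactors, primeMean β l := by
    refine Eq.trans (Finset.prod_congr rfl fun i _ => ?_)
      (Finset.prod_coe_sort _ (fun l : ℕ => primeMean β l))
    simp only [false_or]
    exact hmean i
  have hm2 : meanSymbol q β (fun i => e i % 4 = 2) =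
      quadTerm (partCoprime β P) (partCoprime β L) := by
    rw [h.quadTerm_eq, ← h.prod_ite_primeMean]
    refine Eq.trans (Finset.prod_congr rfl fun i _ => ?_) (Finset.prod_coe_sort _
      (fun l : ℕ => if tripleExponent P Q l % 4 = 2 then 1 else primeMean β l))
    change _ = if e i % 4 = 2 then 1 else primeMean β (q i)
    rw [← hmean i]
    split_ifs <;> first | rfl | tauto
  have main := hHL.hasTraceDensity_prod (q := q) Subtype.val_injective hq2 hβ0 he hε hσ (D := D)
    (by rw [hD, hprod]; ring)
  rw [hm1, hm2] at main
  refine ⟨fun hβ s hs => ?_, main.2⟩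
  have key : ((ε * s * ((∏ l ∈ P.primeFactors, primeSign l) *
      ∏ l ∈ L.primeFactors, primeSign l) : ℤ) : ℝ) *
        (2 * ∏ l ∈ (P * Q * L).primeFactors, primeMean β l) =
      s * (ε * quarticTerm (partCoprime β P) (partCoprime β Q) (partCoprime β L)
          ((dPart β P Q L - 1) / 2)) := by
    rw [h.quarticTerm_eq hoP hoQ hoL]
    push_cast
    ring
  rw [← key]
  exact main.1 hβ _ (by rw [hs, hsign])

lemma partCoprime_eq_self {β : ℤ} {n : ℕ} (hn : Squarefree n) (h : partDividing β n = 1) :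
    partCoprime β n = n := by
  have := partDividing_mul_partCoprime β hn
  rwa [h, one_mul] at this

lemma SquarefreeTriple.dPart_mul {P Q L : ℕ} (h : SquarefreeTriple P Q L) (β : ℤ) :
    dPart β P Q L * (_root_.partCoprime β P * _root_.partCoprime β Q ^ 2 *
      _root_.partCoprime β L ^ 3) = P * Q ^ 2 * L ^ 3 := by
  conv_rhs => rw [← partDividing_mul_partCoprime β h.sqP, ← partDividing_mul_partCoprime β h.sqQ,
    ← partDividing_mul_partCoprime β h.sqL]
  rw [dPart]
  ring

lemma oddRad_eq {P Q L : ℕ} (hodd : Odd (P * Q * L)) {ε : ℤ} (hε : ε = 1 ∨ ε = -1) {σ : ℕ}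
    (hσ : σ ≠ 0) : oddRad (ε * 2 ^ σ * P * Q ^ 2 * L ^ 3) = ∏ l ∈ (P * Q * L).primeFactors, l := by
  have hε' : ε.natAbs = 1 := by rcases hε with rfl | rfl <;> rfl
  have h0 := hodd.pos.ne'
  have hP : P ≠ 0 := by rintro rfl; simp at h0
  have hQ : Q ≠ 0 := by rintro rfl; simp at h0
  have hL : L ≠ 0 := by rintro rfl; simp at h0
  rw [oddRad]
  congr 1
  simp only [Int.natAbs_mul, Int.natAbs_pow, Int.natAbs_natCast, hε', one_mul]
  change Finset.filter _ (2 ^ σ * P * Q ^ 2 * L ^ 3).primeFactors = _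
  rw [Nat.primeFactors_mul (by positivity) (by positivity),
    Nat.primeFactors_mul (by positivity) (by positivity), Nat.primeFactors_mul (by positivity) hP,
    Nat.primeFactors_pow _ hσ, Nat.primeFactors_pow _ two_ne_zero,
    Nat.primeFactors_pow _ three_ne_zero, Nat.primeFactors_mul (mul_ne_zero hP hQ) hL,
    Nat.primeFactors_mul hP hQ, Nat.prime_two.primeFactors]
  have h2 : ∀ {n : ℕ}, n ∣ P * Q * L → 2 ∉ n.primeFactors := fun hn h2 =>
    absurd (hodd.of_dvd_nat ((Nat.dvd_of_mem_primeFactors h2).trans hn)) (by decide)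
  have h2P := h2 (n := P) ⟨Q * L, by ring⟩
  have h2Q := h2 (n := Q) ⟨P * L, by ring⟩
  have h2L := h2 (n := L) ⟨P * Q, by ring⟩
  ext l
  simp only [Finset.mem_filter, Finset.mem_union, Finset.mem_singleton]
  constructor
  · tauto
  · intro hl
    refine ⟨by tauto, ?_⟩
    rintro rfl
    tauto

lemma partCoprime_eq_one_iff {β : ℤ} {n : ℕ} :
    partCoprime β n = 1 ↔ ∀ l ∈ n.primeFactors, (l : ℤ) ∣ β := by
  constructor
  · intro h l hl
    by_contra hlβ
    have : l ∈ (partCoprime β n).primeFactors := by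
      rw [primeFactors_partCoprime]
      exact Finset.mem_filter.2 ⟨hl, hlβ⟩
    rw [h] at this
    simp at this
  · intro h
    rw [partCoprime, Finset.filter_false_of_mem fun l hl => not_not.2 (h l hl),
      Finset.prod_empty]

lemma prod_primeFactors_dvd_iff {β : ℤ} {n : ℕ} :
    ((∏ l ∈ n.primeFactors, l : ℕ) : ℤ) ∣ β ↔ ∀ l ∈ n.primeFactors, (l : ℤ) ∣ β := by
  constructor
  · exact fun h l hl => (Int.natCast_dvd_natCast.2 (Finset.dvd_prod_of_mem _ hl)).trans h
  · intro h
    rw [Int.natCast_dvd]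
    exact Finset.prod_primes_dvd _ (fun l hl => (Nat.prime_of_mem_primeFactors hl).prime)
      fun l hl => Int.natCast_dvd.1 (h l hl)

/-- The cofactor of `d` is a signed power of `2` exactly when every odd prime of `D` divides `β`. -/
lemma SquarefreeTriple.cofactor_eq_iff {P Q L : ℕ} (h : SquarefreeTriple P Q L)
    (hodd : Odd (P * Q * L)) {β : ℤ} {ε : ℤ} (hε : ε = 1 ∨ ε = -1) {σ : ℕ} (hσ : σ ≠ 0)
    {D dbar : ℤ} (hD : D = ε * 2 ^ σ * P * Q ^ 2 * L ^ 3) (hd : D = dPart β P Q L * dbar) :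
    ((dbar = 2 ^ σ ∨ dbar = -2 ^ σ) ↔ (oddRad D : ℤ) ∣ β) ∧
    ((oddRad D : ℤ) ∣ β → _root_.partCoprime β P = 1 ∧ _root_.partCoprime β Q = 1 ∧
      _root_.partCoprime β L = 1) := by
  have h0 := h.dPart_mul β
  have hd0 : (dPart β P Q L : ℤ) ≠ 0 := by
    intro h1
    rw [Int.natCast_eq_zero.1 h1, zero_mul] at h0
    have hPQL : P * Q ^ 2 * L ^ 3 ≠ 0 :=
      mul_ne_zero (mul_ne_zero h.sqP.ne_zero (pow_ne_zero _ h.sqQ.ne_zero))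
        (pow_ne_zero _ h.sqL.ne_zero)
    exact hPQL h0.symm
  have hdbar : dbar = ε * 2 ^ σ * (_root_.partCoprime β P * _root_.partCoprime β Q ^ 2 *
      _root_.partCoprime β L ^ 3 : ℕ) := by
    refine mul_left_cancel₀ hd0 ?_
    rw [← hd, hD]
    have h0' := congrArg (Nat.cast : ℕ → ℤ) h0
    push_cast at h0' ⊢
    linear_combination -(ε * 2 ^ σ) * h0'
  have hall : (oddRad D : ℤ) ∣ β ↔ _root_.partCoprime β P = 1 ∧ _root_.partCoprime β Q = 1 ∧
      _root_.partCoprime β L = 1 := by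
    rw [hD, oddRad_eq hodd hε hσ, prod_primeFactors_dvd_iff,
      Nat.primeFactors_mul (mul_ne_zero h.sqP.ne_zero h.sqQ.ne_zero) h.sqL.ne_zero,
      Nat.primeFactors_mul h.sqP.ne_zero h.sqQ.ne_zero]
    simp only [partCoprime_eq_one_iff, Finset.mem_union]
    constructor
    · intro h; exact ⟨fun l hl => h l (by tauto), fun l hl => h l (by tauto),
        fun l hl => h l (by tauto)⟩
    · rintro ⟨h1, h2, h3⟩ l ((hl | hl) | hl)
      exacts [h1 l hl, h2 l hl, h3 l hl]
  refine ⟨?_, hall.1⟩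
  rw [hall]
  constructor
  · intro hpm
    have habs : dbar.natAbs = 2 ^ σ := by
      rcases hpm with h1 | h1 <;> rw [h1] <;> simp [Int.natAbs_pow]
    have hε' : ε.natAbs = 1 := by rcases hε with rfl | rfl <;> rfl
    rw [hdbar, Int.natAbs_mul, Int.natAbs_mul, Int.natAbs_natCast, Int.natAbs_pow, hε',
      one_mul] at habs
    have h1 := Nat.eq_of_mul_eq_mul_left (by positivity : 0 < 2 ^ σ)
      (habs.trans (mul_one _).symm)
    simpa [and_assoc] using h1
  · rintro ⟨h1, h2, h3⟩
    rw [hdbar, h1, h2, h3]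
    rcases hε with rfl | rfl
    · left; simp
    · right; simp

lemma quadTerm_one_one : quadTerm 1 1 = 1 := by simp [quadTerm, numPrimes, tauFun]

lemma quarticTerm_one (m : ℕ) : quarticTerm 1 1 1 m = 2 * (-1) ^ m := by
  simp [quarticTerm, numPrimes, numPrimesMod, tauFun]

lemma sign_mul_neg_one_pow_half {ε : ℤ} (hε : ε = 1 ∨ ε = -1) {d : ℕ} (hd : Odd d) :
    (ε : ℝ) * (-1) ^ ((d - 1) / 2) = (-1 : ℝ) ^ ((ε * d - 1) / 2) := by
  obtain ⟨k, rfl⟩ := hd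
  rw [show (2 * k + 1 - 1) / 2 = k by omega]
  rcases hε with rfl | rfl
  · rw [show (1 * ((2 * k + 1 : ℕ) : ℤ) - 1) / 2 = k by push_cast; omega, zpow_natCast]
    simp
  · rw [show (-1 * ((2 * k + 1 : ℕ) : ℤ) - 1) / 2 = -((k + 1 : ℕ) : ℤ) by push_cast; omega,
      zpow_neg, zpow_natCast, ← inv_pow, inv_neg_one, pow_succ]
    push_cast
    ring

/-- All the densities for `D = ε 2^σ P Q² L³`, with the sign `s` of the character of `2^σ`. -/
theorem HardyLittlewoodConjecture.traceDensities (hHL : HardyLittlewoodConjecture)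
    {β : ℤ} (hβ0 : β ≠ 0) {P Q L : ℕ} (hodd : Odd (P * Q * L)) (hsf : Squarefree (P * Q * L))
    {ε : ℤ} (hε : ε = 1 ∨ ε = -1) {σ : ℕ} (hσ : σ = 1 ∨ σ = 3) {s : ℤ}
    (hs : s = if σ = 1 then 1 else -1) {D dbar : ℤ} (hD : D = ε * 2 ^ σ * P * Q ^ 2 * L ^ 3)
    (hd : D = dPart β P Q L * dbar) :
    (β ≡ 2 [ZMOD 8] →
      (dPart β P Q L = 1 →
        HasTraceDensity D β (1 / 4 * (1 + quadTerm P L + s * (ε * quarticTerm P Q L 0))) ∧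
        HasTraceDensity D (-β) (1 / 4 * (1 + quadTerm P L - s * (ε * quarticTerm P Q L 0)))) ∧
      ((dbar = 2 ^ σ ∨ dbar = -2 ^ σ) ↔ (oddRad D : ℤ) ∣ β) ∧
      ((dbar = 2 ^ σ ∨ dbar = -2 ^ σ) →
        HasTraceDensity D β (1 / 2 * (1 + s * (-1 : ℝ) ^ ((D / 2 ^ σ - 1) / 2))) ∧
        HasTraceDensity D (-β) (1 / 2 * (1 - s * (-1 : ℝ) ^ ((D / 2 ^ σ - 1) / 2)))) ∧
      HasTraceDensity D β (1 / 4 * (1 + quadTerm (partCoprime β P) (partCoprime β L) +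
        s * (ε * quarticTerm (partCoprime β P) (partCoprime β Q) (partCoprime β L)
          ((dPart β P Q L - 1) / 2)))) ∧
      HasTraceDensity D (-β) (1 / 4 * (1 + quadTerm (partCoprime β P) (partCoprime β L) -
        s * (ε * quarticTerm (partCoprime β P) (partCoprime β Q) (partCoprime β L)
          ((dPart β P Q L - 1) / 2))))) ∧
    (4 ∣ β →
      (dPart β P Q L = 1 →
        HasTraceDensity D β (1 / 4 * (1 - quadTerm P L)) ∧
        HasTraceDensity D (-β) (1 / 4 * (1 - quadTerm P L))) ∧
      HasTraceDensity D β (1 / 4 * (1 - quadTerm (partCoprime β P) (partCoprime β L))) ∧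
      HasTraceDensity D (-β) (1 / 4 * (1 - quadTerm (partCoprime β P) (partCoprime β L)))) := by
  have h := SquarefreeTriple.of_squarefree hsf
  have hσ0 : σ ≠ 0 := by omega
  obtain ⟨hone, hfour⟩ := hHL.hasTraceDensity_triple hβ0 hodd hsf hε hσ hD
  obtain ⟨hiff, hrad⟩ := h.cofactor_eq_iff hodd hε hσ0 hD hd
  have hself : dPart β P Q L = 1 →
      partCoprime β P = P ∧ partCoprime β Q = Q ∧ partCoprime β L = L := by
    intro h1
    obtain ⟨h2, h3⟩ := mul_eq_one.1 h1
    obtain ⟨h4, h5⟩ := mul_eq_one.1 h2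
    exact ⟨partCoprime_eq_self h.sqP h4,
      partCoprime_eq_self h.sqQ ((Nat.pow_eq_one.1 h5).resolve_right two_ne_zero),
      partCoprime_eq_self h.sqL ((Nat.pow_eq_one.1 h3).resolve_right three_ne_zero)⟩
  refine ⟨fun hβ => ?_, fun hβ => ⟨fun h1 => ?_, hfour hβ⟩⟩
  · have hdens := hone hβ s hs
    refine ⟨fun h1 => ?_, hiff, fun h1 => ?_, hdens⟩
    · obtain ⟨hP, hQ, hL⟩ := hself h1
      rwa [hP, hQ, hL, h1] at hdens
    · obtain ⟨hP, hQ, hL⟩ := hrad (hiff.1 h1)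
      have hdD : D = 2 ^ σ * (ε * dPart β P Q L) := by
        have h0 := congrArg (Nat.cast : ℕ → ℤ) (h.dPart_mul β)
        rw [hP, hQ, hL] at h0
        push_cast at h0
        rw [hD]
        linear_combination -(ε * 2 ^ σ) * h0
      have hoddd : Odd (dPart β P Q L) := by
        have hpow : Odd (P * Q ^ 2 * L ^ 3) := by
          have h1 := Nat.odd_mul.1 hodd
          have h2 := Nat.odd_mul.1 h1.1
          exact (h2.1.mul h2.2.pow).mul h1.2.pow
        exact hpow.of_dvd_nat (Dvd.intro _ (h.dPart_mul β))
      rw [hP, hQ, hL, quadTerm_one_one, quarticTerm_one] at hdens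
      rw [show D / 2 ^ σ = ε * dPart β P Q L by
          conv_lhs => rw [hdD]
          exact Int.mul_ediv_cancel_left _ (by positivity),
        ← sign_mul_neg_one_pow_half hε hoddd]
      constructor
      · convert hdens.1 using 1; ring
      · convert hdens.2 using 1; ring
  · obtain ⟨hP, hQ, hL⟩ := hself h1
    have := hfour hβ
    rwa [hP, hL] at this

theorem mainTheorem12
    (hHL : HardyLittlewoodConjecture)
    (β : ℤ) (hβ : β ≠ 0)
    (P Q L : ℕ) (hodd : Odd (P * Q * L)) (hsf : Squarefree (P * Q * L))
    (ε : ℤ) (hε : ε = 1 ∨ ε = -1) :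
    -- the case `2 ∥ D`
    (∀ D dbar : ℤ, D = ε * 2 * P * Q ^ 2 * L ^ 3 → D = dPart β P Q L * dbar →
      -- (1) `2 ∥ β`, normalised by `β ≡ 2 (mod 8)`
      (β ≡ 2 [ZMOD 8] →
        (dPart β P Q L = 1 →
          HasTraceDensity D β (1 / 4 * (1 + quadTerm P L + ε * quarticTerm P Q L 0)) ∧
          HasTraceDensity D (-β) (1 / 4 * (1 + quadTerm P L - ε * quarticTerm P Q L 0))) ∧
        ((dbar = 2 ∨ dbar = -2) ↔ (oddRad D : ℤ) ∣ β) ∧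
        ((dbar = 2 ∨ dbar = -2) →
          HasTraceDensity D β (1 / 2 * (1 + (-1 : ℝ) ^ ((D / 2 - 1) / 2))) ∧
          HasTraceDensity D (-β) (1 / 2 * (1 - (-1 : ℝ) ^ ((D / 2 - 1) / 2)))) ∧
        ((∃ l : ℕ, l.Prime ∧ Odd l ∧ (l : ℤ) ∣ dbar) →
          HasTraceDensity D β (1 / 4 * (1 + quadTerm (partCoprime β P) (partCoprime β L) +
            ε * quarticTerm (partCoprime β P) (partCoprime β Q) (partCoprime β L)
              ((dPart β P Q L - 1) / 2))) ∧
          HasTraceDensity D (-β) (1 / 4 * (1 + quadTerm (partCoprime β P) (partCoprime β L) -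
            ε * quarticTerm (partCoprime β P) (partCoprime β Q) (partCoprime β L)
              ((dPart β P Q L - 1) / 2))))) ∧
      -- (2) `4 ∣ β`
      (4 ∣ β →
        (dPart β P Q L = 1 →
          HasTraceDensity D β (1 / 4 * (1 - quadTerm P L)) ∧
          HasTraceDensity D (-β) (1 / 4 * (1 - quadTerm P L))) ∧
        HasTraceDensity D β (1 / 4 * (1 - quadTerm (partCoprime β P) (partCoprime β L))) ∧
        HasTraceDensity D (-β) (1 / 4 * (1 - quadTerm (partCoprime β P) (partCoprime β L))))) ∧
    -- the case `8 ∥ D`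
    (∀ D dbar : ℤ, D = ε * 8 * P * Q ^ 2 * L ^ 3 → D = dPart β P Q L * dbar →
      -- (1) `2 ∥ β`, normalised by `β ≡ 2 (mod 8)`
      (β ≡ 2 [ZMOD 8] →
        (dPart β P Q L = 1 →
          HasTraceDensity D β (1 / 4 * (1 + quadTerm P L - ε * quarticTerm P Q L 0)) ∧
          HasTraceDensity D (-β) (1 / 4 * (1 + quadTerm P L + ε * quarticTerm P Q L 0))) ∧
        ((dbar = 8 ∨ dbar = -8) ↔ (oddRad D : ℤ) ∣ β) ∧
        ((dbar = 8 ∨ dbar = -8) →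
          HasTraceDensity D β (1 / 2 * (1 - (-1 : ℝ) ^ ((D / 8 - 1) / 2))) ∧
          HasTraceDensity D (-β) (1 / 2 * (1 + (-1 : ℝ) ^ ((D / 8 - 1) / 2)))) ∧
        ((∃ l : ℕ, l.Prime ∧ Odd l ∧ (l : ℤ) ∣ dbar) →
          HasTraceDensity D β (1 / 4 * (1 + quadTerm (partCoprime β P) (partCoprime β L) -
            ε * quarticTerm (partCoprime β P) (partCoprime β Q) (partCoprime β L)
              ((dPart β P Q L - 1) / 2))) ∧
          HasTraceDensity D (-β) (1 / 4 * (1 + quadTerm (partCoprime β P) (partCoprime β L) +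
            ε * quarticTerm (partCoprime β P) (partCoprime β Q) (partCoprime β L)
              ((dPart β P Q L - 1) / 2))))) ∧
      -- (2) `4 ∣ β`
      (4 ∣ β →
        (dPart β P Q L = 1 →
          HasTraceDensity D β (1 / 4 * (1 - quadTerm P L)) ∧
          HasTraceDensity D (-β) (1 / 4 * (1 - quadTerm P L))) ∧
        HasTraceDensity D β (1 / 4 * (1 - quadTerm (partCoprime β P) (partCoprime β L))) ∧
        HasTraceDensity D (-β) (1 / 4 * (1 - quadTerm (partCoprime β P) (partCoprime β L))))) := by

  constructor
  · intro D dbar hD hd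
    obtain ⟨h1, h2⟩ := hHL.traceDensities hβ hodd hsf hε (σ := 1) (.inl rfl) (s := 1) rfl
      (by rw [hD, pow_one]) hd
    refine ⟨fun hβ8 => ?_, h2⟩
    have h := h1 hβ8
    simp only [pow_one, Int.cast_one, one_mul] at h
    exact ⟨h.1, h.2.1, h.2.2.1, fun _ => h.2.2.2⟩
  · intro D dbar hD hd
    obtain ⟨h1, h2⟩ := hHL.traceDensities hβ hodd hsf hε (σ := 3) (.inr rfl) (s := -1) rfl
      (by rw [hD]; norm_num) hd
    refine ⟨fun hβ8 => ?_, h2⟩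
    have h := h1 hβ8
    rw [show (2 : ℤ) ^ 3 = 8 by norm_num] at h
    simp only [Int.cast_neg, Int.cast_one, neg_one_mul, ← sub_eq_add_neg, sub_neg_eq_add] at h
    exact ⟨h.1, h.2.1, h.2.2.1, fun _ => h.2.2.2⟩
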